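/- Let $G$ be a second countable locally compact Hausdorff group, let $\mathcal H$ be a separable real affine Hilbert space with tangent Hilbert space $\mathcal H^0$, and let $\alpha: G\curvearrowright\mathcal H$, $(g,x)\mapsto gx$, be an affine isometric action, i.e. a homomorphism $G\to \mathrm{Isom}(\mathcal H)$ that is continuous for pointwise convergence. For $t>0$ let $\mathcal H^t=\{tx: x\in\mathcal H\}$ be $\mathcal H$ with the metric rescaled by $t$ (same tangent space, $tx-ty=t(x-y)$), and let $\alpha^t:G\curvearrowright \mathcal H^t$ be the action $g(tx)=t(gx)$. *Gaussian actions.* A Gaussian density of an affine Hilbert space $\mathcal K$ is a standard Borel space $\widehat{\mathcal K}$ with pairwise equivalent probability measures $(\mu_x)_{x\in\mathcal K}$ and a linear map $f\mapsto\widehat f$ from the continuous affine functions $f:\mathcal K\to\mathbf R$ to random variables modulo null sets, such that $\widehat f$ has law $\mathcal N(f(x),\|f^0\|^2)$ under $\mu_x$ for all $x$ ($f^0$ is the linear part of $f$), and the $\widehat f$ generate the $\sigma$-algebra up to null sets. The Gaussian action $\widehat\alpha^t:G\curvearrowright\widehat{\mathcal H}^t$ is the nonsingular action of $G$ on the Gaussian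 density of $\mathcal H^t$ with $g_*\mu_{z}=\mu_{gz}$ for all $g\in G$, $z\in\mathcal H^t$. For $\varphi\in\widehat{\mathcal H}^0$ (the Gaussian density of the linear Hilbert space $\mathcal H^0$) and $\xi\in\mathcal H^0$, write $\langle\varphi,\xi\rangle=\widehat{\langle\cdot,\xi\rangle}(\varphi)$, in a version that is jointly measurable in $(\varphi,\xi)$. *Dissipativity and recurrence.* Let $\sigma$ be a nonsingular action of $G$ on $X$ and $T(f)(\omega)=\int_G f(g^{-1}\omega)\,dm(g)$ for measurable $f: X\to[0,\infty]$, where $m$ is a left Haar measure. Then $\sigma$ is dissipative if $\{f: T(f)<\infty \text{ a.e.}\}$ is dense, for convergence in measure, in the space of all measurable $f:X\to[0,\infty]$, and $\sigma$ is recurrent if $T(f)=\infty$ a.e. for every $f>0$. *Poincaré exponent.* $\delta(\alpha)\in[0,\infty]$ is the infimum of all $s>0$ with $\int_G e^{-s\|gx-y\|^2}\,dm(g)<\infty$, where $x,y\in\mathcal H$ and $m$ is a left or right Haar measure. **Theorem.** The Gaussian actions $\widehat\alpha^t$ ($t>0$) and the jointly measurable pairing $\langle\varphi,\xi\rangle$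 exist, and $\delta(\alpha)$ does not depend on the choice of $x,y$ and $m$. There is $t_{\rm diss}(\alpha)\in[0,\infty]$ such that $\widehat\alpha^t$ is recurrent for all $0<t<t_{\rm diss}(\alpha)$ and dissipative for all $t>t_{\rm diss}(\alpha)$, and $$\sqrt{2\delta(\alpha)}\le t_{\rm diss}(\alpha)\le 2\sqrt{2\delta(\alpha)}.$$ Moreover, for all $t>0$, all $x,y\in\mathcal H$ and every right Haar measure $dg$ on $G$, the action $\widehat\alpha^t$ is dissipative (resp. recurrent) if and only if the integral $$\int_G\exp\Big(-\tfrac12t^2\|gx-y\|^2+t\langle\varphi,gx-y\rangle\Big)\,dg$$ is finite (resp. infinite) for almost every $\varphi\in\widehat{\mathcal H}^0$. These statements hold for every choice of the Gaussian densities, of the jointly measurable realization of $\widehat\alpha^t$, of the version of the pairing, and of the left Haar measure in the definition of $T$. -/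

import Mathlib

open MeasureTheory ProbabilityTheory Filter Topology
open scoped ENNReal NNReal

noncomputable section

/-! ### Affine isometric actions and inflations -/

/-- An affine isometric action of `G` on the affine Hilbert space `P` with tangent space `V`:
a group homomorphism into the affine isometry group, continuous for the topology of pointwise
convergence. -/
structure AffineIsometricAction (G V P : Type*) [Group G] [TopologicalSpace G]
    [NormedAddCommGroup V] [InnerProductSpace ℝ V] [MetricSpace P] [NormedAddTorsor V P] where
  toHom : G →* (P ≃ᵃⁱ[ℝ] P)
  continuous_orbit : ∀ x : P, Continuous fun g => toHom g x

/-- The inflation `P^t` of `P`; its element `⟨x⟩` is the point written `t x`. -/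
@[ext]
structure Inflation (t : {t : ℝ // 0 < t}) (P : Type*) where
  point : P

namespace Inflation

variable {t : {t : ℝ // 0 < t}} {V P : Type*}

/-- The metric rescaled by `t`. -/
instance [MetricSpace P] : MetricSpace (Inflation t P) where
  dist p q := t.1 * dist p.point q.point
  dist_self p := by simp
  dist_comm p q := by simp [dist_comm]
  dist_triangle p q r := by
    rw [← mul_add]
    exact mul_le_mul_of_nonneg_left (dist_triangle _ _ _) t.2.le
  eq_of_dist_eq_zero {p q} h := by
    have h' : t.1 = 0 ∨ dist p.point q.point = 0 := mul_eq_zero.mp h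
    exact Inflation.ext (dist_eq_zero.mp (h'.resolve_left t.2.ne'))

/-- The same tangent space acts on `P^t`, in such a way that `t x - t y = t (x - y)`. -/
instance [NormedAddCommGroup V] [InnerProductSpace ℝ V] [MetricSpace P] [NormedAddTorsor V P] :
    NormedAddTorsor V (Inflation t P) where
  vadd v p := ⟨(t.1⁻¹ • v) +ᵥ p.point⟩
  vsub p q := t.1 • (p.point -ᵥ q.point)
  zero_vadd p := by
    apply Inflation.ext
    change (t.1⁻¹ • (0 : V)) +ᵥ p.point = p.point
    simp
  add_vadd v w p := by
    apply Inflation.ext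
    change (t.1⁻¹ • (v + w)) +ᵥ p.point = (t.1⁻¹ • v) +ᵥ ((t.1⁻¹ • w) +ᵥ p.point)
    rw [smul_add, add_vadd]
  nonempty := ⟨⟨(AddTorsor.nonempty (G := V) (P := P)).some⟩⟩
  vsub_vadd' p q := by
    apply Inflation.ext
    change (t.1⁻¹ • (t.1 • (p.point -ᵥ q.point))) +ᵥ q.point = p.point
    rw [smul_smul, inv_mul_cancel₀ t.2.ne', one_smul, vsub_vadd]
  vadd_vsub' v p := by
    change t.1 • (((t.1⁻¹ • v) +ᵥ p.point) -ᵥ p.point) = v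
    rw [vadd_vsub, smul_smul, mul_inv_cancel₀ t.2.ne', one_smul]
  dist_eq_norm' p q := by
    change t.1 * dist p.point q.point = ‖t.1 • (p.point -ᵥ q.point : V)‖
    rw [norm_smul, Real.norm_of_nonneg t.2.le, dist_eq_norm_vsub V]

variable [NormedAddCommGroup V] [InnerProductSpace ℝ V] [MetricSpace P] [NormedAddTorsor V P]

/-- The isometry `g^t` of `P^t`, given by `g^t (t x) = t g(x)`. -/
def mapIsometry (t : {t : ℝ // 0 < t}) (g : P ≃ᵃⁱ[ℝ] P) :
    Inflation t P ≃ᵃⁱ[ℝ] Inflation t P :=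
  AffineIsometryEquiv.mk' (fun p => ⟨g p.point⟩) g.linearIsometryEquiv
    ⟨(AddTorsor.nonempty (G := V) (P := P)).some⟩ (by
      intro p
      apply Inflation.ext
      change g p.point = (t.1⁻¹ • g.linearIsometryEquiv (t.1 • (p.point -ᵥ _))) +ᵥ g _
      rw [map_smul, smul_smul, inv_mul_cancel₀ t.2.ne', one_smul, AffineIsometryEquiv.map_vsub,
        vsub_vadd])

end Inflation

section Actions

variable {G V P : Type*} [Group G] [TopologicalSpace G]
  [NormedAddCommGroup V] [InnerProductSpace ℝ V] [MetricSpace P] [NormedAddTorsor V P]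

/-- The inflated action `α^t` on `P^t`, given by `α^t_g (t x) = t α_g(x)`. -/
def AffineIsometricAction.inflate (α : AffineIsometricAction G V P) (t : {t : ℝ // 0 < t}) :
    AffineIsometricAction G V (Inflation t P) where
  toHom :=
    { toFun := fun g => Inflation.mapIsometry t (α.toHom g)
      map_one' := by
        ext p
        change α.toHom 1 p.point = p.point
        simp
      map_mul' := fun g h => by
        ext p
        change α.toHom (g * h) p.point = α.toHom g (α.toHom h p.point)
        simp }
  continuous_orbit x := by
    have h : Continuous fun g => α.toHom g x.point := α.continuous_orbit x.point
    rw [continuous_iff_continuousAt] at h ⊢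
    intro g
    have hg := (tendsto_iff_dist_tendsto_zero.mp (h g)).const_mul t.1
    rw [mul_zero] at hg
    exact tendsto_iff_dist_tendsto_zero.mpr hg

/-- Right Haar measures; left Haar measures are Mathlib's `IsHaarMeasure`. -/
structure IsRightHaarMeasure [MeasurableSpace G] (m : Measure G) : Prop where
  finiteOnCompacts : IsFiniteMeasureOnCompacts m
  rightInvariant : m.IsMulRightInvariant
  openPos : m.IsOpenPosMeasure

/-- The exponent of convergence in `[0, ∞]` of the quadratic Poincaré integral
`∫ exp (-s ‖g x - y‖²) dm(g)`. -/
def poincareExponent [MeasurableSpace G] (α : AffineIsometricAction G V P) (m : Measure G)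
    (x y : P) : ℝ≥0∞ :=
  sInf {r : ℝ≥0∞ | ∃ s : ℝ, 0 < s ∧ r = ENNReal.ofReal s ∧
    ∫⁻ g, ENNReal.ofReal (Real.exp (-s * ‖α.toHom g x -ᵥ y‖ ^ 2)) ∂m < ∞}

end Actions

/-! ### Nonsingular actions, dissipativity, recurrence -/

/-- A nonsingular action of `G` on the nonsingular space given by `X` and the measure class of
`ν`, realized by a jointly Borel map; the identities of an action hold up to null sets. -/
structure NonsingularAction (G : Type*) {X : Type*} [Group G] [MeasurableSpace G]
    [MeasurableSpace X] (ν : Measure X) where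
  toFun : G → X → X
  measurable : Measurable fun p : G × X => toFun p.1 p.2
  nonsingular : ∀ g, Measure.QuasiMeasurePreserving (toFun g) ν ν
  one_ae : ∀ᵐ ω ∂ν, toFun 1 ω = ω
  mul_ae : ∀ g h, ∀ᵐ ω ∂ν, toFun (g * h) ω = toFun g (toFun h ω)

namespace NonsingularAction

variable {G X : Type*} [Group G] [MeasurableSpace G] [MeasurableSpace X] {ν : Measure X}

/-- The fibered Haar measure `T(f) = ∫ σ_g(f) dm(g)`, where `σ_g(f) = f ∘ σ_g⁻¹`. -/
def fiberedHaar (σ : NonsingularAction G ν) (m : Measure G) (f : X → ℝ≥0∞) (ω : X) : ℝ≥0∞ :=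
  ∫⁻ g, f (σ.toFun g⁻¹ ω) ∂m

/-- The action is dissipative: its fibered Haar measure `T` is semifinite, i.e. the functions
`f` with `T(f) < ∞` are dense in `L⁰(X, [0, ∞])` for convergence in measure. (A function is in
the closure of a set for convergence in measure iff it is the almost everywhere limit of a
sequence in that set.) -/
def IsDissipative (σ : NonsingularAction G ν) (m : Measure G) : Prop :=
  ∀ f : X → ℝ≥0∞, Measurable f → ∃ F : ℕ → X → ℝ≥0∞,
    (∀ n, Measurable (F n) ∧ ∀ᵐ ω ∂ν, σ.fiberedHaar m (F n) ω < ∞) ∧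
    ∀ᵐ ω ∂ν, Tendsto (fun n => F n ω) atTop (𝓝 (f ω))

/-- The action is recurrent: its fibered Haar measure `T` is purely infinite, i.e. `T(f) = ∞`
for every strictly positive `f`. -/
def IsRecurrent (σ : NonsingularAction G ν) (m : Measure G) : Prop :=
  ∀ f : X → ℝ≥0∞, Measurable f → (∀ᵐ ω ∂ν, 0 < f ω) → ∀ᵐ ω ∂ν, σ.fiberedHaar m f ω = ∞

end NonsingularAction

/-! ### Gaussian densities and Gaussian actions -/

/-- A Gaussian density on `X` for the affine Hilbert space `P`: equivalent probability measures
`μ x`, `x ∈ P`, and a linear map `f ↦ hat f` from the continuous affine functions on `P` to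
random variables on `X` modulo null sets, such that `hat f` has law `N(f(x), ‖f⁰‖²)` under `μ x`
and the `hat f` generate the `σ`-algebra of `X` up to null sets. -/
structure GaussianDensity (V P X : Type*) [NormedAddCommGroup V] [InnerProductSpace ℝ V]
    [MetricSpace P] [NormedAddTorsor V P] [MeasurableSpace X] where
  μ : P → Measure X
  isProbabilityMeasure : ∀ x, IsProbabilityMeasure (μ x)
  equivalent : ∀ x y, μ x ≪ μ y
  hat : (P →ᴬ[ℝ] ℝ) → X → ℝ
  measurable_hat : ∀ f, Measurable (hat f)
  hat_add : ∀ f g x, ∀ᵐ ω ∂(μ x), hat (f + g) ω = hat f ω + hat g ω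
  hat_smul : ∀ (c : ℝ) f x, ∀ᵐ ω ∂(μ x), hat (c • f) ω = c * hat f ω
  law_hat : ∀ f x, (μ x).map (hat f) = gaussianReal (f x) (‖f.contLinear‖₊ ^ 2)
  generates : ∀ A, MeasurableSet A → ∃ B,
    MeasurableSet[⨆ f, MeasurableSpace.comap (hat f) inferInstance] B ∧ ∀ x, A =ᵐ[μ x] B

section Gaussian

variable {G V P X : Type*} [Group G] [TopologicalSpace G] [MeasurableSpace G]
  [NormedAddCommGroup V] [InnerProductSpace ℝ V] [MetricSpace P] [NormedAddTorsor V P]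
  [MeasurableSpace X]

/-- A member of the family `μ x`, used only through its null sets, which are those of every
`μ x`. -/
def GaussianDensity.refMeasure (D : GaussianDensity V P X) : Measure X :=
  D.μ (AddTorsor.nonempty (G := V) (P := P)).some

/-- The nonsingular Gaussian action of `α` on a Gaussian density: the automorphism attached to
`g` maps `μ x` to `μ (g x)` for all `x`. -/
structure GaussianAction (α : AffineIsometricAction G V P) (D : GaussianDensity V P X) extends
    NonsingularAction G D.refMeasure where
  map_eq : ∀ g x, (D.μ x).map (toFun g) = D.μ (α.toHom g x)

/-- A jointly measurable version of the random linear functional `⟨φ, ξ⟩`, for `ξ` in the Hilbert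
space `V` and `φ` in a Gaussian density of `V`. -/
structure GaussianPairing (D : GaussianDensity V V X) [MeasurableSpace V] where
  toFun : X → V → ℝ
  measurable : Measurable fun p : X × V => toFun p.1 p.2
  eq_hat : ∀ ξ : V, ∀ᵐ φ ∂D.refMeasure,
    toFun φ ξ = D.hat (innerSL ℝ ξ).toContinuousAffineMap φ

/-- The integral `∫ exp (-(1/2) t² ‖g x - y‖² + t ⟨φ, g x - y⟩) dm(g)`. -/
def gaussianIntegral {D : GaussianDensity V V X} [MeasurableSpace V]
    (α : AffineIsometricAction G V P) (L : GaussianPairing D) (m : Measure G) (t : ℝ) (x y : P)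
    (φ : X) : ℝ≥0∞ :=
  ∫⁻ g, ENNReal.ofReal (Real.exp (-(1 / 2) * t ^ 2 * ‖α.toHom g x -ᵥ y‖ ^ 2
    + t * L.toFun φ (α.toHom g x -ᵥ y))) ∂m

end Gaussian

end

/-! Everything is computed in one model: the sequence space `ι → ℝ` with the product Gaussian
measure and a jointly measurable white noise `L`, a version of `ξ ↦ ⟨ω, ξ⟩`. Hilbert basis
coordinates carry every Gaussian density, every Gaussian action and every pairing to this model.
Measures with finite Laplace transforms are identified by those transforms; this yields the
Cameron–Martin formula dμ_z/dμ_y = exp(⟨ω, z - y⟩ - ‖z - y‖²/2).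

Criterion. Since g_*μ_x = μ_{gx}, Fubini gives ∫ T(f) dμ_x = ∫ f R dμ_y with R = ∫ dμ_{g⁻¹x}/dμ_y
dm(g). The set {T(f) ≤ n} is invariant, so the identity localizes to it. Dissipativity thus means R
< ∞ a.e., and recurrence means R = ∞ a.e. (`isDissipative_iff`, `isRecurrent_iff`). Inverting g
turns R into the integral I_t over a right Haar measure.

Threshold. If a² + c² = 1 and ω' is an independent noise, the mean of I_t(aω + cω') over ω' is
I_{ta}(ω). This averaging is the Ornstein–Uhlenbeck semigroup, which is positivity improving because
translation invariant sets are null or conull. So if I_t is infinite with positive probability, then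
I_s = ∞ almost surely for every s < t (`ae_noiseIntegral_eq_top`).

Lower bound. If I_t is almost surely finite, some ω has I_t(ω) and I_t(-ω) both finite; as e^u +
e^{-u} ≥ 1, the Poincaré integral at t²/2 converges, so δ ≤ t²/2.

Upper bound. The square root of the weight exp(-t²d²/2 + t⟨ω, gx - y⟩), where d = ‖gx - y‖, has mean
exp(-t²d²/8). If δ < t²/8, these square roots are almost surely integrable. On a discrete group
ℓ^{1/2} ⊂ ℓ¹ would finish; in general the weight is first averaged over translates of a compact
neighbourhood of 1 (`lintegral_rpow_localAverage_le`, `lintegral_lt_top_of_rpow_localAverage`). -/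

/-- The exponential of a real number, as an extended nonnegative number. -/
noncomputable def eexp (x : ℝ) : ℝ≥0∞ := ENNReal.ofReal (Real.exp x)

theorem eexp_add (x y : ℝ) : eexp (x + y) = eexp x * eexp y := by
  rw [eexp, Real.exp_add, ENNReal.ofReal_mul (Real.exp_pos x).le, eexp, eexp]

theorem eexp_ne_top (x : ℝ) : eexp x ≠ ∞ := ENNReal.ofReal_ne_top

theorem eexp_lt_top (x : ℝ) : eexp x < ∞ := ENNReal.ofReal_lt_top

theorem eexp_pos (x : ℝ) : 0 < eexp x := ENNReal.ofReal_pos.2 (Real.exp_pos x)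

theorem eexp_ne_zero (x : ℝ) : eexp x ≠ 0 := (eexp_pos x).ne'

theorem eexp_zero : eexp 0 = 1 := by simp [eexp]

theorem eexp_le_eexp {x y : ℝ} (h : x ≤ y) : eexp x ≤ eexp y :=
  ENNReal.ofReal_le_ofReal (Real.exp_le_exp.2 h)

@[fun_prop]
theorem measurable_eexp : Measurable eexp := by
  unfold eexp
  fun_prop

@[fun_prop]
theorem Measurable.eexp {Ω : Type*} [MeasurableSpace Ω] {f : Ω → ℝ} (hf : Measurable f) :
    Measurable fun ω => eexp (f ω) := measurable_eexp.comp hf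

/-! ### Laplace transforms determine measures. -/

section Laplace

variable {Ω Ω' : Type*} [MeasurableSpace Ω] [MeasurableSpace Ω']

theorem integrable_exp_of_lintegral_eexp {μ : Measure Ω} {X : Ω → ℝ} (hX : Measurable X)
    (h : ∫⁻ ω, eexp (X ω) ∂μ ≠ ∞) : Integrable (fun ω => Real.exp (X ω)) μ := by
  refine ⟨by fun_prop, ?_⟩
  rw [hasFiniteIntegral_iff_ofReal (ae_of_all _ fun ω => (Real.exp_pos _).le)]
  exact h.lt_top

theorem integral_exp_eq_toReal (μ : Measure Ω) {X : Ω → ℝ} (hX : Measurable X) :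
    ∫ ω, Real.exp (X ω) ∂μ = (∫⁻ ω, eexp (X ω) ∂μ).toReal :=
  integral_eq_lintegral_of_nonneg_ae (ae_of_all _ fun ω => (Real.exp_pos _).le) (by fun_prop)

theorem lintegral_eexp_gaussianReal (m : ℝ) (v : ℝ≥0) (c : ℝ) :
    ∫⁻ x, eexp (c * x) ∂gaussianReal m v = eexp (m * c + v * c ^ 2 / 2) := by
  have hfin : ∫⁻ x, eexp (c * x) ∂gaussianReal m v ≠ ∞ :=
    ((hasFiniteIntegral_iff_ofReal (ae_of_all _ fun ω => (Real.exp_pos _).le)).1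
      (integrable_exp_mul_gaussianReal c).2).ne
  have h2 := congrFun (mgf_fun_id_gaussianReal (μ := m) (v := v)) c
  rw [← ENNReal.ofReal_toReal hfin, ← integral_exp_eq_toReal _ (by fun_prop), eexp, ← h2, mgf]

/-- The law of a random variable is determined by its Laplace transform, if that is finite. -/
theorem map_eq_of_lintegral_eexp {μ : Measure Ω} {μ' : Measure Ω'} [IsFiniteMeasure μ]
    [IsFiniteMeasure μ'] {X : Ω → ℝ} {Y : Ω' → ℝ} (hX : Measurable X) (hY : Measurable Y)
    (h : ∀ s : ℝ, ∫⁻ ω, eexp (s * X ω) ∂μ = ∫⁻ ω, eexp (s * Y ω) ∂μ')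
    (hfin : ∀ s : ℝ, ∫⁻ ω, eexp (s * X ω) ∂μ ≠ ∞) : μ.map X = μ'.map Y := by
  -- Finiteness at every real s makes the complex moment generating function analytic on the whole
  -- plane, so agreement on the real line suffices.
  apply Measure.ext_of_complexMGF_eq hX.aemeasurable hY.aemeasurable
  have hset : integrableExpSet X μ = Set.univ := by
    ext s
    simpa [integrableExpSet] using
      integrable_exp_of_lintegral_eexp (hX.const_mul s) (hfin s)
  have hmgf : mgf X μ = mgf Y μ' := by
    ext s
    rw [mgf, mgf, integral_exp_eq_toReal μ (hX.const_mul s),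
      integral_exp_eq_toReal μ' (hY.const_mul s), h]
  have h0 : μ = 0 ↔ μ' = 0 := by
    have := h 0
    simp only [zero_mul, eexp_zero, lintegral_one] at this
    rw [← Measure.measure_univ_eq_zero, ← Measure.measure_univ_eq_zero, this]
  funext z
  exact eqOn_complexMGF_of_mgf' hmgf h0 (by simp [hset])

/-- A finite measure on a product of lines is determined by its Laplace transform. -/
theorem Measure.pi_ext_of_lintegral_eexp {κ : Type*} {μ ν : Measure (κ → ℝ)} [IsFiniteMeasure μ]
    [IsFiniteMeasure ν]
    (h : ∀ (s : Finset κ) (c : κ → ℝ), ∫⁻ ω, eexp (∑ k ∈ s, c k * ω k) ∂μ =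
      ∫⁻ ω, eexp (∑ k ∈ s, c k * ω k) ∂ν)
    (hfin : ∀ (s : Finset κ) (c : κ → ℝ), ∫⁻ ω, eexp (∑ k ∈ s, c k * ω k) ∂μ ≠ ∞) :
    μ = ν := by
  classical
  -- Finite-dimensional marginals determine the measure, and each marginal is determined by the laws
  -- of its linear functionals (Cramér–Wold).
  refine IsProjectiveLimit.unique (P := fun I => ν.map I.restrict) ?_ fun I => rfl
  intro I
  apply Measure.ext_of_charFunDual
  funext L
  have hL : Measurable L := L.continuous.measurable
  have hr : Measurable (I.restrict : (κ → ℝ) → (I → ℝ)) := Finset.measurable_restrict I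
  rw [charFunDual_eq_charFun_map_one, charFunDual_eq_charFun_map_one, Measure.map_map hL hr,
    Measure.map_map hL hr]
  congr 1
  have key : ∀ (s : ℝ) (ω : κ → ℝ), s * (L ∘ I.restrict) ω =
      ∑ k ∈ I, (if hk : k ∈ I then s * L (Pi.single ⟨k, hk⟩ 1) else 0) * ω k := by
    intro s ω
    have hsum : (I.restrict ω : I → ℝ) = ∑ k : I, ω k • Pi.single k (1 : ℝ) := by
      ext j
      simp [Finset.sum_apply, Pi.single_apply]
    rw [← Finset.sum_coe_sort I, Function.comp_apply, hsum, map_sum, Finset.mul_sum]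
    refine Finset.sum_congr rfl fun k _ => ?_
    simp only [map_smul, smul_eq_mul, Finset.coe_mem, dif_pos]
    ring
  refine map_eq_of_lintegral_eexp (hL.comp hr) (hL.comp hr) (fun s => ?_) fun s => ?_
  · simp_rw [key]
    exact h _ _
  · simp_rw [key]
    exact hfin _ _

end Laplace

/-! ### Isonormal Gaussian processes. -/

section Isonormal

variable {V Ω Ω' : Type*} [NormedAddCommGroup V] [InnerProductSpace ℝ V] [MeasurableSpace Ω]
  [MeasurableSpace Ω']

/-- `H` is a centered Gaussian process indexed by `V` whose covariance is the inner product. -/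
structure IsIsonormal (H : V → Ω → ℝ) (μ : Measure Ω) : Prop where
  measurable : ∀ ξ, Measurable (H ξ)
  add : ∀ ξ η, ∀ᵐ ω ∂μ, H (ξ + η) ω = H ξ ω + H η ω
  smul : ∀ (c : ℝ) ξ, ∀ᵐ ω ∂μ, H (c • ξ) ω = c * H ξ ω
  lintegral_eexp : ∀ ξ, ∫⁻ ω, eexp (H ξ ω) ∂μ = eexp (‖ξ‖ ^ 2 / 2)

namespace IsIsonormal

variable {H K : V → Ω → ℝ} {μ : Measure Ω}

theorem zero_ae (hH : IsIsonormal H μ) : ∀ᵐ ω ∂μ, H 0 ω = 0 := by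
  filter_upwards [hH.smul 0 0] with ω hω
  simpa using hω

theorem sub_ae (hH : IsIsonormal H μ) (ξ η : V) : ∀ᵐ ω ∂μ, H (ξ - η) ω = H ξ ω - H η ω := by
  filter_upwards [hH.add ξ ((-1 : ℝ) • η), hH.smul (-1) η] with ω h1 h2
  rw [sub_eq_add_neg, ← neg_one_smul ℝ η, h1, h2]
  ring

theorem sum_ae {κ : Type*} (hH : IsIsonormal H μ) (s : Finset κ) (c : κ → ℝ) (v : κ → V) :
    ∀ᵐ ω ∂μ, H (∑ k ∈ s, c k • v k) ω = ∑ k ∈ s, c k * H (v k) ω := by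
  classical
  induction s using Finset.induction_on with
  | empty => simpa using hH.zero_ae
  | insert k s hk ih =>
    filter_upwards [ih, hH.add (c k • v k) (∑ k ∈ s, c k • v k), hH.smul (c k) (v k)]
      with ω h1 h2 h3
    rw [Finset.sum_insert hk, Finset.sum_insert hk, h2, h3, h1]

theorem isProbabilityMeasure (hH : IsIsonormal H μ) : IsProbabilityMeasure μ := by
  constructor
  have h := hH.lintegral_eexp 0
  rw [lintegral_congr_ae (g := fun _ => 1)] at h
  · simpa [eexp_zero] using h
  · filter_upwards [hH.zero_ae] with ω hω
    rw [hω, eexp_zero]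

theorem lintegral_eexp_smul (hH : IsIsonormal H μ) (s : ℝ) (ξ : V) :
    ∫⁻ ω, eexp (s * H ξ ω) ∂μ = eexp (‖s • ξ‖ ^ 2 / 2) := by
  rw [← hH.lintegral_eexp (s • ξ)]
  refine lintegral_congr_ae ?_
  filter_upwards [hH.smul s ξ] with ω hω
  rw [hω]

theorem enorm_le_eexp_add (x : ℝ) : ‖x‖ₑ ≤ eexp x + eexp (-x) := by
  rw [eexp, eexp, ← ENNReal.ofReal_add (Real.exp_pos _).le (Real.exp_pos _).le,
    Real.enorm_eq_ofReal_abs]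
  apply ENNReal.ofReal_le_ofReal
  have h1 := Real.add_one_le_exp x
  have h2 := Real.add_one_le_exp (-x)
  have h3 := Real.exp_pos x
  have h4 := Real.exp_pos (-x)
  rcases abs_cases x with ⟨h, _⟩ | ⟨h, _⟩ <;> rw [h] <;> linarith

/-- For a unit vector, `|H| ≤ e^H + e^{-H}` bounds the first moment; scaling does the rest. Only the
resulting L¹ continuity of `ξ ↦ H ξ` matters, not the constant. -/
theorem lintegral_enorm_le (hH : IsIsonormal H μ) (ξ : V) :
    ∫⁻ ω, ‖H ξ ω‖ₑ ∂μ ≤ 2 * eexp (1 / 2) * ‖ξ‖ₑ := by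
  have unit : ∀ η : V, ‖η‖ = 1 → ∫⁻ ω, ‖H η ω‖ₑ ∂μ ≤ 2 * eexp (1 / 2) := by
    intro η hη
    calc ∫⁻ ω, ‖H η ω‖ₑ ∂μ ≤ ∫⁻ ω, (eexp (1 * H η ω) + eexp ((-1) * H η ω)) ∂μ := by
          refine lintegral_mono fun ω => ?_
          simpa using enorm_le_eexp_add (H η ω)
      _ = 2 * eexp (1 / 2) := by
          have := hH.measurable η
          rw [lintegral_add_left (by fun_prop), hH.lintegral_eexp_smul, hH.lintegral_eexp_smul]
          simp [hη, two_mul]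
  by_cases h0 : ξ = 0
  · subst h0
    rw [lintegral_congr_ae (g := fun _ => 0)]
    · simp
    · filter_upwards [hH.zero_ae] with ω hω
      simp [hω]
  · have hn : ‖ξ‖ ≠ 0 := norm_ne_zero_iff.2 h0
    have h1 : ∫⁻ ω, ‖H ξ ω‖ₑ ∂μ = ∫⁻ ω, ‖ξ‖ₑ * ‖H (‖ξ‖⁻¹ • ξ) ω‖ₑ ∂μ := by
      refine lintegral_congr_ae ?_
      filter_upwards [hH.smul ‖ξ‖⁻¹ ξ] with ω hω
      rw [hω, enorm_mul, ← mul_assoc, ← enorm_norm ξ, ← enorm_mul, mul_inv_cancel₀ hn]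
      simp
    have := hH.measurable (‖ξ‖⁻¹ • ξ)
    rw [h1, lintegral_const_mul _ (by fun_prop), mul_comm]
    gcongr
    apply unit
    rw [norm_smul, norm_inv, norm_norm, inv_mul_cancel₀ hn]

theorem lintegral_enorm_sub_le (hH : IsIsonormal H μ) (ξ η : V) :
    ∫⁻ ω, ‖H ξ ω - H η ω‖ₑ ∂μ ≤ 2 * eexp (1 / 2) * ‖ξ - η‖ₑ := by
  refine le_trans (le_of_eq (lintegral_congr_ae ?_)) (hH.lintegral_enorm_le (ξ - η))
  filter_upwards [hH.sub_ae ξ η] with ω hω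
  rw [hω]

/-- Two isonormal processes that agree on a total family agree. -/
theorem ae_eq_of_dense {κ : Type*} (hH : IsIsonormal H μ) (hK : IsIsonormal K μ) {v : κ → V}
    (hv : Dense (Submodule.span ℝ (Set.range v) : Set V))
    (h : ∀ k, ∀ᵐ ω ∂μ, H (v k) ω = K (v k) ω) (ξ : V) : ∀ᵐ ω ∂μ, H ξ ω = K ξ ω := by
  have hspan : ∀ η ∈ Submodule.span ℝ (Set.range v), ∀ᵐ ω ∂μ, H η ω = K η ω := by
    intro η hη
    induction hη using Submodule.span_induction with
    | mem x hx =>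
      obtain ⟨k, rfl⟩ := hx
      exact h k
    | zero =>
      filter_upwards [hH.zero_ae, hK.zero_ae] with ω h1 h2
      rw [h1, h2]
    | add x y _ _ hx hy =>
      filter_upwards [hH.add x y, hK.add x y, hx, hy] with ω h1 h2 h3 h4
      rw [h1, h2, h3, h4]
    | smul c x _ hx =>
      filter_upwards [hH.smul c x, hK.smul c x, hx] with ω h1 h2 h3
      rw [h1, h2, h3]
  have hHm := hH.measurable
  have hKm := hK.measurable
  set C : ℝ≥0∞ := 2 * eexp (1 / 2) with hC
  have hCtop : C ≠ ∞ := ENNReal.mul_ne_top (by simp) (eexp_ne_top _)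
  -- Both processes agree at `η`, so their difference at `ξ` is controlled by the distance from `ξ`
  -- to the span, which is zero.
  have bound : ∀ η ∈ Submodule.span ℝ (Set.range v),
      ∫⁻ ω, ‖H ξ ω - K ξ ω‖ₑ ∂μ ≤ (C + C) * ‖ξ - η‖ₑ := by
    intro η hη
    calc ∫⁻ ω, ‖H ξ ω - K ξ ω‖ₑ ∂μ ≤ ∫⁻ ω, (‖H ξ ω - H η ω‖ₑ + ‖K ξ ω - K η ω‖ₑ) ∂μ := by
          refine lintegral_mono_ae ?_
          filter_upwards [hspan η hη] with ω hω
          have : H ξ ω - K ξ ω = (H ξ ω - H η ω) - (K ξ ω - K η ω) := by rw [hω]; ring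
          rw [this]
          exact enorm_sub_le
      _ ≤ (C + C) * ‖ξ - η‖ₑ := by
          have h1 := hHm ξ
          have h2 := hHm η
          rw [lintegral_add_left (by fun_prop), add_mul]
          exact add_le_add (hH.lintegral_enorm_sub_le ξ η) (hK.lintegral_enorm_sub_le ξ η)
  have hzero : ∫⁻ ω, ‖H ξ ω - K ξ ω‖ₑ ∂μ = 0 := by
    obtain ⟨u, hu, hlim⟩ := mem_closure_iff_seq_limit.1 (hv ξ)
    have ht : Tendsto (fun n => (C + C) * ‖ξ - u n‖ₑ) atTop (𝓝 ((C + C) * ‖ξ - ξ‖ₑ)) := by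
      refine ENNReal.Tendsto.const_mul ?_ (Or.inr (ENNReal.add_ne_top.2 ⟨hCtop, hCtop⟩))
      exact (continuous_enorm.tendsto _).comp (tendsto_const_nhds.sub hlim)
    rw [sub_self, enorm_zero, mul_zero] at ht
    exact le_antisymm (ge_of_tendsto' ht fun n => bound _ (hu n)) zero_le
  have h1 := hHm ξ
  have h2 := hKm ξ
  rw [lintegral_eq_zero_iff (by fun_prop)] at hzero
  filter_upwards [hzero] with ω hω
  exact sub_eq_zero.1 (enorm_eq_zero.1 hω)

/-- The law of an isonormal process after an exponential change of measure. -/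
theorem lintegral_eexp_withDensity (hH : IsIsonormal H μ) (ζ ξ : V) :
    ∫⁻ ω, eexp (H ξ ω) ∂(μ.withDensity fun ω => eexp (H ζ ω - ‖ζ‖ ^ 2 / 2)) =
      eexp (inner ℝ ξ ζ + ‖ξ‖ ^ 2 / 2) := by
  have h1 := hH.measurable ζ
  have h2 := hH.measurable ξ
  rw [lintegral_withDensity_eq_lintegral_mul _ (by fun_prop) (by fun_prop)]
  have : ∫⁻ ω, ((fun ω => eexp (H ζ ω - ‖ζ‖ ^ 2 / 2)) * fun ω => eexp (H ξ ω)) ω ∂μ =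
      ∫⁻ ω, eexp (-(‖ζ‖ ^ 2 / 2)) * eexp (H (ζ + ξ) ω) ∂μ := by
    refine lintegral_congr_ae ?_
    filter_upwards [hH.add ζ ξ] with ω hω
    rw [Pi.mul_apply, hω, ← eexp_add, ← eexp_add]
    congr 1
    ring
  have h3 := hH.measurable (ζ + ξ)
  rw [this, lintegral_const_mul _ (by fun_prop), hH.lintegral_eexp, ← eexp_add,
    norm_add_sq_real, real_inner_comm]
  congr 1
  ring

/-- Composition with a measure preserving map. -/
theorem comp {μ' : Measure Ω'} (hH : IsIsonormal H μ) {φ : Ω' → Ω} (hφ : MeasurePreserving φ μ' μ) :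
    IsIsonormal (fun ξ ω => H ξ (φ ω)) μ' where
  measurable ξ := (hH.measurable ξ).comp hφ.measurable
  add ξ η := hφ.quasiMeasurePreserving.ae (hH.add ξ η)
  smul c ξ := hφ.quasiMeasurePreserving.ae (hH.smul c ξ)
  lintegral_eexp ξ := by
    have := hH.measurable ξ
    rw [← hH.lintegral_eexp ξ, hφ.lintegral_comp (f := fun ω => eexp (H ξ ω)) (by fun_prop)]

end IsIsonormal

end Isonormal

/-! ### Construction of the white noise. -/

section WhiteNoise

variable {V : Type*} [NormedAddCommGroup V] [InnerProductSpace ℝ V]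

/-- Distinct orthonormal vectors are at distance √2, so the balls of radius 1/2 around them are
disjoint open sets. -/
theorem Orthonormal.countable_of_separable [TopologicalSpace.SeparableSpace V] {κ : Type*}
    {v : κ → V} (hv : Orthonormal ℝ v) : Countable κ := by
  have hdist : ∀ i j, i ≠ j → 1 ≤ dist (v i) (v j) := by
    intro i j hij
    have h : dist (v i) (v j) ^ 2 = 2 := by
      rw [dist_eq_norm, norm_sub_sq_real, hv.1 i, hv.1 j, hv.2 hij]
      norm_num
    nlinarith [dist_nonneg (x := v i) (y := v j)]
  have hd : (Set.univ : Set κ).PairwiseDisjoint fun i => Metric.ball (v i) (1 / 2) := by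
    intro i _ j _ hij
    refine Metric.ball_disjoint_ball ?_
    have := hdist i j hij
    linarith
  have := hd.countable_of_isOpen (fun i _ => Metric.isOpen_ball) fun i _ =>
    ⟨v i, Metric.mem_ball_self (by norm_num)⟩
  exact Set.countable_univ_iff.1 this

/-- A separable Hilbert space has a Hilbert basis indexed by a countable type in `Type`. -/
theorem exists_countable_hilbertBasis (V : Type*) [NormedAddCommGroup V] [InnerProductSpace ℝ V]
    [CompleteSpace V] [TopologicalSpace.SeparableSpace V] :
    ∃ ι : Type, Countable ι ∧ Nonempty (HilbertBasis ι ℝ V) := by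
  obtain ⟨w, b, hb⟩ := exists_hilbertBasis ℝ V
  have hc : Countable w := b.orthonormal.countable_of_separable
  -- Reindexing by a set of natural numbers puts the index type in `Type`, as the existence claims
  -- of the theorem demand.
  obtain ⟨f, hf⟩ := hc.exists_injective_nat
  let e := Equiv.ofInjective f hf
  refine ⟨Set.range f, inferInstance, ⟨HilbertBasis.mk (v := b ∘ e.symm)
    (b.orthonormal.comp _ e.symm.injective) ?_⟩⟩
  rw [e.symm.surjective.range_comp, b.dense_span]

/-- The law of a family of independent standard Gaussian variables. -/
noncomputable def stdGaussianPi (ι : Type*) : Measure (ι → ℝ) :=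
  Measure.infinitePi fun _ => gaussianReal 0 1

instance (ι : Type*) : IsProbabilityMeasure (stdGaussianPi ι) := by
  unfold stdGaussianPi
  infer_instance

/-- A jointly measurable isonormal process on the space of coordinate sequences in the Hilbert
basis `b`, extending the coordinates. -/
structure WhiteNoise {ι : Type*} (b : HilbertBasis ι ℝ V) [MeasurableSpace V] where
  toFun : (ι → ℝ) → V → ℝ
  measurable : Measurable fun p : (ι → ℝ) × V => toFun p.1 p.2
  isonormal : IsIsonormal (fun ξ ω => toFun ω ξ) (stdGaussianPi ι)
  basis : ∀ i, ∀ᵐ ω ∂stdGaussianPi ι, toFun ω (b i) = ω i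

variable {ι : Type*}

theorem lintegral_eexp_coord (c : ℝ) (i : ι) :
    ∫⁻ ω, eexp (c * ω i) ∂stdGaussianPi ι = eexp (c ^ 2 / 2) := by
  have hmp : MeasurePreserving (Function.eval i) (stdGaussianPi ι) (gaussianReal 0 1) :=
    measurePreserving_eval_infinitePi _ i
  exact (hmp.lintegral_comp (f := fun x => eexp (c * x)) (by fun_prop)).trans
    (by rw [lintegral_eexp_gaussianReal]; simp)

theorem lintegral_eexp_sum_coord (s : Finset ι) (c : ι → ℝ) :
    ∫⁻ ω, eexp (∑ i ∈ s, c i * ω i) ∂stdGaussianPi ι = eexp (∑ i ∈ s, c i ^ 2 / 2) := by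
  classical
  have hind : iIndepFun (fun i (ω : ι → ℝ) => eexp (c i * ω i)) (stdGaussianPi ι) :=
    iIndepFun_infinitePi (X := fun i x => eexp (c i * x)) (by fun_prop)
  have hsum : ∀ (s : Finset ι) (f : ι → ℝ), eexp (∑ i ∈ s, f i) = ∏ i ∈ s, eexp (f i) := by
    intro s f
    induction s using Finset.induction_on with
    | empty => simp [eexp_zero]
    | insert i s hi ih => rw [Finset.sum_insert hi, Finset.prod_insert hi, eexp_add, ih]
  rw [hsum]
  simp only [hsum s]
  induction s using Finset.induction_on with
  | empty => simp
  | insert i s hi ih =>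
    simp_rw [Finset.prod_insert hi]
    rw [← ih]
    have := (hind.indepFun_finsetProd_of_notMem (by fun_prop) hi).symm
    have h2 := lintegral_mul_eq_lintegral_mul_lintegral_of_indepFun (by fun_prop) (by fun_prop) this
    simpa [lintegral_eexp_coord] using h2

theorem map_sum_coord (s : Finset ι) (c : ι → ℝ) :
    (stdGaussianPi ι).map (fun ω => ∑ i ∈ s, c i * ω i) =
      gaussianReal 0 (Real.toNNReal (∑ i ∈ s, c i ^ 2)) := by
  have key : ∀ r : ℝ, ∫⁻ ω, eexp (r * ∑ i ∈ s, c i * ω i) ∂stdGaussianPi ι =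
      eexp (∑ i ∈ s, (r * c i) ^ 2 / 2) := by
    intro r
    rw [← lintegral_eexp_sum_coord]
    simp_rw [Finset.mul_sum, mul_assoc]
  rw [← Measure.map_id (μ := gaussianReal 0 _)]
  refine map_eq_of_lintegral_eexp (by fun_prop) measurable_id (fun r => ?_) fun r => ?_
  · simp_rw [id]
    rw [key, lintegral_eexp_gaussianReal, Real.coe_toNNReal _ (by positivity), zero_mul, zero_add,
      Finset.sum_mul, Finset.sum_div]
    congr 1
    refine Finset.sum_congr rfl fun i _ => ?_
    ring
  · rw [key]
    exact eexp_ne_top _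

theorem memLp_coord (i : ι) : MemLp (fun ω : ι → ℝ => ω i) 2 (stdGaussianPi ι) :=
  (memLp_id_gaussianReal' (μ := 0) (v := 1) 2 (by simp)).comp_measurePreserving
    (measurePreserving_eval_infinitePi (fun _ : ι => gaussianReal 0 1) i)

theorem orthonormal_coord :
    Orthonormal ℝ fun i : ι => (memLp_coord i).toLp (fun ω : ι → ℝ => ω i) := by
  classical
  rw [orthonormal_iff_ite]
  intro i j
  have hmp : ∀ i, MeasurePreserving (Function.eval i) (stdGaussianPi ι) (gaussianReal 0 1) :=
    fun i => measurePreserving_eval_infinitePi _ i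
  have hmean : ∀ i, ∫ ω, ω i ∂stdGaussianPi ι = 0 := by
    intro i
    have := integral_map (μ := stdGaussianPi ι) (φ := Function.eval i) (f := fun x : ℝ => x)
      (hmp i).measurable.aemeasurable (by fun_prop)
    rw [(hmp i).map_eq, integral_id_gaussianReal] at this
    exact this.symm
  have hin : inner ℝ ((memLp_coord i).toLp (fun ω : ι → ℝ => ω i))
      ((memLp_coord j).toLp (fun ω : ι → ℝ => ω j)) = ∫ ω, ω i * ω j ∂stdGaussianPi ι := by
    rw [L2.inner_def]
    refine integral_congr_ae ?_
    filter_upwards [(memLp_coord i).coeFn_toLp, (memLp_coord j).coeFn_toLp] with ω h1 h2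
    rw [h1, h2]
    simp [mul_comm]
  rw [hin]
  split_ifs with hij
  · subst hij
    have h1 := integral_map (μ := stdGaussianPi ι) (φ := Function.eval i) (f := fun x : ℝ => x * x)
      (hmp i).measurable.aemeasurable (by fun_prop)
    rw [(hmp i).map_eq] at h1
    have h2 := variance_fun_id_gaussianReal (μ := 0) (v := 1)
    rw [variance_of_integral_eq_zero (by fun_prop) integral_id_gaussianReal] at h2
    simp only [pow_two] at h2
    exact h1.symm.trans h2
  · have hind : iIndepFun (fun i (ω : ι → ℝ) => ω i) (stdGaussianPi ι) :=
      iIndepFun_infinitePi (X := fun _ x => x) (by fun_prop)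
    have := (hind.indepFun hij).integral_mul_eq_mul_integral
      (measurable_pi_apply i).aestronglyMeasurable (measurable_pi_apply j).aestronglyMeasurable
    rw [hmean, zero_mul] at this
    exact this

/-- The map is 1-Lipschitz, since `|e^{ia} - e^{ib}| ≤ |a - b|` and the L¹ norm is at most the L²
norm on a probability space. It carries Gaussian characteristic functions from finite combinations
of coordinates to their L² closure. -/
theorem continuous_integral_cexp_Lp {Ω : Type*} [MeasurableSpace Ω] (μ : Measure Ω)
    [IsProbabilityMeasure μ] :
    Continuous fun f : Lp ℝ 2 μ => ∫ ω, Complex.exp (f ω * Complex.I) ∂μ := by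
  have hint : ∀ f : Lp ℝ 2 μ, Integrable (fun ω => Complex.exp (f ω * Complex.I)) μ := by
    intro f
    refine Integrable.of_bound (C := 1) ?_ (ae_of_all _ fun ω => ?_)
    · have := (Lp.stronglyMeasurable f).measurable
      exact Measurable.aestronglyMeasurable (by fun_prop)
    · rw [Complex.norm_exp_ofReal_mul_I]
  have hlip : LipschitzWith 1 fun f : Lp ℝ 2 μ => ∫ ω, Complex.exp (f ω * Complex.I) ∂μ := by
    refine LipschitzWith.of_dist_le_mul fun f g => ?_
    rw [dist_eq_norm, dist_eq_norm, NNReal.coe_one, one_mul, ← integral_sub (hint f) (hint g)]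
    have hfg : MemLp (fun ω => f ω - g ω) 2 μ := (Lp.memLp f).sub (Lp.memLp g)
    calc ‖∫ ω, (Complex.exp (f ω * Complex.I) - Complex.exp (g ω * Complex.I)) ∂μ‖
        ≤ ∫ ω, ‖f ω - g ω‖ ∂μ := by
          refine norm_integral_le_of_norm_le (hfg.integrable (by norm_num)).norm
            (ae_of_all _ fun ω => ?_)
          have : Complex.exp (f ω * Complex.I) - Complex.exp (g ω * Complex.I) =
              Complex.exp (g ω * Complex.I) *
                (Complex.exp (Complex.I * ((f ω - g ω : ℝ) : ℂ)) - 1) := by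
            rw [mul_sub, ← Complex.exp_add, mul_one]
            congr 2
            push_cast
            ring
          rw [this, norm_mul, Complex.norm_exp_ofReal_mul_I, one_mul]
          exact Real.norm_exp_I_mul_ofReal_sub_one_le
      _ = (eLpNorm (fun ω => f ω - g ω) 1 μ).toReal := by
          rw [eLpNorm_one_eq_lintegral_enorm, integral_norm_eq_lintegral_enorm hfg.1]
      _ ≤ (eLpNorm (fun ω => f ω - g ω) 2 μ).toReal :=
          ENNReal.toReal_mono hfg.2.ne (eLpNorm_le_eLpNorm_of_exponent_le (by norm_num) hfg.1)
      _ = ‖f - g‖ := by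
          rw [Lp.norm_def]
          congr 1
          exact eLpNorm_congr_ae (Lp.coeFn_sub f g).symm
  exact hlip.continuous

theorem HilbertBasis.dense_range_span (b : HilbertBasis ι ℝ V) :
    Dense (Submodule.span ℝ (Set.range b) : Set V) :=
  (Submodule.dense_iff_topologicalClosure_eq_top).2 b.dense_span

/-- The coordinates in a Hilbert basis extend to an isonormal process. -/
theorem exists_isonormal_extending_coord (b : HilbertBasis ι ℝ V) :
    ∃ H : V → (ι → ℝ) → ℝ, IsIsonormal H (stdGaussianPi ι) ∧
      ∀ i, ∀ᵐ ω ∂stdGaussianPi ι, H (b i) ω = ω i := by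
  classical
  -- The coordinates are orthonormal in L², so sending the basis to them extends to an isometry,
  -- whose values are taken as the process.
  let T : V →ₗᵢ[ℝ] Lp ℝ 2 (stdGaussianPi ι) :=
    (orthonormal_coord (ι := ι)).orthogonalFamily.linearIsometry.comp b.repr.toLinearIsometry
  have hTb : ∀ i, T (b i) = (memLp_coord i).toLp (fun ω : ι → ℝ => ω i) := by
    intro i
    change (orthonormal_coord (ι := ι)).orthogonalFamily.linearIsometry (b.repr (b i)) = _
    rw [b.repr_self, OrthogonalFamily.linearIsometry_apply_single]
    simp
  have hTb' : ∀ i, ∀ᵐ ω ∂stdGaussianPi ι, T (b i) ω = ω i := by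
    intro i
    rw [hTb]
    exact (memLp_coord i).coeFn_toLp
  have hTadd : ∀ ξ η, ∀ᵐ ω ∂stdGaussianPi ι, T (ξ + η) ω = T ξ ω + T η ω := by
    intro ξ η
    rw [map_add]
    exact Lp.coeFn_add _ _
  have hTsmul : ∀ (c : ℝ) ξ, ∀ᵐ ω ∂stdGaussianPi ι, T (c • ξ) ω = c * T ξ ω := by
    intro c ξ
    rw [map_smul]
    exact Lp.coeFn_smul _ _
  have hTm : ∀ ξ, Measurable (T ξ) := fun ξ => (Lp.stronglyMeasurable (T ξ)).measurable
  have hsum : ∀ (s : Finset ι) (c : ι → ℝ), ∀ᵐ ω ∂stdGaussianPi ι,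
      T (∑ i ∈ s, c i • b i) ω = ∑ i ∈ s, c i * ω i := by
    intro s c
    induction s using Finset.induction_on with
    | empty => simp
    | insert i s hi ih =>
      filter_upwards [ih, hTadd (c i • b i) (∑ i ∈ s, c i • b i), hTsmul (c i) (b i), hTb' i]
        with ω h1 h2 h3 h4
      rw [Finset.sum_insert hi, Finset.sum_insert hi, h2, h3, h1, h4]
  -- Both sides are continuous in `ξ`. On the span of the basis the left side is the characteristic
  -- function at 1 of a finite sum of independent Gaussians.
  have hchar : ∀ ξ, ∫ ω, Complex.exp (T ξ ω * Complex.I) ∂stdGaussianPi ι =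
      Complex.exp (-(‖ξ‖ ^ 2 / 2 : ℝ)) := by
    intro ξ
    have hd : Dense (Submodule.span ℝ (Set.range b) : Set V) := b.dense_range_span
    have hc1 : Continuous fun ξ => ∫ ω, Complex.exp (T ξ ω * Complex.I) ∂stdGaussianPi ι :=
      (continuous_integral_cexp_Lp _).comp T.continuous
    have hc2 : Continuous fun ξ : V => Complex.exp (-(‖ξ‖ ^ 2 / 2 : ℝ)) := by fun_prop
    refine congrFun (hc1.ext_on hd hc2 fun η hη => ?_) ξ
    obtain ⟨c, rfl⟩ := (Finsupp.mem_span_range_iff_exists_finsupp).1 hη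
    have h1 : ∀ᵐ ω ∂stdGaussianPi ι, T (c.sum fun i a => a • b i) ω =
        ∑ i ∈ c.support, c i * ω i := hsum c.support c
    have h2 : ‖c.sum fun i a => a • b i‖ ^ 2 = ∑ i ∈ c.support, c i ^ 2 := by
      rw [← real_inner_self_eq_norm_sq, Finsupp.sum, b.orthonormal.inner_sum]
      simp [pow_two]
    have h3 := charFun_gaussianReal (μ := 0) (v := Real.toNNReal (∑ i ∈ c.support, c i ^ 2)) 1
    rw [← map_sum_coord, charFun_apply_real, integral_map (Measurable.aemeasurable
      (Finset.measurable_sum _ fun i _ => (measurable_pi_apply i).const_mul _)) (by fun_prop)] at h3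
    have h4 : ∫ ω, Complex.exp (T (c.sum fun i a => a • b i) ω * Complex.I) ∂stdGaussianPi ι =
        ∫ ω, Complex.exp ((1 : ℝ) * (∑ i ∈ c.support, c i * ω i : ℝ) * Complex.I)
          ∂stdGaussianPi ι := by
      refine integral_congr_ae ?_
      filter_upwards [h1] with ω hω
      rw [hω]
      simp
    simp only
    rw [h4, h3, h2]
    congr 1
    have : ((Real.toNNReal (∑ i ∈ c.support, c i ^ 2) : ℝ≥0) : ℝ) = ∑ i ∈ c.support, c i ^ 2 :=
      Real.coe_toNNReal _ (by positivity)
    rw [← Complex.ofReal_pow]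
    simp only [this]
    push_cast
    ring
  have hlaw : ∀ ξ, (stdGaussianPi ι).map (T ξ) = gaussianReal 0 (‖ξ‖₊ ^ 2) := by
    intro ξ
    refine Measure.ext_of_charFun ?_
    funext s
    rw [charFun_gaussianReal, charFun_apply_real, integral_map (hTm ξ).aemeasurable (by fun_prop)]
    have : ∫ ω, Complex.exp (s * T ξ ω * Complex.I) ∂stdGaussianPi ι =
        ∫ ω, Complex.exp (T (s • ξ) ω * Complex.I) ∂stdGaussianPi ι := by
      refine integral_congr_ae ?_
      filter_upwards [hTsmul s ξ] with ω hω
      rw [hω]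
      push_cast
      ring_nf
    rw [this, hchar, norm_smul]
    congr 1
    push_cast
    simp [mul_pow, ← Complex.ofReal_pow]
    ring
  refine ⟨fun ξ => T ξ, ⟨hTm, hTadd, hTsmul, fun ξ => ?_⟩, hTb'⟩
  have h1 := lintegral_eexp_gaussianReal 0 (‖ξ‖₊ ^ 2) 1
  rw [← hlaw, lintegral_map (by fun_prop) (hTm ξ)] at h1
  simpa using h1

/-- An isonormal process indexed by a separable space has a jointly measurable version. -/
theorem IsIsonormal.exists_measurable_version {Ω : Type*} [MeasurableSpace Ω] {μ : Measure Ω}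
    [TopologicalSpace.SeparableSpace V] [MeasurableSpace V] [BorelSpace V]
    {H : V → Ω → ℝ} (hH : IsIsonormal H μ) :
    ∃ L : Ω → V → ℝ, Measurable (fun p : Ω × V => L p.1 p.2) ∧
      ∀ ξ, ∀ᵐ ω ∂μ, L ω ξ = H ξ ω := by
  classical
  let d := TopologicalSpace.denseSeq V
  have hex : ∀ (j : ℕ) (ξ : V), ∃ n, dist ξ (d n) < (1 / 2 : ℝ) ^ j := fun j ξ =>
    (TopologicalSpace.denseRange_denseSeq V).exists_dist_lt ξ (by positivity)
  -- The index of the first point of a dense sequence within `2^{-j}` of `ξ`. It depends measurably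
  -- on `ξ` and takes countably many values, so `F j` is jointly measurable.
  let N : ℕ → V → ℕ := fun j ξ => Nat.find (hex j ξ)
  have hNm : ∀ j, Measurable (N j) := fun j => measurable_find (hex j) fun n =>
    measurableSet_lt (by fun_prop) measurable_const
  have hN : ∀ j ξ, dist ξ (d (N j ξ)) < (1 / 2 : ℝ) ^ j := fun j ξ => Nat.find_spec (hex j ξ)
  let F : ℕ → Ω × V → ℝ := fun j p => H (d (N j p.2)) p.1
  have hFm : ∀ j, Measurable (F j) := by
    intro j
    have h1 : Measurable fun q : ℕ × Ω => H (d q.1) q.2 :=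
      measurable_from_prod_countable_right fun n => hH.measurable (d n)
    exact h1.comp (((hNm j).comp measurable_snd).prodMk measurable_fst)
  -- The L¹ errors are summable, so for each `ξ` the sequence converges almost surely to `H ξ`; the
  -- limsup is a measurable choice of limit.
  refine ⟨fun ω ξ => limsup (fun j => F j (ω, ξ)) atTop, Measurable.limsup hFm, fun ξ => ?_⟩
  set C : ℝ≥0∞ := 2 * eexp (1 / 2) with hC
  have hCtop : C ≠ ∞ := ENNReal.mul_ne_top (by simp) (eexp_ne_top _)
  have hmeas : ∀ j, Measurable fun ω => ‖F j (ω, ξ) - H ξ ω‖ₑ := by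
    intro j
    have := hH.measurable (d (N j ξ))
    have := hH.measurable ξ
    fun_prop
  have hbound : ∫⁻ ω, ∑' j, ‖F j (ω, ξ) - H ξ ω‖ₑ ∂μ ≠ ∞ := by
    rw [lintegral_tsum fun j => (hmeas j).aemeasurable]
    refine ne_top_of_le_ne_top (b := ∑' j : ℕ, C * (1 / 2 : ℝ≥0∞) ^ j) ?_
      (ENNReal.tsum_le_tsum fun j => ?_)
    · rw [ENNReal.tsum_mul_left, ENNReal.tsum_geometric]
      refine ENNReal.mul_ne_top hCtop ?_
      norm_num
    · refine (hH.lintegral_enorm_sub_le (d (N j ξ)) ξ).trans ?_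
      gcongr
      rw [← ofReal_norm, ← dist_eq_norm, dist_comm]
      refine (ENNReal.ofReal_le_ofReal (hN j ξ).le).trans ?_
      rw [ENNReal.ofReal_pow (by norm_num), ENNReal.ofReal_div_of_pos (by norm_num)]
      simp
  have hae := ae_lt_top (Measurable.tsum hmeas) hbound
  filter_upwards [hae] with ω hω
  have h0 := ENNReal.tendsto_atTop_zero_of_tsum_ne_top hω.ne
  have h1 : Tendsto (fun j => F j (ω, ξ)) atTop (𝓝 (H ξ ω)) := by
    rw [tendsto_iff_edist_tendsto_0]
    simpa [edist_eq_enorm_sub] using h0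
  exact h1.limsup_eq

theorem exists_whiteNoise [TopologicalSpace.SeparableSpace V] [MeasurableSpace V] [BorelSpace V]
    (b : HilbertBasis ι ℝ V) : Nonempty (WhiteNoise b) := by
  obtain ⟨H, hH, hb⟩ := exists_isonormal_extending_coord b
  obtain ⟨L, hL, hLH⟩ := hH.exists_measurable_version
  refine ⟨⟨L, hL, ⟨fun ξ => hL.of_uncurry_right, fun ξ η => ?_, fun c ξ => ?_, fun ξ => ?_⟩,
    fun i => ?_⟩⟩
  · filter_upwards [hH.add ξ η, hLH ξ, hLH η, hLH (ξ + η)] with ω h1 h2 h3 h4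
    rw [h2, h3, h4, h1]
  · filter_upwards [hH.smul c ξ, hLH ξ, hLH (c • ξ)] with ω h1 h2 h3
    rw [h2, h3, h1]
  · rw [← hH.lintegral_eexp ξ]
    refine lintegral_congr_ae ?_
    filter_upwards [hLH ξ] with ω h1
    rw [h1]
  · filter_upwards [hb i, hLH (b i)] with ω h1 h2
    rw [h2, h1]

end WhiteNoise

/-! ### Cameron–Martin translations, the zero-one law and rotations. -/

section WhiteNoiseInvariance

variable {V Ω ι : Type*} [NormedAddCommGroup V] [InnerProductSpace ℝ V]
  [MeasurableSpace Ω] {b : HilbertBasis ι ℝ V}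

theorem HilbertBasis.norm_sq_sum (b : HilbertBasis ι ℝ V) (s : Finset ι) (c : ι → ℝ) :
    ‖∑ i ∈ s, c i • b i‖ ^ 2 = ∑ i ∈ s, c i ^ 2 := by
  rw [← real_inner_self_eq_norm_sq, b.orthonormal.inner_sum]
  simp [pow_two]

theorem IsIsonormal.sum_coord_ae {H : V → Ω → ℝ} {μ : Measure Ω} (hH : IsIsonormal H μ)
    {φ : Ω → ι → ℝ} (hφ : ∀ i, ∀ᵐ ω ∂μ, φ ω i = H (b i) ω) (s : Finset ι) (c : ι → ℝ) :
    ∀ᵐ ω ∂μ, ∑ i ∈ s, c i * φ ω i = H (∑ i ∈ s, c i • b i) ω := by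
  have h : ∀ᵐ ω ∂μ, ∀ i ∈ s, φ ω i = H (b i) ω :=
    (Finset.eventually_all s).2 fun i _ => hφ i
  filter_upwards [h, hH.sum_ae s c b] with ω h1 h2
  rw [h2]
  exact Finset.sum_congr rfl fun i hi => by rw [h1 i hi]

/-- The coordinates of an isonormal process in a Hilbert basis are independent standard
Gaussian variables. -/
theorem IsIsonormal.measurePreserving_coord {H : V → Ω → ℝ} {μ : Measure Ω}
    (hH : IsIsonormal H μ) {φ : Ω → ι → ℝ} (hφm : Measurable φ)
    (hφ : ∀ i, ∀ᵐ ω ∂μ, φ ω i = H (b i) ω) : MeasurePreserving φ μ (stdGaussianPi ι) := by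
  have := hH.isProbabilityMeasure
  have := Measure.isProbabilityMeasure_map hφm.aemeasurable (μ := μ)
  have key : ∀ (s : Finset ι) (c : ι → ℝ),
      ∫⁻ ω, eexp (∑ k ∈ s, c k * ω k) ∂(μ.map φ) = eexp (∑ i ∈ s, c i ^ 2 / 2) := by
    intro s c
    rw [lintegral_map (by fun_prop) hφm, ← Finset.sum_div, ← b.norm_sq_sum, ← hH.lintegral_eexp]
    refine lintegral_congr_ae ?_
    filter_upwards [hH.sum_coord_ae hφ s c] with ω hω
    rw [hω]
  refine ⟨hφm, Measure.pi_ext_of_lintegral_eexp (fun s c => ?_) fun s c => ?_⟩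
  · rw [key, lintegral_eexp_sum_coord]
  · rw [key]
    exact eexp_ne_top _

theorem IsIsonormal.isProbabilityMeasure_withDensity {H : V → Ω → ℝ} {μ : Measure Ω}
    (hH : IsIsonormal H μ) (ζ : V) :
    IsProbabilityMeasure (μ.withDensity fun ω => eexp (H ζ ω - ‖ζ‖ ^ 2 / 2)) := by
  constructor
  have h0 := hH.lintegral_eexp_withDensity ζ 0
  have h1 : ∀ᵐ ω ∂(μ.withDensity fun ω => eexp (H ζ ω - ‖ζ‖ ^ 2 / 2)), H 0 ω = 0 :=
    (withDensity_absolutelyContinuous _ _).ae_le hH.zero_ae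
  rw [lintegral_congr_ae (g := fun _ => 1)] at h0
  · simpa [eexp_zero] using h0
  · filter_upwards [h1] with ω hω
    rw [hω, eexp_zero]

variable [MeasurableSpace V]

namespace WhiteNoise

theorem measurable_apply (L : WhiteNoise b) (ξ : V) : Measurable fun ω => L.toFun ω ξ :=
  L.measurable.of_uncurry_right

/-- Every isonormal process is the image of the white noise under its coordinates. -/
theorem comp_coord_ae (L : WhiteNoise b) {H : V → Ω → ℝ} {μ : Measure Ω}
    (hH : IsIsonormal H μ) {φ : Ω → ι → ℝ} (hφm : Measurable φ)
    (hφ : ∀ i, ∀ᵐ ω ∂μ, φ ω i = H (b i) ω) (ξ : V) :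
    ∀ᵐ ω ∂μ, L.toFun (φ ω) ξ = H ξ ω := by
  have hmp := hH.measurePreserving_coord hφm hφ
  refine (L.isonormal.comp hmp).ae_eq_of_dense hH b.dense_range_span (fun i => ?_) ξ
  filter_upwards [hφ i, hmp.quasiMeasurePreserving.ae (L.basis i)] with ω h1 h2
  rw [h2, h1]

theorem sum_ae (L : WhiteNoise b) (s : Finset ι) (c : ι → ℝ) :
    ∀ᵐ ω ∂stdGaussianPi ι, ∑ i ∈ s, c i * ω i = L.toFun ω (∑ i ∈ s, c i • b i) := by
  refine L.isonormal.sum_coord_ae (φ := fun ω => ω) (fun i => ?_) s c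
  filter_upwards [L.basis i] with ω hω
  exact hω.symm

/-- Finite measures on the sequence space, absolutely continuous with respect to the Gaussian
measure, that have the same Laplace transform are equal. -/
theorem ext_of_lintegral_eexp (L : WhiteNoise b) {μ ν : Measure (ι → ℝ)} [IsFiniteMeasure μ]
    [IsFiniteMeasure ν] (hμ : μ ≪ stdGaussianPi ι) (hν : ν ≪ stdGaussianPi ι)
    (h : ∀ ξ, ∫⁻ ω, eexp (L.toFun ω ξ) ∂μ = ∫⁻ ω, eexp (L.toFun ω ξ) ∂ν)
    (hfin : ∀ ξ, ∫⁻ ω, eexp (L.toFun ω ξ) ∂μ ≠ ∞) : μ = ν := by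
  have key : ∀ (ν : Measure (ι → ℝ)), ν ≪ stdGaussianPi ι → ∀ (s : Finset ι) (c : ι → ℝ),
      ∫⁻ ω, eexp (∑ k ∈ s, c k * ω k) ∂ν = ∫⁻ ω, eexp (L.toFun ω (∑ i ∈ s, c i • b i)) ∂ν := by
    intro ν hν s c
    refine lintegral_congr_ae ?_
    filter_upwards [hν.ae_le (L.sum_ae s c)] with ω hω
    rw [hω]
  refine Measure.pi_ext_of_lintegral_eexp (fun s c => ?_) fun s c => ?_
  · rw [key μ hμ, key ν hν, h]
  · rw [key μ hμ]
    exact hfin _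

/-- The Cameron–Martin formula. -/
theorem map_add (L : WhiteNoise b) (v : V) :
    (stdGaussianPi ι).map (fun ω i => ω i + inner ℝ (b i) v) =
      (stdGaussianPi ι).withDensity fun ω => eexp (L.toFun ω v - ‖v‖ ^ 2 / 2) := by
  have hm : Measurable fun (ω : ι → ℝ) i => ω i + inner ℝ (b i) v := by fun_prop
  have := Measure.isProbabilityMeasure_map hm.aemeasurable (μ := stdGaussianPi ι)
  have := L.isonormal.isProbabilityMeasure_withDensity v
  have key : ∀ (s : Finset ι) (c : ι → ℝ), ∫⁻ ω, eexp (∑ k ∈ s, c k * ω k)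
      ∂((stdGaussianPi ι).map (fun ω i => ω i + inner ℝ (b i) v)) =
      eexp (inner ℝ (∑ i ∈ s, c i • b i) v + ∑ i ∈ s, c i ^ 2 / 2) := by
    intro s c
    rw [lintegral_map (by fun_prop) hm, eexp_add, ← lintegral_eexp_sum_coord,
      ← lintegral_const_mul _ (by fun_prop)]
    refine lintegral_congr fun ω => ?_
    rw [← eexp_add, sum_inner]
    congr 1
    simp_rw [mul_add, Finset.sum_add_distrib, inner_smul_left]
    simp [add_comm]
  refine Measure.pi_ext_of_lintegral_eexp (fun s c => ?_) fun s c => ?_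
  · have h1 := L.isonormal.lintegral_eexp_withDensity v (∑ i ∈ s, c i • b i)
    rw [key, ← Finset.sum_div, ← b.norm_sq_sum, ← h1]
    refine lintegral_congr_ae ?_
    filter_upwards [(withDensity_absolutelyContinuous _ _).ae_le (L.sum_ae s c)] with ω hω
    rw [hω]
  · rw [key]
    exact eexp_ne_top _

theorem quasiMeasurePreserving_add (L : WhiteNoise b) (v : V) :
    Measure.QuasiMeasurePreserving (fun (ω : ι → ℝ) i => ω i + inner ℝ (b i) v)
      (stdGaussianPi ι) (stdGaussianPi ι) := by
  refine ⟨by fun_prop, ?_⟩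
  rw [L.map_add]
  exact withDensity_absolutelyContinuous _ _

/-- A measurable set that is invariant under the translations by `V` is null or conull. -/
theorem measure_eq_zero_or_compl (L : WhiteNoise b) {Z : Set (ι → ℝ)} (hZ : MeasurableSet Z)
    (hinv : ∀ v : V, (fun (ω : ι → ℝ) i => ω i + inner ℝ (b i) v) ⁻¹' Z = Z) :
    stdGaussianPi ι Z = 0 ∨ stdGaussianPi ι Zᶜ = 0 := by
  -- Cameron–Martin turns invariance of `Z` into a Laplace transform: the measure restricted to `Z`
  -- has the transform of `stdGaussianPi ι Z • stdGaussianPi ι`, hence equals it. Evaluation at `Zᶜ`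
  -- gives a vanishing product.
  have h1 : ∀ v : V, ∫⁻ ω in Z, eexp (L.toFun ω v) ∂stdGaussianPi ι =
      stdGaussianPi ι Z * eexp (‖v‖ ^ 2 / 2) := by
    intro v
    have h := congrArg (fun μ => μ Z) (L.map_add v)
    rw [Measure.map_apply (by fun_prop) hZ, hinv, withDensity_apply _ hZ] at h
    have hm := L.measurable_apply v
    rw [h, ← lintegral_mul_const _ (by fun_prop)]
    refine lintegral_congr fun ω => ?_
    rw [← eexp_add]
    congr 1
    ring
  have h2 : (stdGaussianPi ι).restrict Z = stdGaussianPi ι Z • stdGaussianPi ι := by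
    have : IsFiniteMeasure (stdGaussianPi ι Z • stdGaussianPi ι) :=
      Measure.smul_finite _ (measure_ne_top _ _)
    refine L.ext_of_lintegral_eexp Measure.restrict_le_self.absolutelyContinuous
      Measure.smul_absolutelyContinuous (fun ξ => ?_) fun ξ => ?_
    · rw [h1, lintegral_smul_measure, L.isonormal.lintegral_eexp, smul_eq_mul]
    · rw [h1]
      exact ENNReal.mul_ne_top (measure_ne_top _ _) (eexp_ne_top _)
  have h3 := congrArg (fun μ => μ Zᶜ) h2
  simp only [Measure.smul_apply, smul_eq_mul] at h3
  rw [Measure.restrict_apply hZ.compl, Set.compl_inter_self, measure_empty] at h3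
  exact mul_eq_zero.1 h3.symm

theorem isonormal_neg (L : WhiteNoise b) :
    IsIsonormal (fun (ξ : V) ω => -L.toFun ω ξ) (stdGaussianPi ι) where
  measurable ξ := (L.measurable_apply ξ).neg
  add ξ η := by
    filter_upwards [L.isonormal.add ξ η] with ω hω
    rw [hω]
    ring
  smul c ξ := by
    filter_upwards [L.isonormal.smul c ξ] with ω hω
    rw [hω]
    ring
  lintegral_eexp ξ := by
    have := L.isonormal.lintegral_eexp_smul (-1) ξ
    simpa using this

theorem measurePreserving_neg (L : WhiteNoise b) :
    MeasurePreserving (fun (ω : ι → ℝ) i => -ω i) (stdGaussianPi ι) (stdGaussianPi ι) := by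
  refine L.isonormal_neg.measurePreserving_coord (b := b) (by fun_prop) fun i => ?_
  filter_upwards [L.basis i] with ω hω
  rw [hω]

theorem neg_ae (L : WhiteNoise b) (ξ : V) :
    ∀ᵐ ω ∂stdGaussianPi ι, L.toFun (fun i => -ω i) ξ = -L.toFun ω ξ := by
  refine L.comp_coord_ae L.isonormal_neg (by fun_prop) (fun i => ?_) ξ
  filter_upwards [L.basis i] with ω hω
  rw [hω]

theorem isonormal_rotation (L : WhiteNoise b) {a c : ℝ} (hac : a ^ 2 + c ^ 2 = 1) :
    IsIsonormal (fun (ξ : V) (p : (ι → ℝ) × (ι → ℝ)) => a * L.toFun p.1 ξ + c * L.toFun p.2 ξ)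
      ((stdGaussianPi ι).prod (stdGaussianPi ι)) where
  measurable ξ := by
    have := L.measurable_apply ξ
    fun_prop
  add ξ η := by
    filter_upwards [Measure.quasiMeasurePreserving_fst.ae (L.isonormal.add ξ η),
      Measure.quasiMeasurePreserving_snd.ae (L.isonormal.add ξ η)] with p h1 h2
    rw [h1, h2]
    ring
  smul r ξ := by
    filter_upwards [Measure.quasiMeasurePreserving_fst.ae (L.isonormal.smul r ξ),
      Measure.quasiMeasurePreserving_snd.ae (L.isonormal.smul r ξ)] with p h1 h2
    rw [h1, h2]
    ring
  lintegral_eexp ξ := by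
    have := L.measurable_apply ξ
    simp_rw [eexp_add]
    rw [lintegral_prod_mul (f := fun ω => eexp (a * L.toFun ω ξ))
      (g := fun ω => eexp (c * L.toFun ω ξ)) (by fun_prop) (by fun_prop),
      L.isonormal.lintegral_eexp_smul, L.isonormal.lintegral_eexp_smul, ← eexp_add, norm_smul,
      norm_smul]
    congr 1
    rw [mul_pow, mul_pow, Real.norm_eq_abs, Real.norm_eq_abs, sq_abs, sq_abs, ← add_div, ← add_mul,
      hac, one_mul]

theorem rotation_coord_ae (L : WhiteNoise b) (a c : ℝ) (i : ι) :
    ∀ᵐ p ∂(stdGaussianPi ι).prod (stdGaussianPi ι),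
      a * p.1 i + c * p.2 i = a * L.toFun p.1 (b i) + c * L.toFun p.2 (b i) := by
  filter_upwards [Measure.quasiMeasurePreserving_fst.ae (L.basis i),
    Measure.quasiMeasurePreserving_snd.ae (L.basis i)] with p h1 h2
  rw [h1, h2]

theorem measurePreserving_rotation (L : WhiteNoise b) {a c : ℝ} (hac : a ^ 2 + c ^ 2 = 1) :
    MeasurePreserving (fun (p : (ι → ℝ) × (ι → ℝ)) i => a * p.1 i + c * p.2 i)
      ((stdGaussianPi ι).prod (stdGaussianPi ι)) (stdGaussianPi ι) :=
  (L.isonormal_rotation hac).measurePreserving_coord (b := b) (by fun_prop)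
    (L.rotation_coord_ae a c)

theorem rotation_ae (L : WhiteNoise b) {a c : ℝ} (hac : a ^ 2 + c ^ 2 = 1) (ξ : V) :
    ∀ᵐ p ∂(stdGaussianPi ι).prod (stdGaussianPi ι),
      L.toFun (fun i => a * p.1 i + c * p.2 i) ξ = a * L.toFun p.1 ξ + c * L.toFun p.2 ξ :=
  L.comp_coord_ae (L.isonormal_rotation hac) (by fun_prop) (L.rotation_coord_ae a c) ξ

/-- The Ornstein–Uhlenbeck semigroup is positivity improving. -/
theorem ae_pos_measure_rotation (L : WhiteNoise b) {a c : ℝ} (hac : a ^ 2 + c ^ 2 = 1)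
    (hc : c ≠ 0) {C : Set (ι → ℝ)} (hC : MeasurableSet C) (hpos : stdGaussianPi ι C ≠ 0) :
    ∀ᵐ ω ∂stdGaussianPi ι, stdGaussianPi ι {ω' | (fun i => a * ω i + c * ω' i) ∈ C} ≠ 0 := by
  have hrot : Measurable fun (p : (ι → ℝ) × (ι → ℝ)) i => a * p.1 i + c * p.2 i := by fun_prop
  have hCm : MeasurableSet ((fun (p : (ι → ℝ) × (ι → ℝ)) i => a * p.1 i + c * p.2 i) ⁻¹' C) :=
    hrot hC
  let F : (ι → ℝ) → ℝ≥0∞ := fun ω => stdGaussianPi ι {ω' | (fun i => a * ω i + c * ω' i) ∈ C}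
  have hF : Measurable F := measurable_measure_prodMk_left hCm
  have hZ : MeasurableSet {ω | F ω = 0} := hF (measurableSet_singleton 0)
  -- Shifting `ω` by `v` has the same effect on `a ω + c ω'` as shifting `ω'` by `(a / c) v`, which
  -- preserves null sets. So `{F = 0}` is translation invariant; it cannot be conull because `F` has
  -- integral `stdGaussianPi ι C`.
  have hshift : ∀ (v : V) (ω : ι → ℝ), F ω = 0 → F (fun i => ω i + inner ℝ (b i) v) = 0 := by
    intro v ω hω
    have h := (L.quasiMeasurePreserving_add ((a / c) • v)).preimage_null hω
    convert h using 2
    ext ω'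
    simp only [Set.mem_ofPred_eq, Set.mem_preimage]
    have : (fun i => a * (ω i + inner ℝ (b i) v) + c * ω' i) =
        fun i => a * ω i + c * (ω' i + inner ℝ (b i) ((a / c) • v)) := by
      ext i
      rw [inner_smul_right]
      field_simp
      ring
    rw [this]
  have hinv : ∀ v : V, (fun (ω : ι → ℝ) i => ω i + inner ℝ (b i) v) ⁻¹' {ω | F ω = 0} =
      {ω | F ω = 0} := by
    intro v
    ext ω
    refine ⟨fun h => ?_, fun h => hshift v ω h⟩
    have := hshift (-v) _ h
    simpa [inner_neg_right] using this
  have hint : stdGaussianPi ι C = ∫⁻ ω, F ω ∂stdGaussianPi ι := by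
    rw [← (L.measurePreserving_rotation hac).measure_preimage hC.nullMeasurableSet,
      Measure.prod_apply hCm]
    rfl
  rcases L.measure_eq_zero_or_compl hZ hinv with h | h
  · exact measure_eq_zero_iff_ae_notMem.1 h
  · refine absurd ?_ hpos
    rw [hint, lintegral_eq_zero_iff hF]
    exact mem_ae_iff.2 h

end WhiteNoise

end WhiteNoiseInvariance

/-! ### Continuous affine functions and their gradients. -/

section AffineFunctions

variable {V P : Type*} [NormedAddCommGroup V] [InnerProductSpace ℝ V] [MetricSpace P]
  [NormedAddTorsor V P]

/-- The affine function `p ↦ ⟨ξ, p - o⟩`. -/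
noncomputable def innerAffine (o : P) (ξ : V) : P →ᴬ[ℝ] ℝ where
  toFun p := inner ℝ ξ (p -ᵥ o)
  linear := (innerSL ℝ ξ).toLinearMap
  map_vadd' p v := by
    simp [vadd_vsub_assoc, inner_add_right]
  cont := by
    fun_prop

theorem innerAffine_apply (o : P) (ξ : V) (p : P) :
    innerAffine o ξ p = inner ℝ ξ (p -ᵥ o) := rfl

theorem contLinear_innerAffine (o : P) (ξ : V) :
    (innerAffine o ξ).contLinear = innerSL ℝ ξ := by
  ext v
  rfl

theorem innerAffine_add (o : P) (ξ η : V) :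
    innerAffine o (ξ + η) = innerAffine o ξ + innerAffine o η := by
  ext p
  exact inner_add_left _ _ _

theorem innerAffine_smul (o : P) (c : ℝ) (ξ : V) :
    innerAffine o (c • ξ) = c • innerAffine o ξ := by
  ext p
  exact real_inner_smul_left _ _ _

theorem innerAffine_zero (ξ : V) :
    innerAffine (0 : V) ξ = (innerSL ℝ ξ).toContinuousAffineMap := by
  ext p
  simp [innerAffine_apply]

theorem AffineIsometryEquiv.inner_symm_linearIsometryEquiv (g : P ≃ᵃⁱ[ℝ] P) (ξ : V) (p q : P) :
    inner ℝ (g.linearIsometryEquiv.symm ξ) (p -ᵥ q) = inner ℝ ξ (g p -ᵥ g q) := by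
  rw [← g.linearIsometryEquiv.inner_map_map, LinearIsometryEquiv.apply_symm_apply]
  simp

variable [CompleteSpace V]

/-- The gradient of a continuous affine function. -/
noncomputable def affineGradient (f : P →ᴬ[ℝ] ℝ) : V :=
  (InnerProductSpace.toDual ℝ V).symm f.contLinear

theorem inner_affineGradient (f : P →ᴬ[ℝ] ℝ) (v : V) :
    inner ℝ (affineGradient f) v = f.contLinear v :=
  InnerProductSpace.toDual_symm_apply

theorem nnnorm_affineGradient (f : P →ᴬ[ℝ] ℝ) : ‖affineGradient f‖₊ = ‖f.contLinear‖₊ :=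
  LinearIsometryEquiv.nnnorm_map _ _

theorem affineGradient_add (f g : P →ᴬ[ℝ] ℝ) :
    affineGradient (f + g) = affineGradient f + affineGradient g := by
  rw [affineGradient, ContinuousAffineMap.add_contLinear, map_add]
  rfl

theorem affineGradient_smul (c : ℝ) (f : P →ᴬ[ℝ] ℝ) :
    affineGradient (c • f) = c • affineGradient f := by
  rw [affineGradient, ContinuousAffineMap.smul_contLinear]
  simp [affineGradient]

theorem affineGradient_innerAffine (o : P) (ξ : V) : affineGradient (innerAffine o ξ) = ξ := by
  rw [affineGradient, contLinear_innerAffine]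
  exact (InnerProductSpace.toDual ℝ V).symm_apply_apply ξ

theorem affine_apply_eq (f : P →ᴬ[ℝ] ℝ) (o p : P) :
    f p = f o + inner ℝ (affineGradient f) (p -ᵥ o) := by
  have h := f.contLinear_map_vsub p o
  rw [inner_affineGradient, h]
  simp

theorem affine_eq_const_add (f : P →ᴬ[ℝ] ℝ) (o : P) :
    f = ContinuousAffineMap.const ℝ P (f o) + innerAffine o (affineGradient f) := by
  ext p
  exact affine_apply_eq f o p

end AffineFunctions

/-! ### The Gaussian density, action and pairing on sequence space. -/

section CanonicalDensity

variable {V P ι : Type*} [NormedAddCommGroup V] [InnerProductSpace ℝ V] [MeasurableSpace V]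
  [MetricSpace P] [NormedAddTorsor V P] {b : HilbertBasis ι ℝ V}

namespace WhiteNoise

/-- Translation by `v` adds the drift `⟨ξ, v⟩`. With the drift removed the process is isonormal
again, so it is identified with `L` by comparing coordinates alone. -/
theorem isonormal_translate (L : WhiteNoise b) (v : V) :
    IsIsonormal (fun (ξ : V) ω => L.toFun (fun i => ω i + inner ℝ (b i) v) ξ - inner ℝ ξ v)
      (stdGaussianPi ι) where
  measurable ξ := ((L.measurable_apply ξ).comp (by fun_prop)).sub_const _
  add ξ η := by
    filter_upwards [(L.quasiMeasurePreserving_add v).ae (L.isonormal.add ξ η)] with ω hω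
    rw [hω, inner_add_left]
    ring
  smul c ξ := by
    filter_upwards [(L.quasiMeasurePreserving_add v).ae (L.isonormal.smul c ξ)] with ω hω
    rw [hω, real_inner_smul_left]
    ring
  lintegral_eexp ξ := by
    have h := L.isonormal.lintegral_eexp_withDensity v ξ
    have hm := L.measurable_apply ξ
    rw [← L.map_add v, lintegral_map (by fun_prop) (by fun_prop)] at h
    simp_rw [sub_eq_neg_add, eexp_add]
    have hm' : Measurable fun ω : ι → ℝ => L.toFun (fun i => ω i + inner ℝ (b i) v) ξ :=
      hm.comp (by fun_prop)
    rw [lintegral_const_mul _ (by fun_prop), h, ← eexp_add]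
    congr 1
    ring

theorem translate_ae (L : WhiteNoise b) (v ξ : V) : ∀ᵐ ω ∂stdGaussianPi ι,
    L.toFun (fun i => ω i + inner ℝ (b i) v) ξ = L.toFun ω ξ + inner ℝ ξ v := by
  have h := (L.isonormal_translate v).ae_eq_of_dense L.isonormal b.dense_range_span (fun i => ?_) ξ
  · filter_upwards [h] with ω hω
    rw [← hω]
    ring
  · filter_upwards [(L.quasiMeasurePreserving_add v).ae (L.basis i), L.basis i] with ω h1 h2
    rw [h1, h2]
    ring

/-- The transformation of the sequence space attached to an affine isometry `g`, in the
coordinates centered at `o`. -/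
noncomputable def isometryMap (L : WhiteNoise b) (o : P) (g : P ≃ᵃⁱ[ℝ] P) (ω : ι → ℝ) : ι → ℝ :=
  fun i => L.toFun ω (g.linearIsometryEquiv.symm (b i)) + inner ℝ (b i) (g o -ᵥ o)

theorem isonormal_comp_isometry (L : WhiteNoise b) (U : V ≃ₗᵢ[ℝ] V) :
    IsIsonormal (fun ξ ω => L.toFun ω (U ξ)) (stdGaussianPi ι) where
  measurable ξ := L.measurable_apply (U ξ)
  add ξ η := by
    rw [_root_.map_add]
    exact L.isonormal.add (U ξ) (U η)
  smul c ξ := by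
    rw [map_smul]
    exact L.isonormal.smul c (U ξ)
  lintegral_eexp ξ := by rw [L.isonormal.lintegral_eexp, U.norm_map]

theorem measurable_rotationMap (L : WhiteNoise b) (U : V ≃ₗᵢ[ℝ] V) :
    Measurable fun (ω : ι → ℝ) i => L.toFun ω (U (b i)) :=
  measurable_pi_lambda _ fun _ => L.measurable_apply _

theorem measurePreserving_rotationMap (L : WhiteNoise b) (U : V ≃ₗᵢ[ℝ] V) :
    MeasurePreserving (fun (ω : ι → ℝ) i => L.toFun ω (U (b i)))
      (stdGaussianPi ι) (stdGaussianPi ι) :=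
  (L.isonormal_comp_isometry U).measurePreserving_coord (b := b) (L.measurable_rotationMap U)
    fun _ => ae_of_all _ fun _ => rfl

theorem rotationMap_ae (L : WhiteNoise b) (U : V ≃ₗᵢ[ℝ] V) (ξ : V) :
    ∀ᵐ ω ∂stdGaussianPi ι, L.toFun (fun i => L.toFun ω (U (b i))) ξ = L.toFun ω (U ξ) :=
  L.comp_coord_ae (L.isonormal_comp_isometry U) (L.measurable_rotationMap U)
    (fun _ => ae_of_all _ fun _ => rfl) ξ

theorem quasiMeasurePreserving_isometryMap (L : WhiteNoise b) (o : P) (g : P ≃ᵃⁱ[ℝ] P) :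
    Measure.QuasiMeasurePreserving (L.isometryMap o g) (stdGaussianPi ι) (stdGaussianPi ι) :=
  (L.quasiMeasurePreserving_add (g o -ᵥ o)).comp
    (L.measurePreserving_rotationMap g.linearIsometryEquiv.symm).quasiMeasurePreserving

/-- The map is a rotation by the linear part followed by the translation by `g o - o`. The rotation
acts on noise by duality, which is why the inverse linear part appears on `ξ`. -/
theorem isometryMap_ae (L : WhiteNoise b) (o : P) (g : P ≃ᵃⁱ[ℝ] P) (ξ : V) :
    ∀ᵐ ω ∂stdGaussianPi ι, L.toFun (L.isometryMap o g ω) ξ =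
      L.toFun ω (g.linearIsometryEquiv.symm ξ) + inner ℝ ξ (g o -ᵥ o) := by
  have h1 := (L.measurePreserving_rotationMap g.linearIsometryEquiv.symm).quasiMeasurePreserving.ae
    (L.translate_ae (g o -ᵥ o) ξ)
  filter_upwards [h1, L.rotationMap_ae g.linearIsometryEquiv.symm ξ] with ω h2 h3
  rw [← h3, ← h2]
  rfl

/-- The Gaussian measure on the sequence space centered at the point `p`. -/
noncomputable def measureAt (L : WhiteNoise b) (o p : P) : Measure (ι → ℝ) :=
  (stdGaussianPi ι).withDensity fun ω => eexp (L.toFun ω (p -ᵥ o) - ‖p -ᵥ o‖ ^ 2 / 2)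

theorem isProbabilityMeasure_measureAt (L : WhiteNoise b) (o p : P) :
    IsProbabilityMeasure (L.measureAt o p) :=
  L.isonormal.isProbabilityMeasure_withDensity (p -ᵥ o)

theorem measureAt_absolutelyContinuous (L : WhiteNoise b) (o p : P) :
    L.measureAt o p ≪ stdGaussianPi ι := withDensity_absolutelyContinuous _ _

theorem absolutelyContinuous_measureAt (L : WhiteNoise b) (o p : P) :
    stdGaussianPi ι ≪ L.measureAt o p := by
  have := L.measurable_apply (p -ᵥ o)
  exact withDensity_absolutelyContinuous' (by fun_prop) (ae_of_all _ fun ω => eexp_ne_zero _)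

theorem lintegral_eexp_measureAt (L : WhiteNoise b) (o p : P) (ξ : V) :
    ∫⁻ ω, eexp (L.toFun ω ξ) ∂(L.measureAt o p) = eexp (inner ℝ ξ (p -ᵥ o) + ‖ξ‖ ^ 2 / 2) :=
  L.isonormal.lintegral_eexp_withDensity (p -ᵥ o) ξ

theorem map_isometryMap (L : WhiteNoise b) (o : P) (g : P ≃ᵃⁱ[ℝ] P) (p : P) :
    (L.measureAt o p).map (L.isometryMap o g) = L.measureAt o (g p) := by
  have hq := L.quasiMeasurePreserving_isometryMap o g
  have := L.isProbabilityMeasure_measureAt o p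
  have := L.isProbabilityMeasure_measureAt o (g p)
  have := Measure.isProbabilityMeasure_map hq.measurable.aemeasurable (μ := L.measureAt o p)
  have key : ∀ ξ, ∫⁻ ω, eexp (L.toFun ω ξ) ∂((L.measureAt o p).map (L.isometryMap o g)) =
      eexp (inner ℝ ξ (g p -ᵥ o) + ‖ξ‖ ^ 2 / 2) := by
    intro ξ
    have hm := L.measurable_apply ξ
    have hm' := L.measurable_apply (g.linearIsometryEquiv.symm ξ)
    rw [lintegral_map (by fun_prop) hq.measurable]
    calc ∫⁻ ω, eexp (L.toFun (L.isometryMap o g ω) ξ) ∂(L.measureAt o p)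
        = ∫⁻ ω, eexp (L.toFun ω (g.linearIsometryEquiv.symm ξ)) * eexp (inner ℝ ξ (g o -ᵥ o))
            ∂(L.measureAt o p) := by
          refine lintegral_congr_ae ?_
          filter_upwards [(L.measureAt_absolutelyContinuous o p).ae_le (L.isometryMap_ae o g ξ)]
            with ω hω
          rw [hω, eexp_add]
      _ = eexp (inner ℝ ξ (g p -ᵥ o) + ‖ξ‖ ^ 2 / 2) := by
          rw [lintegral_mul_const _ (by fun_prop), L.lintegral_eexp_measureAt, ← eexp_add,
            AffineIsometryEquiv.inner_symm_linearIsometryEquiv, LinearIsometryEquiv.norm_map,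
            ← vsub_add_vsub_cancel (g p) (g o) o, inner_add_right]
          congr 1
          ring
  refine L.ext_of_lintegral_eexp ?_ (L.measureAt_absolutelyContinuous o _) (fun ξ => ?_) fun ξ => ?_
  · exact ((L.measureAt_absolutelyContinuous o p).map hq.measurable).trans hq.absolutelyContinuous
  · rw [key, L.lintegral_eexp_measureAt]
  · rw [key]
    exact eexp_ne_top _

/-- The cocycle identity `gho - o = (gho - go) + (go - o)`, coordinate by coordinate; countability
of `ι` unites the exceptional null sets. -/
theorem isometryMap_mul_ae [Countable ι] (L : WhiteNoise b) (o : P) (g h : P ≃ᵃⁱ[ℝ] P) :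
    ∀ᵐ ω ∂stdGaussianPi ι, L.isometryMap o (g * h) ω = L.isometryMap o g (L.isometryMap o h ω) := by
  have h1 := ae_all_iff.2 fun i => L.isometryMap_ae o h (g.linearIsometryEquiv.symm (b i))
  filter_upwards [h1] with ω hω
  ext i
  change L.toFun ω (h.linearIsometryEquiv.symm (g.linearIsometryEquiv.symm (b i))) +
    inner ℝ (b i) (g (h o) -ᵥ o) =
    L.toFun (L.isometryMap o h ω) (g.linearIsometryEquiv.symm (b i)) + inner ℝ (b i) (g o -ᵥ o)
  rw [hω i, AffineIsometryEquiv.inner_symm_linearIsometryEquiv,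
    ← vsub_add_vsub_cancel (g (h o)) (g o) o, inner_add_right]
  ring

theorem isometryMap_one_ae [Countable ι] (L : WhiteNoise b) (o : P) :
    ∀ᵐ ω ∂stdGaussianPi ι, L.isometryMap o (1 : P ≃ᵃⁱ[ℝ] P) ω = ω := by
  filter_upwards [ae_all_iff.2 L.basis] with ω hω
  ext i
  change L.toFun ω (b i) + inner ℝ (b i) (o -ᵥ o) = ω i
  simp [hω i]

variable [CompleteSpace V]

/-- The Gaussian density on the sequence space, in the coordinates centered at `o`. -/
noncomputable def gaussianDensity [Countable ι] (L : WhiteNoise b) (o : P) :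
    GaussianDensity V P (ι → ℝ) where
  μ p := L.measureAt o p
  isProbabilityMeasure p := L.isProbabilityMeasure_measureAt o p
  equivalent p q :=
    (L.measureAt_absolutelyContinuous o p).trans (L.absolutelyContinuous_measureAt o q)
  hat f ω := f o + L.toFun ω (affineGradient f)
  measurable_hat f := (L.measurable_apply _).const_add _
  hat_add f g p := by
    filter_upwards [(L.measureAt_absolutelyContinuous o p).ae_le
      (L.isonormal.add (affineGradient f) (affineGradient g))] with ω hω
    rw [affineGradient_add, hω]
    simp only [ContinuousAffineMap.add_apply]
    ring
  hat_smul c f p := by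
    filter_upwards [(L.measureAt_absolutelyContinuous o p).ae_le
      (L.isonormal.smul c (affineGradient f))] with ω hω
    rw [affineGradient_smul, hω]
    simp only [ContinuousAffineMap.smul_apply, smul_eq_mul]
    ring
  law_hat f p := by
    have := L.isProbabilityMeasure_measureAt o p
    have hm := L.measurable_apply (affineGradient f)
    have key : ∀ s : ℝ, ∫⁻ ω, eexp (s * (f o + L.toFun ω (affineGradient f)))
        ∂(L.measureAt o p) = eexp (f p * s + (‖f.contLinear‖₊ ^ 2 : ℝ≥0) * s ^ 2 / 2) := by
      intro s
      calc ∫⁻ ω, eexp (s * (f o + L.toFun ω (affineGradient f))) ∂(L.measureAt o p)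
          = ∫⁻ ω, eexp (s * f o) * eexp (L.toFun ω (s • affineGradient f))
              ∂(L.measureAt o p) := by
            refine lintegral_congr_ae ?_
            filter_upwards [(L.measureAt_absolutelyContinuous o p).ae_le
              (L.isonormal.smul s (affineGradient f))] with ω hω
            rw [hω, mul_add, eexp_add]
        _ = _ := by
            have hm' := L.measurable_apply (s • affineGradient f)
            rw [lintegral_const_mul _ (by fun_prop), L.lintegral_eexp_measureAt, ← eexp_add,
              affine_apply_eq f o p, real_inner_smul_left, norm_smul, ← nnnorm_affineGradient]
            congr 1
            simp only [Real.norm_eq_abs, mul_pow, sq_abs, NNReal.coe_pow, coe_nnnorm]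
            ring
    rw [← Measure.map_id (μ := gaussianReal _ _)]
    refine map_eq_of_lintegral_eexp (by fun_prop) measurable_id (fun s => ?_) fun s => ?_
    · simp_rw [id]
      rw [key, lintegral_eexp_gaussianReal]
    · rw [key]
      exact eexp_ne_top _
  generates A hA := by
    -- `Ψ` collects the random variables of the coordinate functions. It is the identity almost
    -- everywhere and measurable for the generated σ-algebra, so `Ψ ⁻¹' A` is the set required.
    let Ψ : (ι → ℝ) → ι → ℝ := fun ω i =>
      innerAffine o (b i) o + L.toFun ω (affineGradient (innerAffine o (b i)))
    have hΨ : ∀ᵐ ω ∂stdGaussianPi ι, Ψ ω = ω := by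
      filter_upwards [ae_all_iff.2 L.basis] with ω hω
      ext i
      simp [Ψ, affineGradient_innerAffine, innerAffine_apply, hω i]
    refine ⟨Ψ ⁻¹' A, ?_, fun p => ?_⟩
    · let m : MeasurableSpace (ι → ℝ) := ⨆ f : P →ᴬ[ℝ] ℝ,
        MeasurableSpace.comap (fun ω => f o + L.toFun ω (affineGradient f)) inferInstance
      have hm : Measurable[m, MeasurableSpace.pi] Ψ := @measurable_pi_lambda _ _ _ m _ Ψ fun i =>
        Measurable.mono (comap_measurable _) (le_iSup (fun f : P →ᴬ[ℝ] ℝ =>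
          MeasurableSpace.comap (fun ω => f o + L.toFun ω (affineGradient f)) inferInstance)
          (innerAffine o (b i))) le_rfl
      exact hm hA
    · filter_upwards [(L.measureAt_absolutelyContinuous o p).ae_le hΨ] with ω hω
      exact propext ⟨fun h => by change Ψ ω ∈ A; rwa [hω], fun h => by
        change Ψ ω ∈ A at h; rwa [hω] at h⟩

theorem refMeasure_absolutelyContinuous [Countable ι] (L : WhiteNoise b) (o : P) :
    (L.gaussianDensity o).refMeasure ≪ stdGaussianPi ι :=
  L.measureAt_absolutelyContinuous o _

/-- The Gaussian action on the sequence space. -/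
noncomputable def gaussianAction [Countable ι] [BorelSpace V] [TopologicalSpace.SeparableSpace V]
    {G : Type*} [Group G] [TopologicalSpace G] [IsTopologicalGroup G]
    [MeasurableSpace G] [BorelSpace G] [SecondCountableTopology G]
    (L : WhiteNoise b) (o : P) (α : AffineIsometricAction G V P) :
    GaussianAction α (L.gaussianDensity o) where
  toFun g := L.isometryMap o (α.toHom g)
  measurable := by
    refine measurable_pi_lambda _ fun i => ?_
    have h1 : Measurable fun g : G => (α.toHom g).linearIsometryEquiv.symm (b i) := by
      -- The inverse linear part at a fixed vector is a difference of two orbit maps evaluated at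
      -- `g⁻¹`, hence continuous in `g`.
      have heq : (fun g : G => (α.toHom g).linearIsometryEquiv.symm (b i)) =
          fun g => α.toHom g⁻¹ (b i +ᵥ o) -ᵥ α.toHom g⁻¹ o := by
        ext g
        rw [map_inv, ← AffineIsometryEquiv.map_vsub, vadd_vsub]
        rfl
      rw [heq]
      exact (((α.continuous_orbit _).comp continuous_inv).vsub
        ((α.continuous_orbit _).comp continuous_inv)).measurable
    have h2 : Measurable fun g : G => (inner ℝ (b i) (α.toHom g o -ᵥ o) : ℝ) := by
      have := (α.continuous_orbit o).vsub (continuous_const (y := o))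
      exact (continuous_const.inner this).measurable
    exact (L.measurable.comp (measurable_snd.prodMk (h1.comp measurable_fst))).add
      (h2.comp measurable_fst)
  nonsingular g := by
    refine ⟨(L.quasiMeasurePreserving_isometryMap o _).measurable, ?_⟩
    change (L.measureAt o _).map _ ≪ L.measureAt o _
    rw [L.map_isometryMap]
    exact (L.measureAt_absolutelyContinuous o _).trans (L.absolutelyContinuous_measureAt o _)
  one_ae := by
    refine (L.refMeasure_absolutelyContinuous o).ae_le ?_
    rw [map_one]
    exact L.isometryMap_one_ae o
  mul_ae g h := by
    refine (L.refMeasure_absolutelyContinuous o).ae_le ?_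
    rw [map_mul]
    exact L.isometryMap_mul_ae o _ _
  map_eq g p := L.map_isometryMap o _ p

/-- The white noise is a version of the pairing of `V` with its Gaussian density. -/
noncomputable def gaussianPairing [Countable ι] (L : WhiteNoise b) :
    GaussianPairing (L.gaussianDensity (0 : V)) where
  toFun := L.toFun
  measurable := L.measurable
  eq_hat ξ := by
    refine ae_of_all _ fun ω => ?_
    rw [← innerAffine_zero]
    change _ = innerAffine 0 ξ 0 + L.toFun ω (affineGradient (innerAffine 0 ξ))
    simp [affineGradient_innerAffine, innerAffine_apply]

end WhiteNoise

end CanonicalDensity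

/-! ### Arbitrary Gaussian densities reduced to the white noise. -/

section DensityStructure

variable {V P X : Type*} [NormedAddCommGroup V] [InnerProductSpace ℝ V]
  [MetricSpace P] [NormedAddTorsor V P] [MeasurableSpace X]

namespace GaussianDensity

theorem lintegral_eexp_hat (D : GaussianDensity V P X) (f : P →ᴬ[ℝ] ℝ) (x : P) :
    ∫⁻ ω, eexp (D.hat f ω) ∂(D.μ x) = eexp (f x + ‖f.contLinear‖ ^ 2 / 2) := by
  have h := lintegral_eexp_gaussianReal (f x) (‖f.contLinear‖₊ ^ 2) 1
  rw [← D.law_hat, lintegral_map (by fun_prop) (D.measurable_hat f)] at h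
  simpa using h

theorem hat_const_ae (D : GaussianDensity V P X) (c : ℝ) (x : P) :
    ∀ᵐ ω ∂(D.μ x), D.hat (ContinuousAffineMap.const ℝ P c) ω = c := by
  have h := D.law_hat (ContinuousAffineMap.const ℝ P c) x
  have h0 : (ContinuousAffineMap.const ℝ P c).contLinear = (0 : V →L[ℝ] ℝ) := by
    ext v
    rfl
  rw [h0, nnnorm_zero, zero_pow two_ne_zero, gaussianReal_zero_var] at h
  have h1 : ∀ᵐ r ∂((D.μ x).map (D.hat (ContinuousAffineMap.const ℝ P c))), r = c := by
    rw [h]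
    exact (ae_dirac_iff (measurableSet_singleton c)).2 rfl
  exact ae_of_ae_map (D.measurable_hat _).aemeasurable h1

theorem hat_sum_ae (D : GaussianDensity V P X) (s : Finset (P →ᴬ[ℝ] ℝ)) (c : (P →ᴬ[ℝ] ℝ) → ℝ)
    (x : P) : ∀ᵐ ω ∂(D.μ x), D.hat (∑ f ∈ s, c f • f) ω = ∑ f ∈ s, c f * D.hat f ω := by
  classical
  induction s using Finset.induction_on with
  | empty =>
    filter_upwards [D.hat_smul 0 0 x] with ω hω
    simpa using hω
  | insert f s hf ih =>
    filter_upwards [ih, D.hat_add (c f • f) (∑ f ∈ s, c f • f) x, D.hat_smul (c f) f x]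
      with ω h1 h2 h3
    rw [Finset.sum_insert hf, Finset.sum_insert hf, h2, h3, h1]

/-- A finite measure in the measure class of a Gaussian density is determined by the Laplace
transforms of the affine functions. -/
theorem ext_of_lintegral_eexp_hat (D : GaussianDensity V P X) (x : P) {μ ν : Measure X}
    [IsFiniteMeasure μ] [IsFiniteMeasure ν] (hμ : μ ≪ D.μ x) (hν : ν ≪ D.μ x)
    (h : ∀ f, ∫⁻ ω, eexp (D.hat f ω) ∂μ = ∫⁻ ω, eexp (D.hat f ω) ∂ν)
    (hfin : ∀ f, ∫⁻ ω, eexp (D.hat f ω) ∂μ ≠ ∞) : μ = ν := by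
  -- The Laplace transforms determine the joint law of all the `hat f`; the axiom `generates` says
  -- that `Φ` recovers every measurable set up to null sets.
  let Φ : X → (P →ᴬ[ℝ] ℝ) → ℝ := fun ω f => D.hat f ω
  have hΦ : Measurable Φ := measurable_pi_lambda _ D.measurable_hat
  have key : ∀ ν : Measure X, ν ≪ D.μ x → ∀ (s : Finset (P →ᴬ[ℝ] ℝ)) (c : (P →ᴬ[ℝ] ℝ) → ℝ),
      ∫⁻ r, eexp (∑ f ∈ s, c f * r f) ∂(ν.map Φ) = ∫⁻ ω, eexp (D.hat (∑ f ∈ s, c f • f) ω) ∂ν := by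
    intro ν hν s c
    rw [lintegral_map (by fun_prop) hΦ]
    refine lintegral_congr_ae ?_
    filter_upwards [hν.ae_le (D.hat_sum_ae s c x)] with ω hω
    rw [hω]
  have hmap : μ.map Φ = ν.map Φ := by
    refine Measure.pi_ext_of_lintegral_eexp (fun s c => ?_) fun s c => ?_
    · rw [key μ hμ, key ν hν, h]
    · rw [key μ hμ]
      exact hfin _
  ext A hA
  obtain ⟨B, hB, hAB⟩ := D.generates A hA
  have hcomap : (⨆ f, MeasurableSpace.comap (D.hat f) inferInstance) =
      MeasurableSpace.comap Φ MeasurableSpace.pi := by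
    simp only [MeasurableSpace.pi, MeasurableSpace.comap_iSup, MeasurableSpace.comap_comp]
    rfl
  rw [hcomap] at hB
  obtain ⟨S, hS, rfl⟩ := hB
  rw [measure_congr (hμ.ae_le (hAB x)), measure_congr (hν.ae_le (hAB x)),
    ← Measure.map_apply hΦ hS, ← Measure.map_apply hΦ hS, hmap]

/-- Affine functions vanishing at `y` have mean zero under `μ y`, which gives each point its own
centered process. -/
theorem isonormal_hat (D : GaussianDensity V P X) (y : P) :
    IsIsonormal (fun ξ ω => D.hat (innerAffine y ξ) ω) (D.μ y) where
  measurable ξ := D.measurable_hat _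
  add ξ η := by
    rw [innerAffine_add]
    exact D.hat_add _ _ y
  smul c ξ := by
    rw [innerAffine_smul]
    exact D.hat_smul _ _ y
  lintegral_eexp ξ := by
    rw [D.lintegral_eexp_hat, contLinear_innerAffine, innerAffine_apply, vsub_self,
      inner_zero_right, zero_add, innerSL_apply_norm]

/-- The Cameron–Martin formula for a Gaussian density. -/
theorem eq_withDensity_hat [CompleteSpace V] (D : GaussianDensity V P X) (y z : P) :
    D.μ z = (D.μ y).withDensity fun ω =>
      eexp (D.hat (innerAffine y (z -ᵥ y)) ω - ‖z -ᵥ y‖ ^ 2 / 2) := by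
  have hiso := D.isonormal_hat y
  have := D.isProbabilityMeasure z
  have := hiso.isProbabilityMeasure_withDensity (z -ᵥ y)
  refine D.ext_of_lintegral_eexp_hat y (D.equivalent z y) (withDensity_absolutelyContinuous _ _)
    (fun f => ?_) fun f => ?_
  · have h1 := hiso.lintegral_eexp_withDensity (z -ᵥ y) (affineGradient f)
    have hm := D.measurable_hat (innerAffine y (affineGradient f))
    have hn : ‖f.contLinear‖ = ‖affineGradient f‖ :=
      congrArg NNReal.toReal (nnnorm_affineGradient f).symm
    rw [D.lintegral_eexp_hat, affine_apply_eq f y z, hn, add_assoc, eexp_add, ← h1,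
      ← lintegral_const_mul _ (by fun_prop)]
    refine lintegral_congr_ae ?_
    have h2 : ∀ᵐ ω ∂(D.μ y), D.hat f ω = f y + D.hat (innerAffine y (affineGradient f)) ω := by
      filter_upwards [D.hat_add (ContinuousAffineMap.const ℝ P (f y))
        (innerAffine y (affineGradient f)) y, D.hat_const_ae (f y) y] with ω h3 h4
      rwa [h4, ← affine_eq_const_add] at h3
    filter_upwards [(withDensity_absolutelyContinuous _ _).ae_le h2] with ω hω
    rw [hω, eexp_add]
  · rw [D.lintegral_eexp_hat]
    exact eexp_ne_top _

variable {ι : Type*} {b : HilbertBasis ι ℝ V}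

/-- The coordinates of a Gaussian density in a Hilbert basis, centered at `y`. -/
noncomputable def coord (D : GaussianDensity V P X) (b : HilbertBasis ι ℝ V) (y : P) (ω : X) : ι → ℝ :=
  fun i => D.hat (innerAffine y (b i)) ω

theorem measurePreserving_coord (D : GaussianDensity V P X) (b : HilbertBasis ι ℝ V) (y : P) :
    MeasurePreserving (D.coord b y) (D.μ y) (stdGaussianPi ι) :=
  (D.isonormal_hat y).measurePreserving_coord (b := b)
    (measurable_pi_lambda _ fun _ => D.measurable_hat _) fun _ => ae_of_all _ fun _ => rfl

theorem ae_refMeasure_iff (D : GaussianDensity V P X) (y : P) {p : X → Prop} :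
    (∀ᵐ ω ∂D.refMeasure, p ω) ↔ ∀ᵐ ω ∂(D.μ y), p ω :=
  ⟨fun h => (D.equivalent y _).ae_le h, fun h => (D.equivalent _ y).ae_le h⟩

variable [MeasurableSpace V]

/-- This makes all statements independent of the chosen density: its random variables are those of
the one model, pulled back along the coordinates. -/
theorem whiteNoise_coord_ae (D : GaussianDensity V P X) (L : WhiteNoise b) (y : P) (ξ : V) :
    ∀ᵐ ω ∂(D.μ y), L.toFun (D.coord b y ω) ξ = D.hat (innerAffine y ξ) ω :=
  L.comp_coord_ae (D.isonormal_hat y) (D.measurePreserving_coord b y).measurable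
    (fun _ => ae_of_all _ fun _ => rfl) ξ

theorem eq_withDensity [CompleteSpace V] (D : GaussianDensity V P X) (L : WhiteNoise b) (y z : P) :
    D.μ z = (D.μ y).withDensity fun ω =>
      eexp (L.toFun (D.coord b y ω) (z -ᵥ y) - ‖z -ᵥ y‖ ^ 2 / 2) := by
  rw [D.eq_withDensity_hat y z]
  refine withDensity_congr_ae ?_
  filter_upwards [D.whiteNoise_coord_ae L y (z -ᵥ y)] with ω hω
  rw [hω]

end GaussianDensity

end DensityStructure

/-! ### Dissipativity and recurrence in terms of a density. -/

section FiberedHaar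

theorem exists_eq_smul_of_isHaarMeasure {G : Type*} [Group G] [TopologicalSpace G]
    [IsTopologicalGroup G] [LocallyCompactSpace G] [SecondCountableTopology G] [MeasurableSpace G]
    [BorelSpace G] (m' m : Measure G) [m'.IsHaarMeasure] [m.IsHaarMeasure] :
    ∃ c : ℝ≥0∞, c ≠ 0 ∧ c ≠ ∞ ∧ m' = c • m := by
  refine ⟨Measure.haarScalarFactor m' m, ?_, ENNReal.coe_ne_top,
    Measure.isMulLeftInvariant_eq_smul m' m⟩
  exact_mod_cast (Measure.haarScalarFactor_pos_of_isHaarMeasure m' m).ne'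

/-- The identities of an action or of a process hold off a null set depending on `g`. Joint
measurability and Fubini exchange the quantifiers, so they may be used under an integral over `g`.
-/
theorem ae_lintegral_eq_of_forall_ae_eq {G X : Type*} [MeasurableSpace G] [MeasurableSpace X]
    {m : Measure G} {ν : Measure X} [SFinite m] [SFinite ν] {F F' : G × X → ℝ≥0∞}
    (hF : Measurable F) (hF' : Measurable F') (h : ∀ g, ∀ᵐ ω ∂ν, F (g, ω) = F' (g, ω)) :
    ∀ᵐ ω ∂ν, ∫⁻ g, F (g, ω) ∂m = ∫⁻ g, F' (g, ω) ∂m := by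
  have hset : MeasurableSet {p : G × X | F (p.1, p.2) = F' (p.1, p.2)} :=
    measurableSet_eq_fun hF hF'
  have h1 := (Measure.ae_ae_comm hset).1 (ae_of_all m h)
  filter_upwards [h1] with ω hω
  exact lintegral_congr_ae hω

namespace NonsingularAction

variable {G X : Type*} [Group G] [MeasurableSpace G] [MeasurableSpace X] {ν : Measure X}

theorem measurable_toFun (σ : NonsingularAction G ν) (g : G) : Measurable (σ.toFun g) :=
  (σ.nonsingular g).measurable

section Basic

variable [MeasurableInv G]

theorem measurable_comp_inv (σ : NonsingularAction G ν) {f : X → ℝ≥0∞} (hf : Measurable f) :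
    Measurable fun p : G × X => f (σ.toFun p.1⁻¹ p.2) :=
  hf.comp (σ.measurable.comp ((measurable_inv.comp measurable_fst).prodMk measurable_snd))

theorem measurable_comp_inv_left (σ : NonsingularAction G ν) {f : X → ℝ≥0∞} (hf : Measurable f)
    (ω : X) : Measurable fun g : G => f (σ.toFun g⁻¹ ω) :=
  (σ.measurable_comp_inv hf).comp measurable_prodMk_right

theorem measurable_fiberedHaar (σ : NonsingularAction G ν) (m : Measure G) [SFinite m]
    {f : X → ℝ≥0∞} (hf : Measurable f) : Measurable (σ.fiberedHaar m f) :=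
  (σ.measurable_comp_inv hf).lintegral_prod_left'

theorem fiberedHaar_invariant [MeasurableMul G] (σ : NonsingularAction G ν)
    (m : Measure G) [SFinite m] [SFinite ν] [m.IsMulLeftInvariant] {f : X → ℝ≥0∞}
    (hf : Measurable f) (h : G) :
    ∀ᵐ ω ∂ν, σ.fiberedHaar m f (σ.toFun h ω) = σ.fiberedHaar m f ω := by
  have h1 := ae_lintegral_eq_of_forall_ae_eq (m := m) (ν := ν)
    (F := fun p : G × X => f (σ.toFun p.1⁻¹ (σ.toFun h p.2)))
    (F' := fun p => f (σ.toFun (h⁻¹ * p.1)⁻¹ p.2))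
    ((σ.measurable_comp_inv hf).comp
      (measurable_fst.prodMk ((σ.measurable_toFun h).comp measurable_snd)))
    ((σ.measurable_comp_inv hf).comp
      (((measurable_const_mul h⁻¹).comp measurable_fst).prodMk measurable_snd)) (fun g => by
      filter_upwards [σ.mul_ae g⁻¹ h] with ω hω
      simp [← hω])
  filter_upwards [h1] with ω hω
  rw [fiberedHaar, hω]
  exact lintegral_mul_left_eq_self (fun g => f (σ.toFun g⁻¹ ω)) h⁻¹

/-- Right translation multiplies a left Haar measure by a finite constant, a value of the modular
function. -/
theorem fiberedHaar_comp_lt_top [TopologicalSpace G] [IsTopologicalGroup G] [BorelSpace G]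
    [LocallyCompactSpace G] [SecondCountableTopology G] (σ : NonsingularAction G ν)
    (m : Measure G) [m.IsHaarMeasure] [SFinite ν] {f : X → ℝ≥0∞} (hf : Measurable f) (h : G) :
    ∃ c : ℝ≥0∞, c ≠ ∞ ∧
      ∀ᵐ ω ∂ν, σ.fiberedHaar m (fun ω => f (σ.toFun h ω)) ω = c * σ.fiberedHaar m f ω := by
  obtain ⟨c, -, hc, hm⟩ := exists_eq_smul_of_isHaarMeasure (m.map (· * h⁻¹)) m
  refine ⟨c, hc, ?_⟩
  have h1 := ae_lintegral_eq_of_forall_ae_eq (m := m) (ν := ν)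
    (F := fun p : G × X => f (σ.toFun h (σ.toFun p.1⁻¹ p.2)))
    (F' := fun p => f (σ.toFun (p.1 * h⁻¹)⁻¹ p.2))
    (σ.measurable_comp_inv (f := fun ω => f (σ.toFun h ω)) (hf.comp (σ.measurable_toFun h)))
    ((σ.measurable_comp_inv hf).comp
      (((measurable_mul_const h⁻¹).comp measurable_fst).prodMk measurable_snd)) (fun g => by
      filter_upwards [σ.mul_ae h g⁻¹] with ω hω
      simp [← hω])
  filter_upwards [h1] with ω hω
  rw [fiberedHaar, hω, fiberedHaar]
  have h2 := lintegral_map (μ := m) (σ.measurable_comp_inv_left hf ω) (measurable_mul_const h⁻¹)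
  rw [← h2, hm, lintegral_smul_measure, smul_eq_mul]

theorem measurable_lintegral_inv {ρ : G → X → ℝ≥0∞} (m : Measure G) [SFinite m]
    (hρm : Measurable fun p : G × X => ρ p.1 p.2) : Measurable fun ω => ∫⁻ g, ρ g⁻¹ ω ∂m := by
  have : Measurable fun p : G × X => ρ p.1⁻¹ p.2 :=
    hρm.comp ((measurable_inv.comp measurable_fst).prodMk measurable_snd)
  exact this.lintegral_prod_left'

end Basic

section Criterion

variable [TopologicalSpace G] [IsTopologicalGroup G] [BorelSpace G]
  {μ₁ μ₂ : Measure X} [SFinite μ₁] [SFinite μ₂] {ρ : G → X → ℝ≥0∞}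

/-- The fibered Haar measure integrates against `μ₁` like the density `∫ d(g⁻¹ μ₁)/dμ₂ dm(g)`
against `μ₂`, on invariant functions. -/
theorem lintegral_mul_fiberedHaar (σ : NonsingularAction G ν) (m : Measure G) [SFinite m]
    (h1 : μ₁ ≪ ν) (hρm : Measurable fun p : G × X => ρ p.1 p.2)
    (hρ : ∀ g, μ₁.map (σ.toFun g) = μ₂.withDensity (ρ g)) {f k : X → ℝ≥0∞} (hf : Measurable f)
    (hk : Measurable k) (hinv : ∀ g, ∀ᵐ ω ∂ν, k (σ.toFun g ω) = k ω) :
    ∫⁻ ω, k ω * σ.fiberedHaar m f ω ∂μ₁ = ∫⁻ ω, k ω * f ω * ∫⁻ g, ρ g⁻¹ ω ∂m ∂μ₂ := by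
  have hfm := σ.measurable_comp_inv hf
  have hρm' : Measurable fun p : G × X => ρ p.1⁻¹ p.2 :=
    hρm.comp ((measurable_inv.comp measurable_fst).prodMk measurable_snd)
  calc ∫⁻ ω, k ω * σ.fiberedHaar m f ω ∂μ₁
      = ∫⁻ ω, ∫⁻ g, k ω * f (σ.toFun g⁻¹ ω) ∂m ∂μ₁ := by
        refine lintegral_congr fun ω => ?_
        rw [lintegral_const_mul _ (σ.measurable_comp_inv_left hf ω)]
        rfl
    _ = ∫⁻ g, ∫⁻ ω, k ω * f (σ.toFun g⁻¹ ω) ∂μ₁ ∂m := by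
        refine lintegral_lintegral_swap (Measurable.aemeasurable ?_)
        exact (hk.comp measurable_fst).mul (hfm.comp measurable_swap)
    _ = ∫⁻ g, ∫⁻ ω, ρ g⁻¹ ω * (k ω * f ω) ∂μ₂ ∂m := by
        refine lintegral_congr fun g => ?_
        have hρg : Measurable (ρ g⁻¹) := hρm.comp measurable_prodMk_left
        calc ∫⁻ ω, k ω * f (σ.toFun g⁻¹ ω) ∂μ₁
            = ∫⁻ ω, k (σ.toFun g⁻¹ ω) * f (σ.toFun g⁻¹ ω) ∂μ₁ := by
              refine lintegral_congr_ae ?_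
              filter_upwards [h1.ae_le (hinv g⁻¹)] with ω hω
              rw [hω]
          _ = ∫⁻ ω, k ω * f ω ∂(μ₁.map (σ.toFun g⁻¹)) :=
              (lintegral_map (hk.mul hf) (σ.measurable_toFun _)).symm
          _ = ∫⁻ ω, ρ g⁻¹ ω * (k ω * f ω) ∂μ₂ := by
              rw [hρ]
              exact lintegral_withDensity_eq_lintegral_mul _ hρg (hk.mul hf)
    _ = ∫⁻ ω, ∫⁻ g, ρ g⁻¹ ω * (k ω * f ω) ∂m ∂μ₂ := by
        refine lintegral_lintegral_swap (Measurable.aemeasurable ?_)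
        exact hρm'.mul ((hk.mul hf).comp measurable_snd)
    _ = ∫⁻ ω, k ω * f ω * ∫⁻ g, ρ g⁻¹ ω ∂m ∂μ₂ := by
        refine lintegral_congr fun ω => ?_
        have hρω : Measurable fun g => ρ g⁻¹ ω := hρm'.comp measurable_prodMk_right
        rw [lintegral_mul_const _ hρω, mul_comm]

theorem lintegral_fiberedHaar (σ : NonsingularAction G ν) (m : Measure G) [SFinite m]
    (h1 : μ₁ ≪ ν) (hρm : Measurable fun p : G × X => ρ p.1 p.2)
    (hρ : ∀ g, μ₁.map (σ.toFun g) = μ₂.withDensity (ρ g)) {f : X → ℝ≥0∞} (hf : Measurable f) :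
    ∫⁻ ω, σ.fiberedHaar m f ω ∂μ₁ = ∫⁻ ω, f ω * ∫⁻ g, ρ g⁻¹ ω ∂m ∂μ₂ := by
  simpa using σ.lintegral_mul_fiberedHaar m h1 hρm hρ hf (k := fun _ => 1) measurable_const
    fun _ => ae_of_all _ fun _ => rfl

variable [LocallyCompactSpace G] [SecondCountableTopology G]

/-- The density is integrable against `f` where the fibered Haar measure of `f` is bounded. -/
theorem lintegral_indicator_le (σ : NonsingularAction G ν) (m : Measure G) [m.IsHaarMeasure]
    [IsProbabilityMeasure μ₁] [SFinite ν]
    (h1 : μ₁ ≪ ν) (hρm : Measurable fun p : G × X => ρ p.1 p.2)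
    (hρ : ∀ g, μ₁.map (σ.toFun g) = μ₂.withDensity (ρ g)) {f : X → ℝ≥0∞} (hf : Measurable f)
    (n : ℕ) : ∫⁻ ω, {ω | σ.fiberedHaar m f ω ≤ n}.indicator 1 ω * f ω * ∫⁻ g, ρ g⁻¹ ω ∂m ∂μ₂ ≤ n := by
  have hT := σ.measurable_fiberedHaar m hf
  have hA : MeasurableSet {ω | σ.fiberedHaar m f ω ≤ n} := measurableSet_le hT measurable_const
  -- `T(f)` is invariant up to null sets, so the indicator of `{T(f) ≤ n}` is admissible as `k`; the
  -- other side of the identity is then at most `n`.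
  rw [← σ.lintegral_mul_fiberedHaar m h1 hρm hρ hf (measurable_one.indicator hA) fun g => ?_]
  · calc ∫⁻ ω, {ω | σ.fiberedHaar m f ω ≤ n}.indicator 1 ω * σ.fiberedHaar m f ω ∂μ₁
        ≤ ∫⁻ _, (n : ℝ≥0∞) ∂μ₁ := by
          refine lintegral_mono fun ω => ?_
          by_cases hω : ω ∈ {ω | σ.fiberedHaar m f ω ≤ n}
          · rw [Set.indicator_of_mem hω, Pi.one_apply, one_mul]
            exact hω
          · rw [Set.indicator_of_notMem hω, zero_mul]
            exact zero_le
      _ = n := by simp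
  · filter_upwards [σ.fiberedHaar_invariant m hf g] with ω hω
    simp only [Set.indicator, Set.mem_ofPred_eq, hω, Pi.one_apply]

/-- If `T(F)` is finite, then `F R` is integrable on each `{T(F) ≤ k}`, so `R` is finite where `F >
0`; functions `F` approximating 1 exhaust the space. Conversely, truncating to `{R ≤ n}` makes `f R`
bounded and hence `T(f)` integrable. -/
theorem isDissipative_iff (σ : NonsingularAction G ν) (m : Measure G) [m.IsHaarMeasure]
    [IsProbabilityMeasure μ₁] [SFinite ν]
    (h1 : μ₁ ≪ ν) (h1' : ν ≪ μ₁) (h2' : ν ≪ μ₂) [IsProbabilityMeasure μ₂]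
    (hρm : Measurable fun p : G × X => ρ p.1 p.2)
    (hρ : ∀ g, μ₁.map (σ.toFun g) = μ₂.withDensity (ρ g)) :
    σ.IsDissipative m ↔ ∀ᵐ ω ∂ν, ∫⁻ g, ρ g⁻¹ ω ∂m < ∞ := by
  have hR := measurable_lintegral_inv m hρm
  set R : X → ℝ≥0∞ := fun ω => ∫⁻ g, ρ g⁻¹ ω ∂m with hRdef
  constructor
  · intro hd
    obtain ⟨F, hF, hlim⟩ := hd (fun _ => 1) measurable_const
    have hfin : ∀ n, ∀ᵐ ω ∂ν, F n ω * R ω < ∞ := by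
      intro n
      have hT := σ.measurable_fiberedHaar m (hF n).1
      have hk : ∀ k : ℕ, ∀ᵐ ω ∂ν,
          {ω | σ.fiberedHaar m (F n) ω ≤ k}.indicator 1 ω * F n ω * R ω < ∞ := by
        intro k
        have hA : MeasurableSet {ω | σ.fiberedHaar m (F n) ω ≤ k} :=
          measurableSet_le hT measurable_const
        refine h2'.ae_le (ae_lt_top ?_ ?_)
        · exact ((measurable_one.indicator hA).mul (hF n).1).mul hR
        · exact ne_top_of_le_ne_top (ENNReal.natCast_ne_top k)
            (σ.lintegral_indicator_le m h1 hρm hρ (hF n).1 k)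
      filter_upwards [ae_all_iff.2 hk, (hF n).2] with ω h3 h4
      obtain ⟨k, hk⟩ := ENNReal.exists_nat_gt h4.ne
      have h5 := h3 k
      rwa [Set.indicator_of_mem (show ω ∈ {ω | σ.fiberedHaar m (F n) ω ≤ k} from hk.le),
        Pi.one_apply, one_mul] at h5
    filter_upwards [ae_all_iff.2 hfin, hlim] with ω h3 h4
    obtain ⟨n, hn⟩ := (h4.eventually (lt_mem_nhds zero_lt_one)).exists
    by_contra htop
    have := h3 n
    rw [not_lt, top_le_iff] at htop
    change R ω = ∞ at htop
    rw [htop, ENNReal.mul_top hn.ne'] at this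
    exact lt_irrefl _ this
  · intro hfin f hf
    have hAm : ∀ n : ℕ, MeasurableSet {ω | R ω ≤ n} := fun n =>
      measurableSet_le hR measurable_const
    refine ⟨fun n => {ω | R ω ≤ n}.indicator fun ω => min (f ω) n, fun n => ?_, ?_⟩
    · have hFm : Measurable ({ω | R ω ≤ n}.indicator fun ω => min (f ω) (n : ℝ≥0∞)) :=
        (hf.min measurable_const).indicator (hAm n)
      refine ⟨hFm, h1'.ae_le (ae_lt_top (σ.measurable_fiberedHaar m hFm) ?_)⟩
      rw [σ.lintegral_fiberedHaar m h1 hρm hρ hFm]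
      refine ne_top_of_le_ne_top (b := ∫⁻ _, (n * n : ℝ≥0∞) ∂μ₂) ?_ (lintegral_mono fun ω => ?_)
      · simp only [lintegral_const, measure_univ, mul_one]
        exact ENNReal.mul_ne_top (ENNReal.natCast_ne_top n) (ENNReal.natCast_ne_top n)
      · by_cases hω : ω ∈ {ω | R ω ≤ n}
        · rw [Set.indicator_of_mem hω]
          exact mul_le_mul' (min_le_right _ _) hω
        · rw [Set.indicator_of_notMem hω, zero_mul]
          exact zero_le
    · filter_upwards [hfin] with ω hω
      obtain ⟨N, hN⟩ := ENNReal.exists_nat_gt hω.ne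
      have ht : Tendsto (fun n : ℕ => min (f ω) (n : ℝ≥0∞)) atTop (𝓝 (min (f ω) ∞)) :=
        tendsto_const_nhds.min ENNReal.tendsto_nat_nhds_top
      rw [min_top_right] at ht
      refine ht.congr' ?_
      filter_upwards [eventually_ge_atTop N] with n hn
      rw [Set.indicator_of_mem]
      exact hN.le.trans (by exact_mod_cast hn)

/-- The function `(1 + R)⁻¹` has integrable `T` and is positive exactly where `R < ∞`; since that
set is invariant, recurrence forces it to be null. Conversely, if `R = ∞`, then integrability of `f
R` on `{T(f) ≤ n}` with `f > 0` makes this set null. -/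
theorem isRecurrent_iff (σ : NonsingularAction G ν) (m : Measure G) [m.IsHaarMeasure]
    [IsProbabilityMeasure μ₁] [SFinite ν]
    (h1 : μ₁ ≪ ν) (h1' : ν ≪ μ₁) (h2' : ν ≪ μ₂) [IsProbabilityMeasure μ₂]
    (hρm : Measurable fun p : G × X => ρ p.1 p.2)
    (hρ : ∀ g, μ₁.map (σ.toFun g) = μ₂.withDensity (ρ g)) :
    σ.IsRecurrent m ↔ ∀ᵐ ω ∂ν, ∫⁻ g, ρ g⁻¹ ω ∂m = ∞ := by
  have hR := measurable_lintegral_inv m hρm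
  set R : X → ℝ≥0∞ := fun ω => ∫⁻ g, ρ g⁻¹ ω ∂m with hRdef
  constructor
  · intro hrec
    have hfm : Measurable fun ω => (1 + R ω)⁻¹ := (measurable_const.add hR).inv
    have hTfin : ∫⁻ ω, σ.fiberedHaar m (fun ω => (1 + R ω)⁻¹) ω ∂μ₁ ≠ ∞ := by
      rw [σ.lintegral_fiberedHaar m h1 hρm hρ hfm]
      refine ne_top_of_le_ne_top (b := ∫⁻ _, 1 ∂μ₂) (by simp) (lintegral_mono fun ω => ?_)
      change (1 + R ω)⁻¹ * R ω ≤ 1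
      rw [mul_comm, ← div_eq_mul_inv]
      exact ENNReal.div_le_of_le_mul (by rw [one_mul]; exact le_add_self)
    -- Replacing `(1 + R)⁻¹` by its composition with `h` multiplies `T` by a finite constant, so `(1
    -- + R ∘ h)⁻¹ R` is integrable too.
    have hback : ∀ h : G, ∀ᵐ ω ∂ν, R (σ.toFun h ω) < ∞ → R ω < ∞ := by
      intro h
      obtain ⟨c, hc, hcT⟩ := σ.fiberedHaar_comp_lt_top m hfm h
      have hfm' : Measurable fun ω => (1 + R (σ.toFun h ω))⁻¹ := hfm.comp (σ.measurable_toFun h)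
      have hi : ∫⁻ ω, (1 + R (σ.toFun h ω))⁻¹ * R ω ∂μ₂ ≠ ∞ := by
        have h3 := σ.lintegral_fiberedHaar m h1 hρm hρ hfm'
        rw [← h3, lintegral_congr_ae (h1.ae_le hcT),
          lintegral_const_mul _ (σ.measurable_fiberedHaar m hfm)]
        exact ENNReal.mul_ne_top hc hTfin
      filter_upwards [h2'.ae_le (ae_lt_top (hfm'.mul hR) hi)] with ω h4 h5
      by_contra htop
      rw [not_lt, top_le_iff] at htop
      rw [Pi.mul_apply, htop, ENNReal.mul_top] at h4
      · exact lt_irrefl _ h4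
      · exact ENNReal.inv_ne_zero.2 (ENNReal.add_ne_top.2 ⟨ENNReal.one_ne_top, h5.ne⟩)
    let S : Set X := {ω | R ω = ∞}
    have hS : MeasurableSet S := hR (measurableSet_singleton ∞)
    have hSm : Measurable (S.indicator (1 : X → ℝ≥0∞)) := measurable_one.indicator hS
    -- By `hback` at the point `g⁻¹ ω`, finiteness of `R` passes from `ω` to `g⁻¹ ω`: almost no
    -- orbit leads from `Sᶜ` into `S`.
    have hzero : ∀ᵐ ω ∂ν, Sᶜ.indicator 1 ω * σ.fiberedHaar m (S.indicator 1) ω = 0 := by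
      have hFm : Measurable fun p : G × X =>
          Sᶜ.indicator (1 : X → ℝ≥0∞) p.2 * S.indicator (1 : X → ℝ≥0∞) (σ.toFun p.1⁻¹ p.2) :=
        ((measurable_one.indicator hS.compl).comp measurable_snd).mul (σ.measurable_comp_inv hSm)
      have h3 := ae_lintegral_eq_of_forall_ae_eq (m := m) (ν := ν) hFm
        (F' := fun _ => 0) measurable_const (fun g => by
          filter_upwards [(σ.nonsingular g⁻¹).ae (hback g), σ.mul_ae g g⁻¹, σ.one_ae]
            with ω h4 h5 h6
          rw [mul_inv_cancel, h6] at h5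
          rw [← h5] at h4
          by_cases hω : ω ∈ S
          · simp [hω]
          · have : σ.toFun g⁻¹ ω ∉ S := (h4 (lt_top_iff_ne_top.2 hω)).ne
            simp [this])
      filter_upwards [h3] with ω hω
      rw [lintegral_const_mul _ (σ.measurable_comp_inv_left hSm ω),
        lintegral_zero] at hω
      exact hω
    -- The indicator restores strict positivity on `S` without changing `T` off `S`.
    have hrec' := hrec (fun ω => (1 + R ω)⁻¹ + S.indicator 1 ω) (hfm.add hSm)
      (ae_of_all _ fun ω => by
        by_cases hω : ω ∈ S
        · simp [hω]
        · have : R ω ≠ ∞ := hω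
          simp [hω, this])
    filter_upwards [hrec', hzero, h1'.ae_le (ae_lt_top (σ.measurable_fiberedHaar m hfm) hTfin)]
      with ω h3 h4 h5
    by_contra hω
    have hmem : ω ∈ Sᶜ := hω
    rw [Set.indicator_of_mem hmem, Pi.one_apply, one_mul] at h4
    have hsplit : σ.fiberedHaar m (fun ω => (1 + R ω)⁻¹ + S.indicator 1 ω) ω =
        σ.fiberedHaar m (fun ω => (1 + R ω)⁻¹) ω + σ.fiberedHaar m (S.indicator 1) ω :=
      lintegral_add_left (σ.measurable_comp_inv_left hfm ω) _
    rw [hsplit, h4, add_zero] at h3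
    exact h5.ne h3
  · intro htop f hf hpos
    have hk : ∀ n : ℕ, ∀ᵐ ω ∂ν, ¬ σ.fiberedHaar m f ω ≤ n := by
      intro n
      have hT := σ.measurable_fiberedHaar m hf
      have hA : MeasurableSet {ω | σ.fiberedHaar m f ω ≤ n} := measurableSet_le hT measurable_const
      have h3 := ae_lt_top (((measurable_one.indicator hA).mul hf).mul hR)
        (ne_top_of_le_ne_top (ENNReal.natCast_ne_top n) (σ.lintegral_indicator_le m h1 hρm hρ hf n))
      filter_upwards [h2'.ae_le h3, htop, hpos] with ω h4 h5 h6 h7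
      simp only [Pi.mul_apply] at h4
      change R ω = ∞ at h5
      rw [h5, Set.indicator_of_mem (show ω ∈ {ω | σ.fiberedHaar m f ω ≤ n} from h7), Pi.one_apply,
        one_mul, ENNReal.mul_top h6.ne'] at h4
      exact lt_irrefl _ h4
    filter_upwards [ae_all_iff.2 hk] with ω hω
    by_contra hne
    obtain ⟨n, hn⟩ := ENNReal.exists_nat_gt hne
    exact hω n hn.le

end Criterion

end NonsingularAction

end FiberedHaar

/-! ### Independence of the Poincaré exponent of all choices. -/

section Poincare

variable {G V P : Type*} [Group G] [TopologicalSpace G]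
  [NormedAddCommGroup V] [InnerProductSpace ℝ V] [MetricSpace P] [NormedAddTorsor V P]

/-- Moving the base points changes the distance by a bounded amount `K`. The cross term `2 s K d'`
is absorbed into `(s' - s) d'²` by completing the square. -/
theorem mul_sq_le_of_lt {s s' d d' K : ℝ} (hs : 0 < s) (hss : s < s') (hd : 0 ≤ d)
    (hdd : d ≤ d' + K) : -s' * d' ^ 2 ≤ -s * d ^ 2 + (s * K ^ 2 + s ^ 2 * K ^ 2 / (s' - s)) := by
  have h0 : 0 < s' - s := sub_pos.2 hss
  have h1 : d ^ 2 ≤ (d' + K) ^ 2 := pow_le_pow_left₀ hd hdd 2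
  have h2 : 0 ≤ ((s' - s) * d' - s * K) ^ 2 / (s' - s) := by positivity
  have h3 : ((s' - s) * d' - s * K) ^ 2 / (s' - s) =
      (s' - s) * d' ^ 2 - 2 * s * d' * K + s ^ 2 * K ^ 2 / (s' - s) := by
    field_simp
    ring
  nlinarith [mul_le_mul_of_nonneg_left h1 hs.le]

namespace AffineIsometricAction

theorem norm_inv_vsub (α : AffineIsometricAction G V P) (g : G) (x y : P) :
    ‖α.toHom g⁻¹ x -ᵥ y‖ = ‖α.toHom g y -ᵥ x‖ := by
  rw [← dist_eq_norm_vsub V, ← dist_eq_norm_vsub V, ← (α.toHom g).dist_map, map_inv]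
  rw [dist_comm]
  congr 1
  exact (α.toHom g).apply_symm_apply x

theorem norm_vsub_le (α : AffineIsometricAction G V P) (g : G) (x y x' y' : P) :
    ‖α.toHom g x -ᵥ y‖ ≤ ‖α.toHom g x' -ᵥ y'‖ + (dist x x' + dist y y') := by
  rw [← dist_eq_norm_vsub V, ← dist_eq_norm_vsub V]
  have h1 := dist_triangle4 (α.toHom g x) (α.toHom g x') y' y
  rw [(α.toHom g).dist_map, dist_comm y' y] at h1
  linarith

variable [MeasurableSpace G]

theorem lintegral_eexp_lt_top_of_lt (α : AffineIsometricAction G V P) {m : Measure G} {s s' : ℝ}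
    (hs : 0 < s) (hss : s < s') {x y : P}
    (h : ∫⁻ g, eexp (-s * ‖α.toHom g x -ᵥ y‖ ^ 2) ∂m < ∞) (x' y' : P) :
    ∫⁻ g, eexp (-s' * ‖α.toHom g x' -ᵥ y'‖ ^ 2) ∂m < ∞ := by
  set K := dist x x' + dist y y'
  set C := s * K ^ 2 + s ^ 2 * K ^ 2 / (s' - s)
  calc ∫⁻ g, eexp (-s' * ‖α.toHom g x' -ᵥ y'‖ ^ 2) ∂m
      ≤ ∫⁻ g, eexp C * eexp (-s * ‖α.toHom g x -ᵥ y‖ ^ 2) ∂m := by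
        refine lintegral_mono fun g => ?_
        rw [← eexp_add, add_comm]
        exact eexp_le_eexp (mul_sq_le_of_lt hs hss (norm_nonneg _) (α.norm_vsub_le g x y x' y'))
    _ = eexp C * ∫⁻ g, eexp (-s * ‖α.toHom g x -ᵥ y‖ ^ 2) ∂m :=
        lintegral_const_mul' _ _ (eexp_ne_top _)
    _ < ∞ := ENNReal.mul_lt_top (eexp_lt_top _) h

variable [IsTopologicalGroup G] [BorelSpace G]

theorem lintegral_eexp_inv (α : AffineIsometricAction G V P) (m : Measure G) (s : ℝ) (x y : P) :
    ∫⁻ g, eexp (-s * ‖α.toHom g x -ᵥ y‖ ^ 2) ∂m.inv =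
      ∫⁻ g, eexp (-s * ‖α.toHom g y -ᵥ x‖ ^ 2) ∂m := by
  have h : Measurable fun g => eexp (-s * ‖α.toHom g x -ᵥ y‖ ^ 2) := by
    have h1 : Continuous fun g => α.toHom g x -ᵥ y :=
      (α.continuous_orbit x).vsub continuous_const
    exact measurable_eexp.comp (by fun_prop : Continuous _).measurable
  rw [Measure.inv, lintegral_map h measurable_inv]
  simp_rw [α.norm_inv_vsub]

end AffineIsometricAction

variable [MeasurableSpace G]

theorem poincareExponent_le (α : AffineIsometricAction G V P) {m : Measure G} {x y : P} {s : ℝ}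
    (hs : 0 < s) (h : ∫⁻ g, eexp (-s * ‖α.toHom g x -ᵥ y‖ ^ 2) ∂m < ∞) :
    poincareExponent α m x y ≤ ENNReal.ofReal s :=
  sInf_le ⟨s, hs, rfl, h⟩

variable [IsTopologicalGroup G] [BorelSpace G]

theorem IsRightHaarMeasure.isHaarMeasure_inv {r : Measure G} (hr : IsRightHaarMeasure r) :
    r.inv.IsHaarMeasure := by
  have := hr.finiteOnCompacts
  have := hr.rightInvariant
  have := hr.openPos
  exact { }

variable [LocallyCompactSpace G] [SecondCountableTopology G]

theorem IsRightHaarMeasure.exists_eq_smul_inv {r : Measure G} (hr : IsRightHaarMeasure r)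
    (m : Measure G) [m.IsHaarMeasure] : ∃ c : ℝ≥0∞, c ≠ 0 ∧ c ≠ ∞ ∧ r = c • m.inv := by
  have := hr.isHaarMeasure_inv
  obtain ⟨c, h0, h1, h⟩ := exists_eq_smul_of_isHaarMeasure r.inv m
  refine ⟨c, h0, h1, ?_⟩
  rw [← r.inv_inv, h, Measure.inv, Measure.map_smul]
  rfl

/-- Left Haar measures are proportional to `m₀` and keep the points; right ones are proportional to
its inverse, and inversion exchanges `x` and `y`. The exchange is harmless once the exponent may be
raised slightly. -/
theorem AffineIsometricAction.lintegral_eexp_lt_top_iff (α : AffineIsometricAction G V P)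
    (m₀ : Measure G) [m₀.IsHaarMeasure] {m : Measure G}
    (hm : m.IsHaarMeasure ∨ IsRightHaarMeasure m) (s : ℝ) (x y : P) :
    (∫⁻ g, eexp (-s * ‖α.toHom g x -ᵥ y‖ ^ 2) ∂m < ∞ ↔
      ∫⁻ g, eexp (-s * ‖α.toHom g x -ᵥ y‖ ^ 2) ∂m₀ < ∞) ∨
    (∫⁻ g, eexp (-s * ‖α.toHom g x -ᵥ y‖ ^ 2) ∂m < ∞ ↔
      ∫⁻ g, eexp (-s * ‖α.toHom g y -ᵥ x‖ ^ 2) ∂m₀ < ∞) := by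
  have key : ∀ c a : ℝ≥0∞, c ≠ 0 → c ≠ ∞ → (c * a < ∞ ↔ a < ∞) := fun c a h0 h1 =>
    ⟨fun h => ENNReal.lt_top_of_mul_ne_top_right h.ne h0, fun h => ENNReal.mul_lt_top h1.lt_top h⟩
  rcases hm with hm | hm
  · obtain ⟨c, h0, h1, rfl⟩ := exists_eq_smul_of_isHaarMeasure m m₀
    left
    rw [lintegral_smul_measure, smul_eq_mul, key _ _ h0 h1]
  · obtain ⟨c, h0, h1, rfl⟩ := hm.exists_eq_smul_inv m₀
    right
    rw [lintegral_smul_measure, smul_eq_mul, key _ _ h0 h1, α.lintegral_eexp_inv]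

theorem AffineIsometricAction.lintegral_eexp_lt_top_of_haar (α : AffineIsometricAction G V P)
    {m m' : Measure G} (hm : m.IsHaarMeasure ∨ IsRightHaarMeasure m)
    (hm' : m'.IsHaarMeasure ∨ IsRightHaarMeasure m') {s s' : ℝ} (hs : 0 < s) (hss : s < s')
    {x y : P} (h : ∫⁻ g, eexp (-s * ‖α.toHom g x -ᵥ y‖ ^ 2) ∂m < ∞) (x' y' : P) :
    ∫⁻ g, eexp (-s' * ‖α.toHom g x' -ᵥ y'‖ ^ 2) ∂m' < ∞ := by
  have h1 : ∃ x y : P, ∫⁻ g, eexp (-s * ‖α.toHom g x -ᵥ y‖ ^ 2) ∂(Measure.haar : Measure G) < ∞ := by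
    rcases α.lintegral_eexp_lt_top_iff Measure.haar hm s x y with h2 | h2
    · exact ⟨x, y, h2.1 h⟩
    · exact ⟨y, x, h2.1 h⟩
  obtain ⟨x₀, y₀, h1⟩ := h1
  rcases α.lintegral_eexp_lt_top_iff Measure.haar hm' s' x' y' with h2 | h2
  · exact h2.2 (α.lintegral_eexp_lt_top_of_lt hs hss h1 x' y')
  · exact h2.2 (α.lintegral_eexp_lt_top_of_lt hs hss h1 y' x')

theorem lintegral_eexp_lt_top_of_poincareExponent_lt (α : AffineIsometricAction G V P)
    {m m' : Measure G} (hm : m.IsHaarMeasure ∨ IsRightHaarMeasure m)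
    (hm' : m'.IsHaarMeasure ∨ IsRightHaarMeasure m') {x y : P} {s : ℝ}
    (h : poincareExponent α m x y < ENNReal.ofReal s) (x' y' : P) :
    ∫⁻ g, eexp (-s * ‖α.toHom g x' -ᵥ y'‖ ^ 2) ∂m' < ∞ := by
  obtain ⟨_, ⟨s₀, hs₀, rfl, hfin⟩, hlt⟩ := sInf_lt_iff.1 h
  exact α.lintegral_eexp_lt_top_of_haar hm hm' hs₀ ((ENNReal.ofReal_lt_ofReal_iff').1 hlt).1
    hfin x' y'

theorem poincareExponent_eq (α : AffineIsometricAction G V P)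
    {m m' : Measure G} (hm : m.IsHaarMeasure ∨ IsRightHaarMeasure m)
    (hm' : m'.IsHaarMeasure ∨ IsRightHaarMeasure m') (x y x' y' : P) :
    poincareExponent α m x y = poincareExponent α m' x' y' := by
  have key : ∀ {m m' : Measure G}, m.IsHaarMeasure ∨ IsRightHaarMeasure m →
      m'.IsHaarMeasure ∨ IsRightHaarMeasure m' → ∀ x y x' y' : P,
      poincareExponent α m' x' y' ≤ poincareExponent α m x y := by
    intro m m' hm hm' x y x' y'
    refine le_of_forall_gt fun r hr => ?_
    obtain ⟨q, hq1, hq2⟩ := ENNReal.lt_iff_exists_nnreal_btwn.1 hr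
    have hq : (q : ℝ≥0∞) = ENNReal.ofReal q := (ENNReal.ofReal_coe_nnreal).symm
    rw [hq] at hq1
    have hpos : (0 : ℝ) < q := by
      have := (zero_le.trans_lt hq1 : (0 : ℝ≥0∞) < _)
      exact ENNReal.ofReal_pos.1 this
    refine lt_of_le_of_lt ?_ hq2
    rw [hq]
    exact poincareExponent_le α hpos
      (lintegral_eexp_lt_top_of_poincareExponent_lt α hm hm' hq1 x' y')
  exact le_antisymm (key hm' hm x' y' x y) (key hm hm' x y x' y')

end Poincare

/-! ### The Gaussian integral as a function of the white noise. -/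

/-- The weight `exp (-(1/2) t² ‖v‖² + t u)`. -/
noncomputable def gaussWeight {V : Type*} [Norm V] (t : ℝ) (v : V) (u : ℝ) : ℝ≥0∞ :=
  eexp (-(1 / 2) * t ^ 2 * ‖v‖ ^ 2 + t * u)

theorem Measurable.gaussWeight {Ω V : Type*} [MeasurableSpace Ω] [NormedAddCommGroup V]
    [MeasurableSpace V] [OpensMeasurableSpace V] {ξ : Ω → V} {f : Ω → ℝ} (hξ : Measurable ξ)
    (hf : Measurable f) (t : ℝ) : Measurable fun ω => gaussWeight t (ξ ω) (f ω) := by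
  have := hξ.norm
  unfold _root_.gaussWeight
  fun_prop

section NoiseIntegral

variable {G V ι : Type*} [MeasurableSpace G] [NormedAddCommGroup V] [InnerProductSpace ℝ V]
  [MeasurableSpace V] {b : HilbertBasis ι ℝ V}

namespace WhiteNoise

/-- The integral `∫ exp (-(1/2) t² ‖ξ(g)‖² + t ⟨ω, ξ(g)⟩) dr(g)`. -/
noncomputable def noiseIntegral (L : WhiteNoise b) (ξ : G → V) (r : Measure G) (t : ℝ)
    (ω : ι → ℝ) : ℝ≥0∞ :=
  ∫⁻ g, gaussWeight t (ξ g) (L.toFun ω (ξ g)) ∂r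

theorem measurable_pairing (L : WhiteNoise b) {ξ : G → V} (hξ : Measurable ξ) :
    Measurable fun p : G × (ι → ℝ) => L.toFun p.2 (ξ p.1) :=
  L.measurable.comp (measurable_snd.prodMk (hξ.comp measurable_fst))

theorem noiseIntegral_smul_measure (L : WhiteNoise b) (ξ : G → V) (r : Measure G) (c : ℝ≥0∞)
    (t : ℝ) (ω : ι → ℝ) : L.noiseIntegral ξ (c • r) t ω = c * L.noiseIntegral ξ r t ω :=
  lintegral_smul_measure _ _

variable [BorelSpace V] {ξ : G → V}

theorem measurable_integrand_comp (L : WhiteNoise b) (hξ : Measurable ξ) (t : ℝ) {Ω : Type*}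
    [MeasurableSpace Ω] {φ : Ω → ι → ℝ} (hφ : Measurable φ) :
    Measurable fun p : G × Ω => gaussWeight t (ξ p.1) (L.toFun (φ p.2) (ξ p.1)) :=
  (hξ.comp measurable_fst).gaussWeight
    (L.measurable.comp ((hφ.comp measurable_snd).prodMk (hξ.comp measurable_fst))) t

theorem measurable_integrand (L : WhiteNoise b) (hξ : Measurable ξ) (t : ℝ) :
    Measurable fun p : G × (ι → ℝ) => gaussWeight t (ξ p.1) (L.toFun p.2 (ξ p.1)) :=
  L.measurable_integrand_comp hξ t measurable_id

theorem measurable_integrand_right (L : WhiteNoise b) (hξ : Measurable ξ) (t : ℝ) (ω : ι → ℝ) :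
    Measurable fun g => gaussWeight t (ξ g) (L.toFun ω (ξ g)) :=
  hξ.gaussWeight (L.measurable.comp (measurable_const.prodMk hξ)) t

theorem measurable_noiseIntegral (L : WhiteNoise b) (hξ : Measurable ξ)
    (r : Measure G) [SFinite r] (t : ℝ) :
    Measurable (L.noiseIntegral ξ r t) :=
  (L.measurable_integrand hξ t).lintegral_prod_left'

theorem ae_noiseIntegral_smul (L : WhiteNoise b) (hξ : Measurable ξ)
    (r : Measure G) [SFinite r] (t : ℝ) :
    ∀ᵐ ω ∂stdGaussianPi ι, L.noiseIntegral (fun g => t • ξ g) r 1 ω = L.noiseIntegral ξ r t ω := by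
  refine ae_lintegral_eq_of_forall_ae_eq (L.measurable_integrand (hξ.const_smul t) 1)
    (L.measurable_integrand hξ t) fun g => ?_
  filter_upwards [L.isonormal.smul t (ξ g)] with ω hω
  rw [Pi.smul_apply, hω, gaussWeight, gaussWeight, norm_smul, Real.norm_eq_abs, mul_pow, sq_abs]
  congr 1
  ring

/-- Averaging over an independent noise lowers the parameter. -/
theorem ae_lintegral_noiseIntegral_rotation (L : WhiteNoise b) (hξ : Measurable ξ)
    (r : Measure G) [SFinite r] (t : ℝ)
    {a c : ℝ} (hac : a ^ 2 + c ^ 2 = 1) :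
    ∀ᵐ ω ∂stdGaussianPi ι, ∫⁻ ω', L.noiseIntegral ξ r t (fun i => a * ω i + c * ω' i)
      ∂stdGaussianPi ι = L.noiseIntegral ξ r (t * a) ω := by
  have hrot : Measurable fun q : (ι → ℝ) × (ι → ℝ) => fun i => a * q.1 i + c * q.2 i := by fun_prop
  have h1m : Measurable fun p : G × ((ι → ℝ) × (ι → ℝ)) => L.toFun p.2.1 (ξ p.1) :=
    (L.measurable_pairing hξ).comp (measurable_fst.prodMk (measurable_fst.comp measurable_snd))
  have h2m : Measurable fun p : G × ((ι → ℝ) × (ι → ℝ)) => L.toFun p.2.2 (ξ p.1) :=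
    (L.measurable_pairing hξ).comp (measurable_fst.prodMk (measurable_snd.comp measurable_snd))
  have hFm : Measurable fun p : G × ((ι → ℝ) × (ι → ℝ)) =>
      gaussWeight t (ξ p.1) (a * L.toFun p.2.1 (ξ p.1) + c * L.toFun p.2.2 (ξ p.1)) :=
    (hξ.comp measurable_fst).gaussWeight (by fun_prop) t
  have h1 : ∀ᵐ p ∂(stdGaussianPi ι).prod (stdGaussianPi ι),
      L.noiseIntegral ξ r t (fun i => a * p.1 i + c * p.2 i) =
        ∫⁻ g, gaussWeight t (ξ g) (a * L.toFun p.1 (ξ g) + c * L.toFun p.2 (ξ g)) ∂r := by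
    refine ae_lintegral_eq_of_forall_ae_eq (L.measurable_integrand_comp hξ t hrot) hFm fun g => ?_
    filter_upwards [L.rotation_ae hac (ξ g)] with p hp
    simp only [hp]
  filter_upwards [Measure.ae_ae_of_ae_prod h1] with ω hω
  have hFω : Measurable fun p : (ι → ℝ) × G =>
      gaussWeight t (ξ p.2) (a * L.toFun ω (ξ p.2) + c * L.toFun p.1 (ξ p.2)) := by
    have hξ2 : Measurable fun p : (ι → ℝ) × G => ξ p.2 := hξ.comp measurable_snd
    have h3 : Measurable fun p : (ι → ℝ) × G => L.toFun ω (ξ p.2) :=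
      L.measurable.comp (measurable_const.prodMk hξ2)
    have h4 : Measurable fun p : (ι → ℝ) × G => L.toFun p.1 (ξ p.2) :=
      L.measurable.comp (measurable_fst.prodMk hξ2)
    exact hξ2.gaussWeight (by fun_prop) t
  rw [lintegral_congr_ae hω, lintegral_lintegral_swap hFω.aemeasurable]
  refine lintegral_congr fun g => ?_
  have hm := L.measurable_apply (ξ g)
  have h2 : ∀ ω', gaussWeight t (ξ g) (a * L.toFun ω (ξ g) + c * L.toFun ω' (ξ g)) =
      eexp (-(1 / 2) * t ^ 2 * ‖ξ g‖ ^ 2 + t * a * L.toFun ω (ξ g)) *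
        eexp (t * c * L.toFun ω' (ξ g)) := by
    intro ω'
    rw [← eexp_add, gaussWeight]
    congr 1
    ring
  simp_rw [h2]
  rw [lintegral_const_mul _ (by fun_prop), L.isonormal.lintegral_eexp_smul, ← eexp_add,
    norm_smul, Real.norm_eq_abs, mul_pow |t * c|, sq_abs, gaussWeight]
  congr 1
  -- The mean over `ω'` contributes `t² c² ‖ξ‖² / 2`, which leaves `-(1/2) (t a)² ‖ξ‖²` of the
  -- quadratic term.
  have : c ^ 2 = 1 - a ^ 2 := by linarith
  rw [mul_pow t c, this]
  ring

/-- Below a parameter at which the integral is infinite with positive probability it is infinite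
almost surely. -/
theorem ae_noiseIntegral_eq_top (L : WhiteNoise b) (hξ : Measurable ξ)
    (r : Measure G) [SFinite r] {s t : ℝ}
    (hs : 0 < s) (hst : s < t) (h : ¬ ∀ᵐ ω ∂stdGaussianPi ι, L.noiseIntegral ξ r t ω < ∞) :
    ∀ᵐ ω ∂stdGaussianPi ι, L.noiseIntegral ξ r s ω = ∞ := by
  have ht : 0 < t := hs.trans hst
  have hm := L.measurable_noiseIntegral hξ r t
  -- The angle is chosen so that averaging lowers the parameter `t` exactly to `s`.
  set a := s / t with ha
  have ha1 : a < 1 := (div_lt_one ht).2 hst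
  have ha0 : 0 < a := by positivity
  have hpos : 0 < 1 - a ^ 2 := by nlinarith
  set c := √(1 - a ^ 2) with hc
  have hc0 : c ≠ 0 := (Real.sqrt_pos.2 hpos).ne'
  have hac : a ^ 2 + c ^ 2 = 1 := by
    rw [hc, Real.sq_sqrt hpos.le]
    ring
  have hta : t * a = s := by
    rw [ha]
    field_simp
  have hC : MeasurableSet {ω | L.noiseIntegral ξ r t ω = ∞} := hm (measurableSet_singleton ∞)
  have hCpos : stdGaussianPi ι {ω | L.noiseIntegral ξ r t ω = ∞} ≠ 0 := by
    intro h0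
    refine h ?_
    filter_upwards [measure_eq_zero_iff_ae_notMem.1 h0] with ω hω
    exact lt_top_iff_ne_top.2 hω
  filter_upwards [L.ae_pos_measure_rotation hac hc0 hC hCpos,
    L.ae_lintegral_noiseIntegral_rotation hξ r t hac] with ω h1 h2
  rw [hta] at h2
  rw [← h2]
  -- A finite average would make the integral at `aω + cω'` finite for almost every `ω'`, whereas it
  -- is infinite on a set of positive measure by `h1`.
  by_contra hne
  refine h1 ?_
  have hrot : Measurable fun ω' : ι → ℝ => fun i => a * ω i + c * ω' i := by fun_prop
  have h3 := ae_lt_top (hm.comp hrot) hne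
  rw [measure_eq_zero_iff_ae_notMem]
  filter_upwards [h3] with ω' hω'
  exact hω'.ne

/-- The noise is symmetric, so some `ω` has finite integrals at both `ω` and `-ω`. One of the two
linear terms is nonnegative for each `g`, so the sum of the weights dominates the pure Gaussian
factor. -/
theorem lintegral_eexp_lt_top_of_ae_noiseIntegral (L : WhiteNoise b) (hξ : Measurable ξ)
    (r : Measure G) [SFinite r]
    {t : ℝ} (h : ∀ᵐ ω ∂stdGaussianPi ι, L.noiseIntegral ξ r t ω < ∞) :
    ∫⁻ g, eexp (-(t ^ 2 / 2) * ‖ξ g‖ ^ 2) ∂r < ∞ := by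
  have hneg : Measurable fun ω : ι → ℝ => fun i => -ω i := by fun_prop
  have hm1 := L.measurable_pairing hξ
  have h1 : ∀ᵐ ω ∂stdGaussianPi ι, L.noiseIntegral ξ r t (fun i => -ω i) =
      ∫⁻ g, gaussWeight t (ξ g) (-L.toFun ω (ξ g)) ∂r := by
    refine ae_lintegral_eq_of_forall_ae_eq
      (L.measurable_integrand_comp hξ t hneg)
      ((hξ.comp measurable_fst).gaussWeight hm1.neg t) fun g => ?_
    filter_upwards [L.neg_ae (ξ g)] with ω hω
    simp only [Function.comp_apply, hω, Pi.neg_apply]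
  have h2 := L.measurePreserving_neg.quasiMeasurePreserving.ae h
  obtain ⟨ω, hω, hω', hω''⟩ := (h.and (h2.and h1)).exists
  rw [hω''] at hω'
  refine lt_of_le_of_lt ?_ (ENNReal.add_lt_top.2 ⟨hω, hω'⟩)
  rw [noiseIntegral, ← lintegral_add_left (L.measurable_integrand_right hξ t ω)]
  refine lintegral_mono fun g => ?_
  simp only [gaussWeight]
  rcases le_total 0 (t * L.toFun ω (ξ g)) with h5 | h5
  · exact (eexp_le_eexp (by linarith)).trans le_self_add
  · exact (eexp_le_eexp (by linarith)).trans le_add_self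

end WhiteNoise

end NoiseIntegral

/-! ### The integral criterion for Gaussian actions. -/

section Transfer

variable {G V P X ι : Type*} [Group G] [TopologicalSpace G] [MeasurableSpace G] [BorelSpace G]
  [NormedAddCommGroup V] [InnerProductSpace ℝ V]
  [MeasurableSpace V] [BorelSpace V] [MetricSpace P] [NormedAddTorsor V P] [MeasurableSpace X]
  {b : HilbertBasis ι ℝ V}

theorem AffineIsometricAction.measurable_vsub (α : AffineIsometricAction G V P) (x y : P) :
    Measurable fun g => α.toHom g x -ᵥ y := by
  have : Continuous fun g => α.toHom g x -ᵥ y := (α.continuous_orbit x).vsub continuous_const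
  exact this.measurable

theorem ae_gaussianIntegral_eq (L : WhiteNoise b) {E : GaussianDensity V V X}
    (α : AffineIsometricAction G V P) (K : GaussianPairing E) (r : Measure G) [SFinite r] (t : ℝ)
    (x y : P) : ∀ᵐ φ ∂(E.μ 0), gaussianIntegral α K r t x y φ =
      L.noiseIntegral (fun g => α.toHom g x -ᵥ y) r t (E.coord b 0 φ) := by
  have := E.isProbabilityMeasure 0
  have hξ := α.measurable_vsub x y
  have hm1 : Measurable fun p : G × X => K.toFun p.2 (α.toHom p.1 x -ᵥ y) :=
    K.measurable.comp (measurable_snd.prodMk (hξ.comp measurable_fst))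
  refine ae_lintegral_eq_of_forall_ae_eq (ν := E.μ 0)
    (F := fun p => gaussWeight t (α.toHom p.1 x -ᵥ y) (K.toFun p.2 (α.toHom p.1 x -ᵥ y)))
    ((hξ.comp measurable_fst).gaussWeight hm1 t)
    (L.measurable_integrand_comp hξ t (E.measurePreserving_coord b 0).measurable) fun g => ?_
  filter_upwards [(E.ae_refMeasure_iff 0).1 (K.eq_hat (α.toHom g x -ᵥ y)),
    E.whiteNoise_coord_ae L 0 (α.toHom g x -ᵥ y)] with φ h1 h2
  rw [h1, h2, innerAffine_zero]

/-- A general set `S` serves both finiteness and infiniteness. -/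
theorem ae_gaussianIntegral_iff (L : WhiteNoise b) {E : GaussianDensity V V X}
    (α : AffineIsometricAction G V P) (K : GaussianPairing E) (r : Measure G) [SFinite r] (t : ℝ)
    (x y : P) {S : Set ℝ≥0∞} (hS : MeasurableSet S) :
    (∀ᵐ φ ∂E.refMeasure, gaussianIntegral α K r t x y φ ∈ S) ↔
      ∀ᵐ ω ∂stdGaussianPi ι, L.noiseIntegral (fun g => α.toHom g x -ᵥ y) r t ω ∈ S := by
  have hmp := E.measurePreserving_coord b 0
  have hm := L.measurable_noiseIntegral (α.measurable_vsub x y) r t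
  rw [E.ae_refMeasure_iff 0, ← hmp.map_eq, ae_map_iff hmp.measurable.aemeasurable (hm hS)]
  exact eventually_congr ((ae_gaussianIntegral_eq L α K r t x y).mono fun φ hφ => by rw [hφ])

variable [IsTopologicalGroup G] [LocallyCompactSpace G] [SecondCountableTopology G]
  [CompleteSpace V]

/-- The density `ρ g` of `μ (g x)` with respect to `μ y` is the Gaussian weight at `g x - y`. The
criteria integrate `ρ g⁻¹` over a left Haar measure, that is, `ρ` over its inverse. -/
theorem GaussianAction.criterion (L : WhiteNoise b) {α : AffineIsometricAction G V P}
    {D : GaussianDensity V P X} (σ : GaussianAction α D) (m : Measure G) [m.IsHaarMeasure]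
    {r : Measure G} (hr : IsRightHaarMeasure r) (x y : P) :
    (σ.IsDissipative m ↔
      ∀ᵐ ω ∂stdGaussianPi ι, L.noiseIntegral (fun g => α.toHom g x -ᵥ y) r 1 ω < ∞) ∧
    (σ.IsRecurrent m ↔
      ∀ᵐ ω ∂stdGaussianPi ι, L.noiseIntegral (fun g => α.toHom g x -ᵥ y) r 1 ω = ∞) := by
  have := D.isProbabilityMeasure x
  have := D.isProbabilityMeasure y
  have : IsProbabilityMeasure D.refMeasure := D.isProbabilityMeasure _
  have hξ := α.measurable_vsub x y
  have hmp := D.measurePreserving_coord b y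
  have hm := L.measurable_noiseIntegral hξ m.inv 1
  obtain ⟨c, hc0, hc1, rfl⟩ := hr.exists_eq_smul_inv m
  let ρ : G → X → ℝ≥0∞ := fun g ω =>
    gaussWeight 1 (α.toHom g x -ᵥ y) (L.toFun (D.coord b y ω) (α.toHom g x -ᵥ y))
  have hρm : Measurable fun p : G × X => ρ p.1 p.2 :=
    L.measurable_integrand_comp hξ 1 hmp.measurable
  have hρ : ∀ g, (D.μ x).map (σ.toFun g) = (D.μ y).withDensity (ρ g) := by
    intro g
    rw [σ.map_eq, D.eq_withDensity L y]
    congr 1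
    funext ω
    simp only [ρ, gaussWeight]
    congr 1
    ring
  have hint : ∀ ω, ∫⁻ g, ρ g⁻¹ ω ∂m =
      L.noiseIntegral (fun g => α.toHom g x -ᵥ y) m.inv 1 (D.coord b y ω) := by
    intro ω
    exact (lintegral_map (L.measurable_integrand_right hξ 1 (D.coord b y ω)) measurable_inv).symm
  have transfer : ∀ {S : Set ℝ≥0∞}, MeasurableSet S →
      ((∀ᵐ ω ∂D.refMeasure, ∫⁻ g, ρ g⁻¹ ω ∂m ∈ S) ↔ ∀ᵐ ω ∂stdGaussianPi ι,
        L.noiseIntegral (fun g => α.toHom g x -ᵥ y) m.inv 1 ω ∈ S) := by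
    intro S hS
    rw [D.ae_refMeasure_iff y, ← hmp.map_eq, ae_map_iff hmp.measurable.aemeasurable (hm hS)]
    simp_rw [hint]
  have hdiss := σ.isDissipative_iff m (D.equivalent x _) (D.equivalent _ x) (D.equivalent _ y)
    hρm hρ
  have hrec := σ.isRecurrent_iff m (D.equivalent x _) (D.equivalent _ x) (D.equivalent _ y)
    hρm hρ
  constructor
  · rw [hdiss]
    refine (transfer measurableSet_Iio).trans (eventually_congr (ae_of_all _ fun ω => ?_))
    rw [L.noiseIntegral_smul_measure]
    exact ⟨fun h => ENNReal.mul_lt_top hc1.lt_top h,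
      fun h => ENNReal.lt_top_of_mul_ne_top_right h.ne hc0⟩
  · rw [hrec]
    refine (transfer (measurableSet_singleton ∞)).trans
      (eventually_congr (ae_of_all _ fun ω => ?_))
    rw [L.noiseIntegral_smul_measure, Set.mem_singleton_iff]
    refine ⟨fun h => by rw [h, ENNReal.mul_top hc0], fun h => ?_⟩
    by_contra hne
    exact ENNReal.mul_ne_top hc1 hne h

theorem IsRightHaarMeasure.sFinite {r : Measure G} (hr : IsRightHaarMeasure r) : SFinite r := by
  have := hr.isHaarMeasure_inv
  rw [← r.inv_inv]
  infer_instance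

/-- The criterion for the inflated actions. -/
theorem GaussianAction.criterion_inflate (L : WhiteNoise b) {α : AffineIsometricAction G V P}
    (t : {t : ℝ // 0 < t}) {D : GaussianDensity V (Inflation t P) X}
    (σ : GaussianAction (α.inflate t) D) (m : Measure G) [m.IsHaarMeasure]
    {r : Measure G} (hr : IsRightHaarMeasure r) (x y : P) :
    (σ.IsDissipative m ↔
      ∀ᵐ ω ∂stdGaussianPi ι, L.noiseIntegral (fun g => α.toHom g x -ᵥ y) r t ω < ∞) ∧
    (σ.IsRecurrent m ↔
      ∀ᵐ ω ∂stdGaussianPi ι, L.noiseIntegral (fun g => α.toHom g x -ᵥ y) r t ω = ∞) := by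
  have := hr.sFinite
  have h := σ.criterion L m hr ⟨x⟩ ⟨y⟩
  have hsmul := L.ae_noiseIntegral_smul (α.measurable_vsub x y) r t.1
  have heq : (fun g => (α.inflate t).toHom g ⟨x⟩ -ᵥ (⟨y⟩ : Inflation t P)) =
      fun g => t.1 • (α.toHom g x -ᵥ y) := rfl
  rw [heq] at h
  exact ⟨h.1.trans (eventually_congr (hsmul.mono fun ω hω => by rw [hω])),
    h.2.trans (eventually_congr (hsmul.mono fun ω hω => by rw [hω]))⟩

end Transfer

/-! ### Local averages: from half moments to integrability. -/

theorem ENNReal.rpow_half_mul_self (a : ℝ≥0∞) : a ^ (1 / 2 : ℝ) * a ^ (1 / 2 : ℝ) = a := by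
  rw [← ENNReal.rpow_add_of_nonneg _ _ (by norm_num) (by norm_num)]
  norm_num

/-- A form of the inequality of arithmetic and geometric means. -/
theorem ENNReal.rpow_half_le_eexp_add (a : ℝ≥0∞) (κ : ℝ) :
    a ^ (1 / 2 : ℝ) ≤ eexp κ + a * eexp (-κ) := by
  rcases le_total (a ^ (1 / 2 : ℝ)) (eexp κ) with h | h
  · exact h.trans le_self_add
  · refine le_trans ?_ le_add_self
    calc a ^ (1 / 2 : ℝ) = a ^ (1 / 2 : ℝ) * (eexp κ * eexp (-κ)) := by
          rw [← eexp_add, add_neg_cancel, eexp_zero, mul_one]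
      _ ≤ a ^ (1 / 2 : ℝ) * (a ^ (1 / 2 : ℝ) * eexp (-κ)) := by gcongr
      _ = a * eexp (-κ) := by rw [← mul_assoc, ENNReal.rpow_half_mul_self]

section LocalAverage

variable {G : Type*} [Group G] [MeasurableSpace G]

/-- The average `∫_S F(gu) dm(u)` over the translate `gS`. -/
noncomputable def localAverage (m : Measure G) (S : Set G) (F : G → ℝ≥0∞) (g : G) : ℝ≥0∞ :=
  ∫⁻ u in S, F (g * u) ∂m

/-- By left invariance both sides integrate `F` over translates, and `hUW` says that `gU` lies in
`hW`. -/
theorem localAverage_le [MeasurableMul G] (m : Measure G) [m.IsMulLeftInvariant] {U W : Set G}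
    (hU : MeasurableSet U) (hW : MeasurableSet W) (F : G → ℝ≥0∞) {g h : G}
    (hUW : ∀ v ∈ U, h⁻¹ * g * v ∈ W) : localAverage m U F g ≤ localAverage m W F h := by
  have h1 : localAverage m W F h = ∫⁻ v, W.indicator (fun w => F (h * w)) (h⁻¹ * g * v) ∂m := by
    rw [localAverage, ← lintegral_indicator hW,
      lintegral_mul_left_eq_self (fun v => W.indicator (fun w => F (h * w)) v)]
  rw [h1, localAverage, ← lintegral_indicator hU]
  refine lintegral_mono fun v => ?_
  by_cases hv : v ∈ U
  · rw [Set.indicator_of_mem hv, Set.indicator_of_mem (hUW v hv)]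
    simp [mul_assoc]
  · simp [hv]

/-- Integrability of the square roots of the local averages implies integrability. -/
theorem lintegral_lt_top_of_rpow_localAverage [MeasurableMul₂ G] (m : Measure G)
    [m.IsMulLeftInvariant] [SFinite m] (r : Measure G) [r.IsMulRightInvariant] [SFinite r]
    {U W : Set G} (hU : MeasurableSet U) (hW : MeasurableSet W) (hU1 : 1 ∈ U) (hU0 : m U ≠ 0)
    (hUtop : m U ≠ ∞) (hUW : ∀ u ∈ U, ∀ v ∈ U, u⁻¹ * v ∈ W) {F : G → ℝ≥0∞} (hF : Measurable F)
    (hm : ∫⁻ g, localAverage m W F g ^ (1 / 2 : ℝ) ∂m < ∞)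
    (hr : ∫⁻ g, localAverage m W F g ^ (1 / 2 : ℝ) ∂r < ∞) : ∫⁻ g, F g ∂r < ∞ := by
  set Q := ∫⁻ g, localAverage m W F g ^ (1 / 2 : ℝ) ∂m with hQ
  have hmul : Measurable fun p : G × G => F (p.1 * p.2) := hF.comp measurable_mul
  have hle : ∀ g, ∀ u ∈ U, localAverage m U F g ≤ localAverage m W F (g * u) := fun g u hu =>
    localAverage_le m hU hW F fun v hv => by simpa using hUW u hu v hv
  -- A uniform bound: for each `u ∈ U` the average over `gU` is at most that over `guW`. Integrating
  -- square roots over `u` and using left invariance gives `Q`.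
  have hbound : ∀ g, m U * localAverage m U F g ^ (1 / 2 : ℝ) ≤ Q := by
    intro g
    calc m U * localAverage m U F g ^ (1 / 2 : ℝ)
        = ∫⁻ u in U, localAverage m U F g ^ (1 / 2 : ℝ) ∂m := by
          rw [setLIntegral_const, mul_comm]
      _ ≤ ∫⁻ u in U, localAverage m W F (g * u) ^ (1 / 2 : ℝ) ∂m :=
          setLIntegral_mono' hU fun u hu => ENNReal.rpow_le_rpow (hle g u hu) (by norm_num)
      _ ≤ ∫⁻ u, localAverage m W F (g * u) ^ (1 / 2 : ℝ) ∂m := setLIntegral_le_lintegral _ _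
      _ = Q := lintegral_mul_left_eq_self (fun g => localAverage m W F g ^ (1 / 2 : ℝ)) g
  -- This replaces ℓ^{1/2} ⊂ ℓ¹: one of the two square root factors is bounded, the other is
  -- integrable.
  have hbound' : ∀ g, m U * localAverage m U F g ≤ Q * localAverage m W F g ^ (1 / 2 : ℝ) := by
    intro g
    rw [← ENNReal.rpow_half_mul_self (localAverage m U F g), ← mul_assoc]
    refine mul_le_mul' (hbound g) (ENNReal.rpow_le_rpow ?_ (by norm_num))
    simpa using hle g 1 hU1
  -- Here right invariance of `r` enters: after Fubini the translation by `u` disappears.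
  have hfub : ∫⁻ g, localAverage m U F g ∂r = m U * ∫⁻ g, F g ∂r := by
    simp only [localAverage]
    rw [lintegral_lintegral_swap hmul.aemeasurable]
    simp_rw [lintegral_mul_right_eq_self F]
    rw [setLIntegral_const, mul_comm]
  have hfin : m U * (m U * ∫⁻ g, F g ∂r) < ∞ := by
    rw [← hfub, ← lintegral_const_mul' _ _ hUtop]
    refine (lintegral_mono hbound').trans_lt ?_
    rw [lintegral_const_mul' _ _ hm.ne]
    exact ENNReal.mul_lt_top hm hr
  have := ENNReal.lt_top_of_mul_ne_top_right hfin.ne hU0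
  exact ENNReal.lt_top_of_mul_ne_top_right this.ne hU0

theorem WhiteNoise.measurable_localAverage {V ι : Type*} [NormedAddCommGroup V]
    [InnerProductSpace ℝ V] [MeasurableSpace V] [BorelSpace V] {b : HilbertBasis ι ℝ V}
    [MeasurableMul₂ G] (L : WhiteNoise b) {ξ : G → V} (hξ : Measurable ξ) (m : Measure G) [SFinite m] (W : Set G) (t : ℝ) :
    Measurable fun p : G × (ι → ℝ) =>
      localAverage m W (fun h => gaussWeight t (ξ h) (L.toFun p.2 (ξ h))) p.1 := by
  have h1 : Measurable fun q : (G × (ι → ℝ)) × G => ξ (q.1.1 * q.2) := hξ.comp (by fun_prop)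
  have h2 : Measurable fun q : (G × (ι → ℝ)) × G => L.toFun q.1.2 (ξ (q.1.1 * q.2)) :=
    L.measurable.comp ((measurable_snd.comp measurable_fst).prodMk h1)
  exact (h1.gaussWeight h2 t).lintegral_prod_right'

end LocalAverage

/-! ### Half moments and almost sure finiteness above the Poincaré exponent. -/

section Dissipative

variable {G V P ι : Type*} [Group G] [TopologicalSpace G] [MeasurableSpace G] [BorelSpace G]
  [NormedAddCommGroup V] [InnerProductSpace ℝ V]
  [MeasurableSpace V] [MetricSpace P] [NormedAddTorsor V P]
  {b : HilbertBasis ι ℝ V}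

/-- The half moment bound for a weight at a vector `ζ` near `ξ`. -/
theorem WhiteNoise.lintegral_gaussWeight_mul_eexp_le (L : WhiteNoise b) (t : ℝ) (ξ ζ : V) {c : ℝ}
    (hc : ‖ζ - ξ‖ ≤ c) :
    ∫⁻ ω, gaussWeight t ζ (L.toFun ω ζ) *
      eexp (-(-(t ^ 2 / 4) * ‖ξ‖ ^ 2 + t / 2 * L.toFun ω ξ)) ∂stdGaussianPi ι ≤
      eexp (-(t ^ 2 / 8) * ‖ξ‖ ^ 2 + t ^ 2 / 2 * c * ‖ξ‖) := by
  have h1 : ∀ᵐ ω ∂stdGaussianPi ι, gaussWeight t ζ (L.toFun ω ζ) *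
      eexp (-(-(t ^ 2 / 4) * ‖ξ‖ ^ 2 + t / 2 * L.toFun ω ξ)) =
      eexp (-(1 / 2) * t ^ 2 * ‖ζ‖ ^ 2 + t ^ 2 / 4 * ‖ξ‖ ^ 2) *
        eexp (t * L.toFun ω (ζ + (-(1 / 2 : ℝ)) • ξ)) := by
    filter_upwards [L.isonormal.add ζ ((-(1 / 2 : ℝ)) • ξ), L.isonormal.smul (-(1 / 2 : ℝ)) ξ]
      with ω h2 h3
    rw [h2, h3, gaussWeight, ← eexp_add, ← eexp_add]
    exact congrArg eexp (by ring)
  have hm := L.measurable_apply (ζ + (-(1 / 2 : ℝ)) • ξ)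
  rw [lintegral_congr_ae h1, lintegral_const_mul _ (by fun_prop),
    L.isonormal.lintegral_eexp_smul, ← eexp_add]
  refine eexp_le_eexp ?_
  -- Half of this cancels the `‖ζ‖²` term of the prefactor, so only `⟨ζ, ξ⟩` must be bounded from
  -- below.
  have h4 : ‖t • (ζ + (-(1 / 2 : ℝ)) • ξ)‖ ^ 2 =
      t ^ 2 * (‖ζ‖ ^ 2 - inner ℝ ζ ξ + ‖ξ‖ ^ 2 / 4) := by
    rw [norm_smul, mul_pow, Real.norm_eq_abs, sq_abs, norm_add_sq_real, inner_smul_right,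
      norm_smul, Real.norm_eq_abs, mul_pow, sq_abs]
    ring
  have h5 : ‖ξ‖ ^ 2 - c * ‖ξ‖ ≤ inner ℝ ζ ξ := by
    have h6 : inner ℝ ζ ξ = ‖ξ‖ ^ 2 + inner ℝ (ζ - ξ) ξ := by
      rw [inner_sub_left, real_inner_self_eq_norm_sq]
      ring
    have h7 := (abs_le.1 (abs_real_inner_le_norm (ζ - ξ) ξ)).1
    have h8 := mul_le_mul_of_nonneg_right hc (norm_nonneg ξ)
    linarith
  have h9 := mul_le_mul_of_nonneg_left h5 (by positivity : 0 ≤ t ^ 2 / 2)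
  rw [h4]
  nlinarith

variable [BorelSpace V]

/-- The square root of an average is linearized by the arithmetic-geometric mean inequality, with
the root of the weight at `g` as reference. Fubini then reduces to single vectors at distance at
most `c`, at the cost of a term linear in the norm. -/
theorem WhiteNoise.lintegral_rpow_localAverage_le [MeasurableMul₂ G] (L : WhiteNoise b)
    (α : AffineIsometricAction G V P) (m : Measure G) [SFinite m] {W : Set G}
    (hW : MeasurableSet W) (t : ℝ) (x y : P) {c : ℝ} (hc0 : 0 ≤ c)
    (hc : ∀ w ∈ W, dist (α.toHom w x) x ≤ c) (g : G) :
    ∫⁻ ω, localAverage m W (fun h => gaussWeight t (α.toHom h x -ᵥ y)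
      (L.toFun ω (α.toHom h x -ᵥ y))) g ^ (1 / 2 : ℝ) ∂stdGaussianPi ι ≤
      (1 + m W) * eexp (-(t ^ 2 / 8) * ‖α.toHom g x -ᵥ y‖ ^ 2 +
        t ^ 2 / 2 * c * ‖α.toHom g x -ᵥ y‖) := by
  have hξ := α.measurable_vsub x y
  set ξ : G → V := fun h => α.toHom h x -ᵥ y with hξdef
  -- `eexp (κ ω)` is the square root of the weight at `g`; its mean has exponent `-(t²/4) + t²/8 =
  -- -(t²/8)` times the squared norm.
  set κ : (ι → ℝ) → ℝ := fun ω => -(t ^ 2 / 4) * ‖ξ g‖ ^ 2 + t / 2 * L.toFun ω (ξ g) with hκ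
  have hmg := L.measurable_apply (ξ g)
  have hκm : Measurable κ := by fun_prop
  have hξg : Measurable fun q : (ι → ℝ) × G => ξ (g * q.2) := hξ.comp (by fun_prop)
  have hD : Measurable fun q : (ι → ℝ) × G =>
      gaussWeight t (ξ (g * q.2)) (L.toFun q.1 (ξ (g * q.2))) * eexp (-κ q.1) :=
    (hξg.gaussWeight (L.measurable.comp (measurable_fst.prodMk hξg)) t).mul
      (hκm.comp measurable_fst).neg.eexp
  calc ∫⁻ ω, localAverage m W (fun h => gaussWeight t (ξ h) (L.toFun ω (ξ h))) g ^ (1 / 2 : ℝ)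
        ∂stdGaussianPi ι
      ≤ ∫⁻ ω, (eexp (κ ω) + localAverage m W (fun h => gaussWeight t (ξ h) (L.toFun ω (ξ h))) g *
          eexp (-κ ω)) ∂stdGaussianPi ι :=
        lintegral_mono fun ω => ENNReal.rpow_half_le_eexp_add _ _
    _ = ∫⁻ ω, eexp (κ ω) ∂stdGaussianPi ι +
          ∫⁻ ω, ∫⁻ w in W, gaussWeight t (ξ (g * w)) (L.toFun ω (ξ (g * w))) * eexp (-κ ω) ∂m
            ∂stdGaussianPi ι := by
        rw [lintegral_add_left hκm.eexp]
        congr 1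
        refine lintegral_congr fun ω => ?_
        rw [lintegral_mul_const' _ _ (eexp_ne_top _), localAverage]
    _ = ∫⁻ ω, eexp (κ ω) ∂stdGaussianPi ι +
          ∫⁻ w in W, ∫⁻ ω, gaussWeight t (ξ (g * w)) (L.toFun ω (ξ (g * w))) * eexp (-κ ω)
            ∂stdGaussianPi ι ∂m := by
        rw [lintegral_lintegral_swap hD.aemeasurable]
    _ ≤ eexp (-(t ^ 2 / 8) * ‖ξ g‖ ^ 2 + t ^ 2 / 2 * c * ‖ξ g‖) +
          ∫⁻ w in W, eexp (-(t ^ 2 / 8) * ‖ξ g‖ ^ 2 + t ^ 2 / 2 * c * ‖ξ g‖) ∂m := by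
        refine add_le_add ?_ (setLIntegral_mono' hW fun w hw => ?_)
        · simp_rw [hκ, eexp_add]
          rw [lintegral_const_mul _ (by fun_prop), L.isonormal.lintegral_eexp_smul, ← eexp_add,
            ← eexp_add]
          refine eexp_le_eexp ?_
          rw [norm_smul, mul_pow, Real.norm_eq_abs, sq_abs]
          have : 0 ≤ t ^ 2 / 2 * c * ‖ξ g‖ := by positivity
          linarith
        · refine L.lintegral_gaussWeight_mul_eexp_le t (ξ g) (ξ (g * w)) ?_
          rw [hξdef, vsub_sub_vsub_cancel_right, ← dist_eq_norm_vsub V, map_mul]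
          exact ((α.toHom g).dist_map _ _).trans_le (hc w hw)
    _ = _ := by
        rw [setLIntegral_const]
        ring

/-- A linear term is absorbed by a change of the Gaussian exponent. -/
theorem exists_quadratic_add_linear_le {s s' : ℝ} (hs : s < s') (k : ℝ) :
    ∃ C : ℝ, ∀ d : ℝ, -s' * d ^ 2 + k * d ≤ C + -s * d ^ 2 := by
  refine ⟨k ^ 2 / (4 * (s' - s)), fun d => ?_⟩
  have hpos : 0 < s' - s := sub_pos.2 hs
  have h1 : k ^ 2 / (4 * (s' - s)) - k * d + (s' - s) * d ^ 2 =
      (2 * (s' - s) * d - k) ^ 2 / (4 * (s' - s)) := by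
    field_simp
    ring
  have h2 : 0 ≤ (2 * (s' - s) * d - k) ^ 2 / (4 * (s' - s)) := by positivity
  linarith

open scoped Pointwise in
/-- Convergence of the Poincaré integral at some `s < t² / 8` makes the Gaussian integral at `t`
almost surely finite. -/
theorem WhiteNoise.ae_noiseIntegral_lt_top [IsTopologicalGroup G] [LocallyCompactSpace G]
    [SecondCountableTopology G] (L : WhiteNoise b) (α : AffineIsometricAction G V P)
    (m : Measure G) [m.IsHaarMeasure] {r : Measure G} (hr : IsRightHaarMeasure r) {s t : ℝ}
    (hst : s < t ^ 2 / 8) (x y : P)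
    (hm : ∫⁻ g, eexp (-s * ‖α.toHom g x -ᵥ y‖ ^ 2) ∂m < ∞)
    (hr' : ∫⁻ g, eexp (-s * ‖α.toHom g x -ᵥ y‖ ^ 2) ∂r < ∞) :
    ∀ᵐ ω ∂stdGaussianPi ι, L.noiseIntegral (fun g => α.toHom g x -ᵥ y) r t ω < ∞ := by
  have := hr.sFinite
  have := hr.rightInvariant
  have hξ := α.measurable_vsub x y
  obtain ⟨K, hK, hK1⟩ := exists_compact_mem_nhds (1 : G)
  set U : Set G := interior K with hU
  have hU1 : 1 ∈ U := mem_interior_iff_mem_nhds.2 hK1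
  have hUm : MeasurableSet U := isOpen_interior.measurableSet
  -- Taking the closure keeps `K⁻¹K` compact and makes it measurable.
  set W : Set G := closure (K⁻¹ * K) with hWdef
  have hWc : IsCompact W := (hK.inv.mul hK).closure
  have hWm : MeasurableSet W := isClosed_closure.measurableSet
  have hUW : ∀ u ∈ U, ∀ v ∈ U, u⁻¹ * v ∈ W := fun u hu v hv =>
    subset_closure (Set.mul_mem_mul (Set.inv_mem_inv.2 (interior_subset hu)) (interior_subset hv))
  have hU0 : m U ≠ 0 := (isOpen_interior.measure_pos m ⟨1, hU1⟩).ne'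
  have hUtop : m U ≠ ∞ := ((measure_mono interior_subset).trans_lt hK.measure_lt_top).ne
  obtain ⟨c, hc⟩ : ∃ c, ∀ w ∈ W, dist (α.toHom w x) x ≤ c := by
    obtain ⟨c, hc⟩ := hWc.bddAbove_image
      (f := fun w => dist (α.toHom w x) x) ((α.continuous_orbit x).dist continuous_const).continuousOn
    exact ⟨c, fun w hw => hc ⟨w, hw, rfl⟩⟩
  have hc0 : 0 ≤ c := dist_nonneg.trans (hc _ (hUW 1 hU1 1 hU1))
  -- The gap between `s` and `t² / 8` absorbs the linear term due to the displacement over `W`.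
  obtain ⟨C, hC⟩ := exists_quadratic_add_linear_le hst (t ^ 2 / 2 * c)
  have hmeas := L.measurable_localAverage hξ m W t
  have key : ∀ (n : Measure G) [SFinite n],
      ∫⁻ g, eexp (-s * ‖α.toHom g x -ᵥ y‖ ^ 2) ∂n < ∞ → ∀ᵐ ω ∂stdGaussianPi ι,
        ∫⁻ g, localAverage m W (fun h => gaussWeight t (α.toHom h x -ᵥ y)
          (L.toFun ω (α.toHom h x -ᵥ y))) g ^ (1 / 2 : ℝ) ∂n < ∞ := by
    intro n _ hn
    refine ae_lt_top (hmeas.pow_const (1 / 2 : ℝ)).lintegral_prod_left' (ne_of_lt ?_)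
    rw [lintegral_lintegral_swap (f := fun ω g => localAverage m W (fun h =>
      gaussWeight t (α.toHom h x -ᵥ y) (L.toFun ω (α.toHom h x -ᵥ y))) g ^ (1 / 2 : ℝ))
      ((hmeas.pow_const (1 / 2 : ℝ)).comp measurable_swap).aemeasurable]
    have hD : (1 + m W) * eexp C < ∞ :=
      ENNReal.mul_lt_top (ENNReal.add_lt_top.2 ⟨ENNReal.one_lt_top, hWc.measure_lt_top⟩)
        (eexp_lt_top C)
    calc _ ≤ ∫⁻ g, (1 + m W) * eexp C * eexp (-s * ‖α.toHom g x -ᵥ y‖ ^ 2) ∂n := by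
          refine lintegral_mono fun g =>
            (L.lintegral_rpow_localAverage_le α m hWm t x y hc0 hc g).trans ?_
          rw [mul_assoc (1 + m W), ← eexp_add]
          gcongr
          exact eexp_le_eexp (hC _)
      _ = (1 + m W) * eexp C * ∫⁻ g, eexp (-s * ‖α.toHom g x -ᵥ y‖ ^ 2) ∂n :=
          lintegral_const_mul' _ _ hD.ne
      _ < ∞ := ENNReal.mul_lt_top hD hn
  filter_upwards [key m hm, key r hr'] with ω h1 h2
  exact lintegral_lt_top_of_rpow_localAverage m r hUm hWm hU1 hU0 hUtop hUW
    (L.measurable_integrand_right hξ t ω) h1 h2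

end Dissipative

/-! ### The threshold and its two bounds. -/

theorem ENNReal.two_mul_rpow_half_le {a : ℝ≥0∞} {t : ℝ} (ht : 0 ≤ t)
    (h : a ≤ ENNReal.ofReal (t ^ 2 / 2)) : (2 * a) ^ (1 / 2 : ℝ) ≤ ENNReal.ofReal t := by
  have h1 : 2 * a ≤ ENNReal.ofReal (t ^ 2) := by
    calc 2 * a ≤ ENNReal.ofReal 2 * ENNReal.ofReal (t ^ 2 / 2) := by
          rw [ENNReal.ofReal_ofNat]
          gcongr
      _ = ENNReal.ofReal (t ^ 2) := by
          rw [← ENNReal.ofReal_mul (by norm_num)]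
          congr 1
          ring
  calc (2 * a) ^ (1 / 2 : ℝ) ≤ ENNReal.ofReal (t ^ 2) ^ (1 / 2 : ℝ) :=
        ENNReal.rpow_le_rpow h1 (by norm_num)
    _ = ENNReal.ofReal t := by
        rw [ENNReal.ofReal_rpow_of_nonneg (by positivity) (by norm_num), ← Real.sqrt_eq_rpow,
          Real.sqrt_sq ht]

theorem ENNReal.lt_of_two_mul_two_mul_rpow_half_lt {a : ℝ≥0∞} {t : ℝ}
    (h : 2 * (2 * a) ^ (1 / 2 : ℝ) < ENNReal.ofReal t) : a < ENNReal.ofReal (t ^ 2 / 8) := by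
  have ht : 0 < t := ENNReal.ofReal_pos.1 (pos_of_gt h)
  by_contra hle
  rw [not_lt] at hle
  refine absurd h (not_lt.2 ?_)
  have h1 : ENNReal.ofReal ((t / 2) ^ 2) ≤ 2 * a := by
    calc ENNReal.ofReal ((t / 2) ^ 2) = ENNReal.ofReal 2 * ENNReal.ofReal (t ^ 2 / 8) := by
          rw [← ENNReal.ofReal_mul (by norm_num)]
          congr 1
          ring
      _ ≤ 2 * a := by
          rw [ENNReal.ofReal_ofNat]
          gcongr
  calc ENNReal.ofReal t = ENNReal.ofReal 2 * ENNReal.ofReal (t / 2) := by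
        rw [← ENNReal.ofReal_mul (by norm_num)]
        congr 1
        ring
    _ = 2 * ENNReal.ofReal ((t / 2) ^ 2) ^ (1 / 2 : ℝ) := by
        rw [ENNReal.ofReal_rpow_of_nonneg (by positivity) (by norm_num), ← Real.sqrt_eq_rpow,
          Real.sqrt_sq (by positivity), ENNReal.ofReal_ofNat]
    _ ≤ 2 * (2 * a) ^ (1 / 2 : ℝ) := by
        gcongr

section Threshold

variable {G V P ι : Type*} [Group G] [TopologicalSpace G] [IsTopologicalGroup G]
  [LocallyCompactSpace G] [SecondCountableTopology G] [MeasurableSpace G] [BorelSpace G]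
  [NormedAddCommGroup V] [InnerProductSpace ℝ V] [MeasurableSpace V]
  [MetricSpace P] [NormedAddTorsor V P] {b : HilbertBasis ι ℝ V}

/-- The infimum of the parameters `t` at which the Gaussian integral is almost surely finite. -/
noncomputable def WhiteNoise.threshold (L : WhiteNoise b) (α : AffineIsometricAction G V P)
    (r : Measure G) (x y : P) : ℝ≥0∞ :=
  sInf {a : ℝ≥0∞ | ∃ t : ℝ, 0 < t ∧ a = ENNReal.ofReal t ∧
    ∀ᵐ ω ∂stdGaussianPi ι, L.noiseIntegral (fun g => α.toHom g x -ᵥ y) r t ω < ∞}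

variable [BorelSpace V] (L : WhiteNoise b) (α : AffineIsometricAction G V P) {r : Measure G}

theorem WhiteNoise.ae_noiseIntegral_eq_top_of_lt_threshold
    (hr : IsRightHaarMeasure r) (x y : P) {t : ℝ} (ht : 0 < t)
    (h : ENNReal.ofReal t < L.threshold α r x y) :
    ∀ᵐ ω ∂stdGaussianPi ι, L.noiseIntegral (fun g => α.toHom g x -ᵥ y) r t ω = ∞ := by
  have := hr.sFinite
  obtain ⟨c, htc, hc⟩ := ENNReal.lt_iff_exists_nnreal_btwn.1 h
  rw [← ENNReal.ofReal_coe_nnreal] at htc hc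
  have htc' := ENNReal.ofReal_lt_ofReal_iff'.1 htc
  -- Almost sure finiteness at `c` would put the threshold at or below `c`; its failure there forces
  -- infinity at the smaller `t`.
  exact L.ae_noiseIntegral_eq_top (α.measurable_vsub x y) r ht htc'.1
    fun hfin => not_le.2 hc (sInf_le ⟨c, htc'.2, rfl, hfin⟩)

theorem WhiteNoise.ae_noiseIntegral_lt_top_of_threshold_lt
    (hr : IsRightHaarMeasure r) (x y : P) {t : ℝ}
    (h : L.threshold α r x y < ENNReal.ofReal t) :
    ∀ᵐ ω ∂stdGaussianPi ι, L.noiseIntegral (fun g => α.toHom g x -ᵥ y) r t ω < ∞ := by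
  have := hr.sFinite
  obtain ⟨_, ⟨s, hs, rfl, hfin⟩, hst⟩ := sInf_lt_iff.1 h
  by_contra hcon
  have htop := L.ae_noiseIntegral_eq_top (α.measurable_vsub x y) r hs
    (ENNReal.ofReal_lt_ofReal_iff'.1 hst).1 hcon
  obtain ⟨ω, h1, h2⟩ := (hfin.and htop).exists
  exact h1.ne h2

theorem WhiteNoise.two_mul_poincareExponent_rpow_half_le_threshold
    (hr : IsRightHaarMeasure r) (x y : P) :
    (2 * poincareExponent α r x y) ^ (1 / 2 : ℝ) ≤ L.threshold α r x y := by
  have := hr.sFinite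
  refine le_sInf ?_
  rintro _ ⟨t, ht, rfl, hfin⟩
  refine ENNReal.two_mul_rpow_half_le ht.le (poincareExponent_le α (by positivity) ?_)
  exact L.lintegral_eexp_lt_top_of_ae_noiseIntegral (α.measurable_vsub x y) r hfin

theorem WhiteNoise.threshold_le (hr : IsRightHaarMeasure r) (x y : P) :
    L.threshold α r x y ≤ 2 * (2 * poincareExponent α r x y) ^ (1 / 2 : ℝ) := by
  refine le_of_forall_gt_imp_ge_of_dense fun a ha => ?_
  obtain ⟨t, hlt, hta⟩ := ENNReal.lt_iff_exists_nnreal_btwn.1 ha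
  rw [← ENNReal.ofReal_coe_nnreal] at hlt hta
  refine le_trans (sInf_le ⟨t, ENNReal.ofReal_pos.1 (pos_of_gt hlt), rfl, ?_⟩) hta.le
  -- An `s` strictly between the exponent and `t² / 8` gives convergence for both left and right
  -- Haar measures, as the local average argument needs.
  obtain ⟨s, hs, hst⟩ := ENNReal.lt_iff_exists_nnreal_btwn.1
    (ENNReal.lt_of_two_mul_two_mul_rpow_half_lt hlt)
  rw [← ENNReal.ofReal_coe_nnreal] at hs hst
  have hs' : poincareExponent α (Measure.haar : Measure G) x y < ENNReal.ofReal s := by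
    rwa [poincareExponent_eq α (Or.inl inferInstance) (Or.inr hr) x y x y]
  exact L.ae_noiseIntegral_lt_top α Measure.haar hr (ENNReal.ofReal_lt_ofReal_iff'.1 hst).1 x y
    (lintegral_eexp_lt_top_of_poincareExponent_lt α (Or.inl inferInstance)
      (Or.inl inferInstance) hs' x y)
    (lintegral_eexp_lt_top_of_poincareExponent_lt α (Or.inl inferInstance) (Or.inr hr) hs' x y)

end Threshold

theorem isRightHaarMeasure_inv {G : Type*} [Group G] [TopologicalSpace G] [IsTopologicalGroup G]
    [MeasurableSpace G] [BorelSpace G] (m : Measure G) [m.IsHaarMeasure] :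
    IsRightHaarMeasure m.inv where
  finiteOnCompacts := inferInstance
  rightInvariant := inferInstance
  openPos := inferInstance

theorem theoremB {G V P : Type*}
    [Group G] [TopologicalSpace G] [IsTopologicalGroup G] [T2Space G] [LocallyCompactSpace G]
    [SecondCountableTopology G] [MeasurableSpace G] [BorelSpace G]
    [NormedAddCommGroup V] [InnerProductSpace ℝ V] [CompleteSpace V]
    [TopologicalSpace.SeparableSpace V] [MeasurableSpace V] [BorelSpace V]
    [MetricSpace P] [NormedAddTorsor V P]
    (α : AffineIsometricAction G V P) :
    -- the Gaussian actions `α̂^t` and the Gaussian space of `V` exist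
    (∀ t : {t : ℝ // 0 < t}, ∃ (X : Type) (_ : MeasurableSpace X) (_ : StandardBorelSpace X)
        (D : GaussianDensity V (Inflation t P) X), Nonempty (GaussianAction (α.inflate t) D)) ∧
    (∃ (Ω : Type) (_ : MeasurableSpace Ω) (_ : StandardBorelSpace Ω)
        (D : GaussianDensity V V Ω), Nonempty (GaussianPairing D)) ∧
    ∃ δ tdiss : ℝ≥0∞,
      -- `δ` is the Poincaré exponent, for any choice of points and of a left or right Haar measure
      (∀ (m : Measure G) (x y : P), m.IsHaarMeasure ∨ IsRightHaarMeasure m →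
        poincareExponent α m x y = δ) ∧
      -- `tdiss` is a threshold between recurrence and dissipativity
      (∀ (t : {t : ℝ // 0 < t}) (X : Type*) [MeasurableSpace X] [StandardBorelSpace X]
          (D : GaussianDensity V (Inflation t P) X) (σ : GaussianAction (α.inflate t) D)
          (m : Measure G) [m.IsHaarMeasure],
        (ENNReal.ofReal t < tdiss → σ.IsRecurrent m) ∧
        (tdiss < ENNReal.ofReal t → σ.IsDissipative m)) ∧
      (2 * δ) ^ (1 / 2 : ℝ) ≤ tdiss ∧ tdiss ≤ 2 * (2 * δ) ^ (1 / 2 : ℝ) ∧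
      -- the integral criterion
      (∀ (t : {t : ℝ // 0 < t}) (X : Type*) [MeasurableSpace X] [StandardBorelSpace X]
          (D : GaussianDensity V (Inflation t P) X) (σ : GaussianAction (α.inflate t) D)
          (m : Measure G) [m.IsHaarMeasure]
          (Ω : Type*) [MeasurableSpace Ω] [StandardBorelSpace Ω]
          (E : GaussianDensity V V Ω) (L : GaussianPairing E)
          (r : Measure G) (x y : P), IsRightHaarMeasure r →
        (σ.IsDissipative m ↔ ∀ᵐ φ ∂E.refMeasure, gaussianIntegral α L r t x y φ < ∞) ∧
        (σ.IsRecurrent m ↔ ∀ᵐ φ ∂E.refMeasure, gaussianIntegral α L r t x y φ = ∞)) := by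
  -- One basis, one noise and one base point define the threshold; the criterion, valid for every
  -- density, action and Haar measure, makes it serve all of them.
  obtain ⟨ι, _, ⟨b⟩⟩ := exists_countable_hilbertBasis V
  obtain ⟨L⟩ := exists_whiteNoise b
  obtain ⟨x₀⟩ := AddTorsor.nonempty (G := V) (P := P)
  have hr₀ := isRightHaarMeasure_inv (Measure.haar : Measure G)
  have haction : ∀ t : {t : ℝ // 0 < t}, Nonempty
      (GaussianAction (α.inflate t) (L.gaussianDensity (⟨x₀⟩ : Inflation t P))) := fun t =>
    ⟨L.gaussianAction (⟨x₀⟩ : Inflation t P) (α.inflate t)⟩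
  refine ⟨fun t => ⟨ι → ℝ, inferInstance, inferInstance, _, haction t⟩,
    ⟨ι → ℝ, inferInstance, inferInstance, _, ⟨L.gaussianPairing⟩⟩,
    poincareExponent α (Measure.haar : Measure G).inv x₀ x₀,
    L.threshold α (Measure.haar : Measure G).inv x₀ x₀,
    fun m x y hm => poincareExponent_eq α hm (Or.inr hr₀) x y x₀ x₀, ?_,
    L.two_mul_poincareExponent_rpow_half_le_threshold α hr₀ x₀ x₀,
    L.threshold_le α hr₀ x₀ x₀, ?_⟩
  · intro t X _ _ D σ m _
    have hcrit := σ.criterion_inflate L t m hr₀ x₀ x₀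
    exact ⟨fun h => hcrit.2.2 (L.ae_noiseIntegral_eq_top_of_lt_threshold α hr₀ x₀ x₀ t.2 h),
      fun h => hcrit.1.2 (L.ae_noiseIntegral_lt_top_of_threshold_lt α hr₀ x₀ x₀ h)⟩
  · intro t X _ _ D σ m _ Ω _ _ E K r x y hr
    have := hr.sFinite
    have hcrit := σ.criterion_inflate L t m hr x y
    exact ⟨hcrit.1.trans (ae_gaussianIntegral_iff L α K r t x y measurableSet_Iio).symm,
      hcrit.2.trans (ae_gaussianIntegral_iff L α K r t x y (measurableSet_singleton ∞)).symm⟩
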